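/- **Conventions.** A *map* is a connected graph (loops and multiple edges allowed) embedded in the oriented sphere with simply connected faces, whose vertices are coloured black and white so that each edge joins a black and a white vertex; besides its edges it may carry *half-edges*, each incident to a single vertex, all lying in one face, called the *infinite face*. A map is rooted at one of its half-edges, and maps are considered up to orientation-preserving homeomorphisms that preserve colours and root. Half-edges at black vertices are called *buds*, those at white vertices *leaves*. The degree of a vertex is the number of edges and half-edges incident to it. The *degree distribution* of a map is the pair $(\lambda,\mu)$, where $\lambda$ (resp. $\mu$) is the multiset of the degrees of the white (resp. black) vertices. A *$k$-leg map* is a map with exactly $k$ leaves and no bud. A *tree* is a map with a single face; its *total charge* is its number of leaves minus its number of buds. Walking around the infinite face in counterclockwise direction means walking around the map drawn in the plane with the infinite face on the right. **Blossom trees.** Cutting an edge $e$ of a tree $T$ into two half-edges leaves two subtrees; the one that does not contain the root of $T$ is the *lower subtree* at $e$, and it is rooted at its half of $e$. Its *charge* is its number of leaves minus its number of buds, the half-edge coming from $e$ not being counted. $T$ is a *blossom tree* if every lower subtree has charge at most $1$ when its half of $e$ is attached to a black vertex, and nonnegative charge when it is attached to a white vertex. **Closure.** Let $T$ be a tree of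 positive total charge $k$. The half-edges of $T$ form a cyclic sequence in counterclockwise direction around $T$. Match every bud that is immediately followed by a leaf with this leaf; forget the matched buds and leaves, and repeat until no further matching is possible. The $k$ leaves that remain unmatched are called *single*. A tree is *balanced* if it is rooted at a single leaf. The *closure* of a balanced tree is obtained by fusing each matched pair of a bud and a leaf into an edge, in counterclockwise direction around the tree; the root is unchanged. **Opening.** Let $M$ be a $k$-leg map. Walk around the infinite face in counterclockwise direction, starting from the root. Each time an edge has just been visited from its black to its white endpoint and is non-separating (its deletion does not disconnect the current map), cut it into a bud at its black endpoint and a leaf at its white endpoint, and continue the walk from the white endpoint. Stop as soon as all edges are separating. The result, with the same root, is the *opening* of $M$. **Theorem.** Let $m\ge 3$ be an integer. Closure and opening are inverse bijections between the set of balanced blossom trees of total charge $m$ in which the degrees of all vertices are multiples of $m$, and the set of $m$-leg maps in which the degrees of all vertices are multiples of $m$. Moreover, closure and opening preserve the degree distribution $(\lambda,\mu)$. -/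

import Mathlib

/-- A bicoloured combinatorial map with half-edges, rooted at a half-edge, on the set `D` of darts
(vertex-edge incidences).  `rot` is the counterclockwise rotation of the darts around their
vertices; `opp` exchanges the two darts of an edge, and its fixed points are the half-edges, each
incident to a single vertex.  The vertices are black or white, and every edge joins two vertices of
different colours.  Connectedness and planarity are imposed separately in `IsMap`. -/
structure HalfEdgeMap (D : Type) where
  rot : Equiv.Perm D
  opp : Equiv.Perm D
  opp_opp : ∀ d, opp (opp d) = d
  black : D → Prop
  black_rot : ∀ d, black (rot d) ↔ black d
  black_opp : ∀ d, opp d ≠ d → (black (opp d) ↔ ¬ black d)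
  root : D
  opp_root : opp root = root

namespace HalfEdgeMap

section Basic

variable {D : Type}

def IsHalfEdge (M : HalfEdgeMap D) (d : D) : Prop := M.opp d = d

/-- A bud is a half-edge that hangs from a black vertex. -/
def IsBud (M : HalfEdgeMap D) (d : D) : Prop := M.IsHalfEdge d ∧ M.black d

/-- A leaf is a half-edge that hangs from a white vertex. -/
def IsLeaf (M : HalfEdgeMap D) (d : D) : Prop := M.IsHalfEdge d ∧ ¬ M.black d

/-- The walk around the faces: travel along the dart `d` (going back and forth if it is a
half-edge), then take the next dart counterclockwise around the vertex that has been reached.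
The face that is followed lies to the right of the darts, so that the infinite face is followed in
counterclockwise direction around the map. -/
def face (M : HalfEdgeMap D) : Equiv.Perm D := M.rot * M.opp

/-- Two darts are linked if they lie in the same connected component (the darts of a finite map
being permuted by `rot` and `opp`, this is a symmetric relation). -/
def Linked (M : HalfEdgeMap D) : D → D → Prop :=
  Relation.ReflTransGen (fun x y => y = M.rot x ∨ y = M.opp x)

def IsConnected (M : HalfEdgeMap D) : Prop := ∀ x y, M.Linked x y

/-- The involution obtained from `opp` by turning `d` and `opp d` into fixed points. -/
noncomputable def cutFun (M : HalfEdgeMap D) (d : D) : D → D :=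
  open Classical in fun x => if x = d ∨ x = M.opp d then x else M.opp x

theorem cutFun_involutive (M : HalfEdgeMap D) (d : D) : Function.Involutive (M.cutFun d) := by
  intro x
  have h1 := M.opp_opp
  unfold cutFun
  by_cases h : x = d ∨ x = M.opp d
  · simp [h]
  · have h' : ¬ (M.opp x = d ∨ M.opp x = M.opp d) := by
      rintro (e | e)
      · exact h (Or.inr (by rw [← e, h1]))
      · exact h (Or.inl (M.opp.injective e))
    rw [if_neg h, if_neg h', h1]

/-- Cut the edge that contains the dart `d` into two half-edges (nothing happens if `d` is already
a half-edge). -/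
noncomputable def cut (M : HalfEdgeMap D) (d : D) : HalfEdgeMap D where
  rot := M.rot
  opp := (M.cutFun_involutive d).toPerm
  opp_opp := M.cutFun_involutive d
  black := M.black
  black_rot := M.black_rot
  black_opp := by
    intro x hx
    simp only [Function.Involutive.coe_toPerm, cutFun] at hx ⊢
    split_ifs at hx ⊢ with h
    · exact absurd rfl hx
    · exact M.black_opp x hx
  root := M.root
  opp_root := by
    simp only [Function.Involutive.coe_toPerm, cutFun]
    split_ifs
    · rfl
    · exact M.opp_root

/-- The edge that contains the dart `d` is separating: its deletion disconnects the map.  (Every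
vertex keeps at least one dart when the edge is cut, so it is the same to cut the edge.) -/
def IsSeparating (M : HalfEdgeMap D) (d : D) : Prop := ¬ (M.cut d).IsConnected

end Basic

section Counting

open Classical in
noncomputable def vertexOf {D : Type} [Fintype D] (M : HalfEdgeMap D) (d : D) : Finset D :=
  Finset.univ.filter fun x => M.rot.SameCycle d x

open Classical in
noncomputable def faceOf {D : Type} [Fintype D] (M : HalfEdgeMap D) (d : D) : Finset D :=
  Finset.univ.filter fun x => M.face.SameCycle d x

open Classical in
/-- The vertices, each given as the set of its darts: the degree of a vertex `v` is `v.card`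
(half-edges are counted). -/
noncomputable def vertices {D : Type} [Fintype D] (M : HalfEdgeMap D) : Finset (Finset D) :=
  Finset.univ.image M.vertexOf

open Classical in
noncomputable def whiteVertices {D : Type} [Fintype D] (M : HalfEdgeMap D) : Finset (Finset D) :=
  (Finset.univ.filter fun d => ¬ M.black d).image M.vertexOf

open Classical in
noncomputable def blackVertices {D : Type} [Fintype D] (M : HalfEdgeMap D) : Finset (Finset D) :=
  (Finset.univ.filter fun d => M.black d).image M.vertexOf

open Classical in
/-- The edges, each given as the set of its two darts; half-edges are not counted. -/
noncomputable def edges {D : Type} [Fintype D] (M : HalfEdgeMap D) : Finset (Finset D) :=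
  (Finset.univ.filter fun d => ¬ M.IsHalfEdge d).image fun d => {d, M.opp d}

open Classical in
noncomputable def faces {D : Type} [Fintype D] (M : HalfEdgeMap D) : Finset (Finset D) :=
  Finset.univ.image M.faceOf

open Classical in
noncomputable def leaves {D : Type} [Fintype D] (M : HalfEdgeMap D) : Finset D :=
  Finset.univ.filter M.IsLeaf

open Classical in
noncomputable def buds {D : Type} [Fintype D] (M : HalfEdgeMap D) : Finset D :=
  Finset.univ.filter M.IsBud

/-- The degree distribution `(lam, mu)`: the multisets of the degrees of the white vertices and of
the black vertices. -/
noncomputable def degreeDistribution {D : Type} [Fintype D] (M : HalfEdgeMap D) :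
    Multiset ℕ × Multiset ℕ :=
  (M.whiteVertices.val.map Finset.card, M.blackVertices.val.map Finset.card)

def DegreesDivisibleBy {D : Type} [Fintype D] (M : HalfEdgeMap D) (m : ℕ) : Prop :=
  ∀ v ∈ M.vertices, m ∣ v.card

/-- A bipartite planar map rooted at a half-edge, with all its half-edges in the infinite face
(the face that contains the root).  Planarity is Euler's relation. -/
structure IsMap {D : Type} [Fintype D] (M : HalfEdgeMap D) : Prop where
  connected : M.IsConnected
  euler : M.vertices.card + M.faces.card = M.edges.card + 2
  outer : ∀ d, M.IsHalfEdge d → M.face.SameCycle M.root d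

/-- A `k`-leg map: a map with exactly `k` leaves and no bud. -/
def IsLegMap {D : Type} [Fintype D] (M : HalfEdgeMap D) (k : ℕ) : Prop :=
  M.IsMap ∧ M.leaves.card = k ∧ M.buds.card = 0

/-- A tree: a map with only one face. -/
def IsTree {D : Type} [Fintype D] (M : HalfEdgeMap D) : Prop :=
  M.IsMap ∧ M.faces.card = 1

/-- Number of leaves minus number of buds, the root half-edge being counted. -/
noncomputable def totalCharge {D : Type} [Fintype D] (M : HalfEdgeMap D) : ℤ :=
  (M.leaves.card : ℤ) - M.buds.card

open Classical in
/-- The darts of the subtree obtained by cutting the edge that contains `d` and keeping the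
component of `d`; this subtree is rooted at the half-edge `d`. -/
noncomputable def subtree {D : Type} [Fintype D] (M : HalfEdgeMap D) (d : D) : Finset D :=
  Finset.univ.filter fun x => (M.cut d).Linked d x

open Classical in
/-- The charge of the subtree rooted at `d`: number of leaves minus number of buds, its root
half-edge `d` (which is not a half-edge of `M` itself) not being counted. -/
noncomputable def subtreeCharge {D : Type} [Fintype D] (M : HalfEdgeMap D) (d : D) : ℤ :=
  ((M.subtree d ∩ M.leaves).card : ℤ) - (M.subtree d ∩ M.buds).card

/-- A blossom tree: every lower subtree (a subtree, cut at an edge, that does not contain the root)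
has charge at most one if it is rooted at a black vertex, and nonnegative charge if it is rooted at
a white vertex. -/
def IsBlossomTree {D : Type} [Fintype D] (M : HalfEdgeMap D) : Prop :=
  M.IsTree ∧ ∀ d, ¬ M.IsHalfEdge d → M.root ∉ M.subtree d →
    (M.black d → M.subtreeCharge d ≤ 1) ∧ (¬ M.black d → 0 ≤ M.subtreeCharge d)

end Counting

section Closure

variable {D : Type}

/-- The first element of `S` that is met after `d` on the walk around the face of `d`. -/
noncomputable def nextIn (M : HalfEdgeMap D) (S : Set D) (d : D) : D :=
  (M.face ^ sInf {k : ℕ | 0 < k ∧ (M.face ^ k) d ∈ S}) d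

/-- Among the half-edges of `S`, the bud `b` is immediately followed by the leaf `l`. -/
def Consecutive (M : HalfEdgeMap D) (S : Set D) (b l : D) : Prop :=
  b ∈ S ∧ l ∈ S ∧ M.IsBud b ∧ M.IsLeaf l ∧ M.nextIn S b = l

/-- The half-edges that are still unmatched after `i` rounds of the matching procedure: in each
round, all pairs of an unmatched bud and an unmatched leaf that are immediately consecutive are
matched and forgotten. -/
def unmatched (M : HalfEdgeMap D) : ℕ → Set D
  | 0 => {d | M.IsHalfEdge d}
  | i + 1 => {d | d ∈ M.unmatched i ∧
      ∀ x, ¬ M.Consecutive (M.unmatched i) d x ∧ ¬ M.Consecutive (M.unmatched i) x d}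

/-- The bud `b` and the leaf `l` are matched in some round of the procedure. -/
def Matches (M : HalfEdgeMap D) (b l : D) : Prop := ∃ i, M.Consecutive (M.unmatched i) b l

/-- A single leaf is a leaf that is never matched. -/
def IsSingle (M : HalfEdgeMap D) (l : D) : Prop := M.IsLeaf l ∧ ∀ b, ¬ M.Matches b l

/-- A tree is balanced if its root is a single leaf. -/
def IsBalanced (M : HalfEdgeMap D) : Prop := M.IsSingle M.root

theorem nextIn_spec [Finite D] (M : HalfEdgeMap D) {S : Set D} {d : D} (hd : d ∈ S) :
    sInf {k : ℕ | 0 < k ∧ (M.face ^ k) d ∈ S} ∈ {k : ℕ | 0 < k ∧ (M.face ^ k) d ∈ S} := by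
  apply Nat.sInf_mem
  exact ⟨orderOf M.face, orderOf_pos _, by simpa [pow_orderOf_eq_one] using hd⟩

theorem nextIn_injOn [Finite D] (M : HalfEdgeMap D) (S : Set D) : Set.InjOn (M.nextIn S) S := by
  have key : ∀ x ∈ S, ∀ y ∈ S, M.nextIn S x = M.nextIn S y →
      sInf {k : ℕ | 0 < k ∧ (M.face ^ k) x ∈ S} ≤ sInf {k : ℕ | 0 < k ∧ (M.face ^ k) y ∈ S} →
      x = y := by
    intro x hx y hy h hle
    have hp := M.nextIn_spec hx
    unfold nextIn at h
    generalize sInf {k : ℕ | 0 < k ∧ (M.face ^ k) x ∈ S} = p at hp h hle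
    have hmin : ∀ k, 0 < k → (M.face ^ k) y ∈ S →
        sInf {k : ℕ | 0 < k ∧ (M.face ^ k) y ∈ S} ≤ k := fun k h1 h2 => Nat.sInf_le ⟨h1, h2⟩
    generalize sInf {k : ℕ | 0 < k ∧ (M.face ^ k) y ∈ S} = q at h hle hmin
    obtain ⟨r, rfl⟩ := Nat.exists_eq_add_of_le hle
    rw [pow_add, Equiv.Perm.mul_apply] at h
    have hxy : x = (M.face ^ r) y := (M.face ^ p).injective h
    rcases Nat.eq_zero_or_pos r with hr | hr
    · subst hr; simpa using hxy
    · have := hmin r hr (hxy ▸ hx)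
      have h0 : 0 < p := hp.1
      omega
  intro x hx y hy h
  rcases le_total (sInf {k : ℕ | 0 < k ∧ (M.face ^ k) x ∈ S})
    (sInf {k : ℕ | 0 < k ∧ (M.face ^ k) y ∈ S}) with hle | hle
  · exact key x hx y hy h hle
  · exact (key y hy x hx h.symm hle).symm

theorem unmatched_antitone (M : HalfEdgeMap D) : Antitone M.unmatched :=
  antitone_nat_of_succ_le fun _ _ h => h.1

/-- Two rounds in which the same half-edge is matched coincide. -/
theorem round_unique (M : HalfEdgeMap D) {d : D} {i j : ℕ}
    (hi : ∃ x, M.Consecutive (M.unmatched i) d x ∨ M.Consecutive (M.unmatched i) x d)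
    (hj : ∃ x, M.Consecutive (M.unmatched j) d x ∨ M.Consecutive (M.unmatched j) x d) :
    i = j := by
  have key : ∀ i j : ℕ,
      (∃ x, M.Consecutive (M.unmatched i) d x ∨ M.Consecutive (M.unmatched i) x d) →
      (∃ x, M.Consecutive (M.unmatched j) d x ∨ M.Consecutive (M.unmatched j) x d) →
      ¬ i < j := by
    rintro i j ⟨x, hx⟩ ⟨y, hy⟩ hlt
    have hd : d ∈ M.unmatched j := by
      rcases hy with hy | hy
      · exact hy.1
      · exact hy.2.1
    have h2 : d ∈ M.unmatched (i + 1) := M.unmatched_antitone (Nat.succ_le_of_lt hlt) hd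
    rcases hx with hx | hx
    · exact (h2.2 x).1 hx
    · exact (h2.2 x).2 hx
  have h1 := key i j hi hj
  have h2 := key j i hj hi
  omega

theorem matches_unique_right (M : HalfEdgeMap D) {b x y : D}
    (hx : M.Matches b x) (hy : M.Matches b y) : x = y := by
  obtain ⟨i, hi⟩ := hx
  obtain ⟨j, hj⟩ := hy
  obtain rfl := M.round_unique ⟨x, Or.inl hi⟩ ⟨y, Or.inl hj⟩
  rw [← hi.2.2.2.2, ← hj.2.2.2.2]

theorem matches_unique_left [Finite D] (M : HalfEdgeMap D) {l x y : D}
    (hx : M.Matches x l) (hy : M.Matches y l) : x = y := by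
  obtain ⟨i, hi⟩ := hx
  obtain ⟨j, hj⟩ := hy
  obtain rfl := M.round_unique ⟨x, Or.inr hi⟩ ⟨y, Or.inr hj⟩
  exact M.nextIn_injOn _ hi.1 hj.1 (hi.2.2.2.2.trans hj.2.2.2.2.symm)

theorem Matches.isBud {M : HalfEdgeMap D} {b l : D} (h : M.Matches b l) : M.IsBud b := by
  obtain ⟨_, h⟩ := h
  exact h.2.2.1

theorem Matches.isLeaf {M : HalfEdgeMap D} {b l : D} (h : M.Matches b l) : M.IsLeaf l := by
  obtain ⟨_, h⟩ := h
  exact h.2.2.2.1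

theorem partner_unique [Finite D] (M : HalfEdgeMap D) {d x y : D}
    (hx : M.Matches d x ∨ M.Matches x d) (hy : M.Matches d y ∨ M.Matches y d) : x = y := by
  rcases hx with hx | hx <;> rcases hy with hy | hy
  · exact M.matches_unique_right hx hy
  · exact absurd hx.isBud.2 hy.isLeaf.2
  · exact absurd hy.isBud.2 hx.isLeaf.2
  · exact M.matches_unique_left hx hy

/-- The half-edge matched with `d`, if there is one, and `opp d` otherwise. -/
noncomputable def closureFun (M : HalfEdgeMap D) (d : D) : D :=
  open Classical in
  if h : ∃ x, M.Matches d x ∨ M.Matches x d then h.choose else M.opp d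

theorem closureFun_of_matches [Finite D] (M : HalfEdgeMap D) {d x : D}
    (h : M.Matches d x ∨ M.Matches x d) : M.closureFun d = x := by
  have h' : ∃ x, M.Matches d x ∨ M.Matches x d := ⟨x, h⟩
  unfold closureFun
  rw [dif_pos h']
  exact M.partner_unique h'.choose_spec h

theorem closureFun_of_not (M : HalfEdgeMap D) {d : D}
    (h : ¬ ∃ x, M.Matches d x ∨ M.Matches x d) : M.closureFun d = M.opp d := by
  unfold closureFun
  rw [dif_neg h]

theorem isHalfEdge_of_matches (M : HalfEdgeMap D) {d x : D}
    (h : M.Matches d x ∨ M.Matches x d) : M.IsHalfEdge d := by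
  rcases h with h | h
  · exact h.isBud.1
  · exact h.isLeaf.1

theorem closureFun_involutive [Finite D] (M : HalfEdgeMap D) :
    Function.Involutive M.closureFun := by
  intro d
  by_cases h : ∃ x, M.Matches d x ∨ M.Matches x d
  · obtain ⟨x, hx⟩ := h
    rw [M.closureFun_of_matches hx, M.closureFun_of_matches hx.symm]
  · rw [M.closureFun_of_not h]
    by_cases hd : M.IsHalfEdge d
    · have hd' : M.opp d = d := hd
      rw [hd', M.closureFun_of_not h, hd']
    · rw [M.closureFun_of_not, M.opp_opp]
      rintro ⟨x, hx⟩
      have h2 : M.opp (M.opp d) = M.opp d := M.isHalfEdge_of_matches hx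
      exact hd (M.opp.injective h2)

open Classical in
/-- The closure: each bud is fused with the leaf it is matched with into an edge, and nothing else
changes.  The root is kept; it is only meant for balanced trees, whose root is unmatched (for the
sake of totality, the map is returned unchanged if the root is matched). -/
noncomputable def closure [Finite D] (M : HalfEdgeMap D) : HalfEdgeMap D :=
  if hroot : M.closureFun M.root = M.root then
    { rot := M.rot
      opp := M.closureFun_involutive.toPerm
      opp_opp := M.closureFun_involutive
      black := M.black
      black_rot := M.black_rot
      black_opp := by
        intro d hd
        simp only [Function.Involutive.coe_toPerm] at hd ⊢
        by_cases h : ∃ x, M.Matches d x ∨ M.Matches x d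
        · obtain ⟨x, hx⟩ := h
          rw [M.closureFun_of_matches hx]
          rcases hx with hx | hx
          · exact iff_of_false hx.isLeaf.2 (not_not.mpr hx.isBud.2)
          · exact iff_of_true hx.isBud.2 hx.isLeaf.2
        · rw [M.closureFun_of_not h] at hd ⊢
          exact M.black_opp d hd
      root := M.root
      opp_root := hroot }
  else M

end Closure

section Opening

variable {D : Type}

open Classical in
/-- One step of the walk that opens a map.  The state is the current map and the dart that is about
to be visited.  After the visit of a dart, which leads to its other endpoint, the walk goes on with
the next dart of the same face; if the visited dart leads from the black to the white endpoint of a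
non-separating edge, this edge is cut into a bud and a leaf. -/
noncomputable def openStep (s : HalfEdgeMap D × D) : HalfEdgeMap D × D :=
  (if s.1.black s.2 ∧ ¬ s.1.IsHalfEdge s.2 ∧ ¬ s.1.IsSeparating s.2 then s.1.cut s.2 else s.1,
    s.1.face s.2)

/-- The state after `n` steps of the walk around the infinite face, which starts at the root. -/
noncomputable def openState (M : HalfEdgeMap D) (n : ℕ) : HalfEdgeMap D × D :=
  openStep^[n] (M, M.root)

def AllSeparating (M : HalfEdgeMap D) : Prop := ∀ d, ¬ M.IsHalfEdge d → M.IsSeparating d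

/-- The opening: the walk is stopped as soon as all edges are separating. -/
noncomputable def opening (M : HalfEdgeMap D) : HalfEdgeMap D :=
  (M.openState (sInf {n : ℕ | (M.openState n).1.AllSeparating})).1

end Opening

section Isomorphism

variable {D D' : Type}

/-- The bijection `e` of the darts is an isomorphism of rooted bicoloured maps on the oriented
sphere. -/
structure IsIso (e : D ≃ D') (M : HalfEdgeMap D) (M' : HalfEdgeMap D') : Prop where
  rot : ∀ d, M'.rot (e d) = e (M.rot d)
  opp : ∀ d, M'.opp (e d) = e (M.opp d)
  black : ∀ d, M'.black (e d) ↔ M.black d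
  root : M'.root = e M.root

theorem IsIso.refl (M : HalfEdgeMap D) : IsIso (Equiv.refl D) M M :=
  ⟨fun _ => rfl, fun _ => rfl, fun _ => Iff.rfl, rfl⟩

theorem IsIso.symm {e : D ≃ D'} {M : HalfEdgeMap D} {M' : HalfEdgeMap D'} (h : IsIso e M M') :
    IsIso e.symm M' M where
  rot d := by rw [Equiv.eq_symm_apply, ← h.rot, Equiv.apply_symm_apply]
  opp d := by rw [Equiv.eq_symm_apply, ← h.opp, Equiv.apply_symm_apply]
  black d := by rw [← h.black, Equiv.apply_symm_apply]
  root := by rw [h.root, Equiv.symm_apply_apply]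

theorem IsIso.trans {D'' : Type} {e : D ≃ D'} {e' : D' ≃ D''} {M : HalfEdgeMap D}
    {M' : HalfEdgeMap D'} {M'' : HalfEdgeMap D''} (h : IsIso e M M') (h' : IsIso e' M' M'') :
    IsIso (e.trans e') M M'' where
  rot d := by simp [h'.rot, h.rot]
  opp d := by simp [h'.opp, h.opp]
  black d := by simp [h'.black, h.black]
  root := by simp [h'.root, h.root]

variable {e : D ≃ D'} {M : HalfEdgeMap D} {M' : HalfEdgeMap D'}

theorem IsIso.isHalfEdge (h : IsIso e M M') (d : D) : M'.IsHalfEdge (e d) ↔ M.IsHalfEdge d := by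
  simp [IsHalfEdge, h.opp]

theorem IsIso.isBud (h : IsIso e M M') (d : D) : M'.IsBud (e d) ↔ M.IsBud d := by
  simp [IsBud, h.isHalfEdge, h.black]

theorem IsIso.isLeaf (h : IsIso e M M') (d : D) : M'.IsLeaf (e d) ↔ M.IsLeaf d := by
  simp [IsLeaf, h.isHalfEdge, h.black]

theorem IsIso.face (h : IsIso e M M') (d : D) : M'.face (e d) = e (M.face d) := by
  simp [HalfEdgeMap.face, h.rot, h.opp]

theorem IsIso.face_pow (h : IsIso e M M') (k : ℕ) (d : D) :
    (M'.face ^ k) (e d) = e ((M.face ^ k) d) := by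
  induction k generalizing d with
  | zero => simp
  | succ k ih => rw [pow_succ, pow_succ, Equiv.Perm.mul_apply, Equiv.Perm.mul_apply, h.face, ih]

theorem IsIso.nextIn (h : IsIso e M M') {S : Set D} {S' : Set D'} (hS : ∀ x, e x ∈ S' ↔ x ∈ S)
    (d : D) : M'.nextIn S' (e d) = e (M.nextIn S d) := by
  simp only [HalfEdgeMap.nextIn, h.face_pow, hS]

theorem IsIso.consecutive (h : IsIso e M M') {S : Set D} {S' : Set D'}
    (hS : ∀ x, e x ∈ S' ↔ x ∈ S) (b l : D) :
    M'.Consecutive S' (e b) (e l) ↔ M.Consecutive S b l := by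
  simp [Consecutive, hS, h.isBud, h.isLeaf, h.nextIn hS]

theorem IsIso.unmatched (h : IsIso e M M') (i : ℕ) (d : D) :
    e d ∈ M'.unmatched i ↔ d ∈ M.unmatched i := by
  induction i generalizing d with
  | zero => exact h.isHalfEdge d
  | succ i ih =>
    simp only [HalfEdgeMap.unmatched, Set.mem_ofPred_eq, ih, e.surjective.forall,
      h.consecutive ih]

theorem IsIso.matches (h : IsIso e M M') (b l : D) :
    M'.Matches (e b) (e l) ↔ M.Matches b l := by
  simp only [Matches, h.consecutive (h.unmatched _)]

theorem IsIso.closureFun [Finite D] [Finite D'] (h : IsIso e M M') (d : D) :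
    M'.closureFun (e d) = e (M.closureFun d) := by
  by_cases hx : ∃ x, M.Matches d x ∨ M.Matches x d
  · obtain ⟨x, hx⟩ := hx
    rw [M.closureFun_of_matches hx]
    exact M'.closureFun_of_matches (by rwa [h.matches, h.matches])
  · rw [M.closureFun_of_not hx, M'.closureFun_of_not, h.opp]
    simpa only [e.surjective.exists, h.matches] using hx

theorem IsIso.closure [Finite D] [Finite D'] (h : IsIso e M M') :
    IsIso e M.closure M'.closure := by
  by_cases hr : M.closureFun M.root = M.root
  · have hr' : M'.closureFun M'.root = M'.root := by rw [h.root, h.closureFun, hr]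
    unfold HalfEdgeMap.closure
    rw [dif_pos hr, dif_pos hr']
    exact ⟨h.rot, h.closureFun, h.black, h.root⟩
  · have hr' : ¬ M'.closureFun M'.root = M'.root := by
      rw [h.root, h.closureFun]
      exact fun hh => hr (e.injective hh)
    unfold HalfEdgeMap.closure
    rw [dif_neg hr, dif_neg hr']
    exact h

theorem IsIso.cut (h : IsIso e M M') (d : D) : IsIso e (M.cut d) (M'.cut (e d)) where
  rot := h.rot
  opp x := by
    change M'.cutFun (e d) (e x) = e (M.cutFun d x)
    have hc : (e x = e d ∨ e x = M'.opp (e d)) ↔ (x = d ∨ x = M.opp d) := by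
      rw [h.opp, e.injective.eq_iff, e.injective.eq_iff]
    unfold cutFun
    by_cases hx : x = d ∨ x = M.opp d
    · rw [if_pos hx, if_pos (hc.mpr hx)]
    · rw [if_neg hx, if_neg (fun hh => hx (hc.mp hh)), h.opp]
  black := h.black
  root := h.root

theorem IsIso.linked (h : IsIso e M M') {x y : D} (hxy : M.Linked x y) :
    M'.Linked (e x) (e y) := by
  unfold Linked at hxy
  induction hxy with
  | refl => exact Relation.ReflTransGen.refl
  | tail _ hs ih =>
    refine Relation.ReflTransGen.tail ih ?_
    rcases hs with rfl | rfl
    · exact Or.inl (h.rot _).symm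
    · exact Or.inr (h.opp _).symm

theorem IsIso.linked_iff (h : IsIso e M M') (x y : D) :
    M'.Linked (e x) (e y) ↔ M.Linked x y :=
  ⟨fun hxy => by simpa using h.symm.linked hxy, h.linked⟩

theorem IsIso.isConnected (h : IsIso e M M') : M'.IsConnected ↔ M.IsConnected := by
  simp only [IsConnected, e.surjective.forall, h.linked_iff]

theorem IsIso.isSeparating (h : IsIso e M M') (d : D) :
    M'.IsSeparating (e d) ↔ M.IsSeparating d := by
  simp only [IsSeparating, (h.cut d).isConnected]

theorem IsIso.allSeparating (h : IsIso e M M') : M'.AllSeparating ↔ M.AllSeparating := by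
  simp only [AllSeparating, e.surjective.forall, h.isHalfEdge, h.isSeparating]

theorem IsIso.openStep (h : IsIso e M M') (d : D) :
    IsIso e (HalfEdgeMap.openStep (M, d)).1 (HalfEdgeMap.openStep (M', e d)).1 ∧
      (HalfEdgeMap.openStep (M', e d)).2 = e (HalfEdgeMap.openStep (M, d)).2 := by
  refine ⟨?_, h.face d⟩
  have hc : (M'.black (e d) ∧ ¬ M'.IsHalfEdge (e d) ∧ ¬ M'.IsSeparating (e d)) ↔
      (M.black d ∧ ¬ M.IsHalfEdge d ∧ ¬ M.IsSeparating d) := by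
    rw [h.black, h.isHalfEdge, h.isSeparating]
  unfold HalfEdgeMap.openStep
  by_cases hx : M.black d ∧ ¬ M.IsHalfEdge d ∧ ¬ M.IsSeparating d
  · simpa only [if_pos hx, if_pos (hc.mpr hx)] using h.cut d
  · simpa only [if_neg hx, if_neg (fun hh => hx (hc.mp hh))] using h

theorem IsIso.openState (h : IsIso e M M') (n : ℕ) :
    IsIso e (M.openState n).1 (M'.openState n).1 ∧
      (M'.openState n).2 = e (M.openState n).2 := by
  induction n with
  | zero => exact ⟨h, h.root⟩
  | succ n ih =>
    simp only [HalfEdgeMap.openState, Function.iterate_succ_apply'] at ih ⊢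
    have := ih.1.openStep (HalfEdgeMap.openStep^[n] (M, M.root)).2
    rw [← ih.2] at this
    exact this

theorem IsIso.opening (h : IsIso e M M') : IsIso e M.opening M'.opening := by
  unfold HalfEdgeMap.opening
  simp only [fun n => (h.openState n).1.allSeparating]
  exact (h.openState _).1

open Classical in
theorem IsIso.vertexOf [Fintype D] [Fintype D'] (h : IsIso e M M') (d : D) :
    M'.vertexOf (e d) = (M.vertexOf d).map e.toEmbedding := by
  have hz : ∀ (k : ℤ) (x : D), (M'.rot ^ k) (e x) = e ((M.rot ^ k) x) := by
    have hc : M'.rot = (e.symm.trans M.rot).trans e := by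
      ext y
      have := h.rot (e.symm y)
      simpa using this
    intro k x
    have h1 : M'.rot = e.permCongrHom M.rot := by rw [hc]; rfl
    rw [h1, ← map_zpow]
    simp [Equiv.permCongrHom]
  ext y
  obtain ⟨x, rfl⟩ := e.surjective y
  unfold HalfEdgeMap.vertexOf
  rw [Finset.mem_filter, ← Equiv.coe_toEmbedding, Finset.mem_map' e.toEmbedding, Finset.mem_filter]
  simp [Equiv.Perm.SameCycle, hz]

open Classical in
theorem IsIso.image_vertexOf_card [Fintype D] [Fintype D'] (h : IsIso e M M')
    {p : D → Prop} {p' : D' → Prop} [DecidablePred p] [DecidablePred p'] (hp : ∀ d, p' (e d) ↔ p d) :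
    ((Finset.univ.filter p').image M'.vertexOf).val.map Finset.card =
      ((Finset.univ.filter p).image M.vertexOf).val.map Finset.card := by
  have h1 : (Finset.univ.filter p').image M'.vertexOf =
      ((Finset.univ.filter p).image M.vertexOf).map (Finset.mapEmbedding e.toEmbedding).toEmbedding
      := by
    ext v
    simp only [Finset.mem_image, Finset.mem_map, Finset.mem_filter, Finset.mem_univ, true_and,
      e.surjective.exists, hp, h.vertexOf]
    constructor
    · rintro ⟨a, ha, rfl⟩
      exact ⟨_, ⟨a, ha, rfl⟩, rfl⟩
    · rintro ⟨_, ⟨a, ha, rfl⟩, rfl⟩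
      exact ⟨a, ha, rfl⟩
  rw [h1, Finset.map_val, Multiset.map_map]
  refine Multiset.map_congr rfl fun v _ => ?_
  exact Finset.card_map _

open Classical in
theorem IsIso.degreeDistribution [Fintype D] [Fintype D'] (h : IsIso e M M') :
    M'.degreeDistribution = M.degreeDistribution := by
  unfold HalfEdgeMap.degreeDistribution whiteVertices blackVertices
  exact Prod.ext
    (h.image_vertexOf_card (p := fun d => ¬ M.black d) (p' := fun d => ¬ M'.black d)
      fun d => not_congr (h.black d))
    (h.image_vertexOf_card (p := fun d => M.black d) (p' := fun d => M'.black d) h.black)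

end Isomorphism

end HalfEdgeMap

/-- Isomorphism of finite rooted maps with labelled darts. -/
instance HalfEdgeMap.isoSetoid : Setoid (Σ n : ℕ, HalfEdgeMap (Fin n)) where
  r M M' := ∃ e : Fin M.1 ≃ Fin M'.1, HalfEdgeMap.IsIso e M.2 M'.2
  iseqv :=
    { refl := fun M => ⟨_, HalfEdgeMap.IsIso.refl M.2⟩
      symm := fun ⟨_, h⟩ => ⟨_, h.symm⟩
      trans := fun ⟨_, h⟩ ⟨_, h'⟩ => ⟨_, h.trans h'⟩ }

/-- Finite bicoloured combinatorial maps rooted at a half-edge, up to isomorphism. -/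
def RootedMap : Type := Quotient HalfEdgeMap.isoSetoid

namespace RootedMap

/-- The isomorphism class of a map. -/
def mk {n : ℕ} (M : HalfEdgeMap (Fin n)) : RootedMap :=
  Quotient.mk HalfEdgeMap.isoSetoid ⟨n, M⟩

noncomputable def closure : RootedMap → RootedMap :=
  Quotient.lift (fun M : Σ n : ℕ, HalfEdgeMap (Fin n) => mk M.2.closure)
    fun _ _ ⟨e, h⟩ => Quotient.sound ⟨e, h.closure⟩

noncomputable def opening : RootedMap → RootedMap :=
  Quotient.lift (fun M : Σ n : ℕ, HalfEdgeMap (Fin n) => mk M.2.opening)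
    fun _ _ ⟨e, h⟩ => Quotient.sound ⟨e, h.opening⟩

noncomputable def degreeDistribution : RootedMap → Multiset ℕ × Multiset ℕ :=
  Quotient.lift (fun M : Σ n : ℕ, HalfEdgeMap (Fin n) => M.2.degreeDistribution)
    fun _ _ ⟨_, h⟩ => h.degreeDistribution.symm

/-- Balanced blossom trees of total charge `m` whose vertex degrees are all multiples of `m`. -/
def balancedBlossomTrees (m : ℕ) : Set RootedMap :=
  {c | ∃ (n : ℕ) (T : HalfEdgeMap (Fin n)), mk T = c ∧ T.IsBlossomTree ∧ T.IsBalanced ∧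
    T.totalCharge = m ∧ T.DegreesDivisibleBy m}

/-- `m`-leg maps whose vertex degrees are all multiples of `m`. -/
def legMaps (m : ℕ) : Set RootedMap :=
  {c | ∃ (n : ℕ) (M : HalfEdgeMap (Fin n)), mk M = c ∧ M.IsLegMap m ∧ M.DegreesDivisibleBy m}

end RootedMap

/-! Number the darts of a tree by the walk around its only face, starting at the root. When the tree
is balanced the root is unmatched, so the matching is a parenthesis system on this line, and the
`height` of a position is the number of pairs around it.

Opening, then closing. Each edge cut by the opening separates the infinite face from an inner face,
and cutting it inserts the walk around the inner face between the new bud and the new leaf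
(`cut_pos`). The cut edges therefore form a parenthesis system (`ArcSystem.cut`). Such a system is
unique (`ArcSystem.matches_iff`), so the closure fuses exactly the pairs that were cut. The opening
terminates because, by a count of colours, as long as there are several faces some edge is followed
from black to white along the infinite face and has another face on its other side.

Closing, then opening. As long as no edge of the tree `T` is cut, the opening walk on the closure of
`T` proceeds in rounds: round `r` cuts the pairs whose bud has height `r`, and jumps over what they
enclose (`IsPartialClosure.openStep`). Hence `T` is recovered if and only if every edge of `T` is
separating whenever it is followed from black to white, that is, if no pair still fused joins its
two sides. A lower subtree is an interval of the walk, and the height varies along it by its number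
`s` of single leaves minus its charge `c`. Comparing heights at its two ends, the condition becomes
`c - s ≤ 1` for a black lower end and `s ≤ c` for a white one.

Divisibility turns this into the blossom condition. Modulo `m`, the charge `c` is `1` at a black end
and `-1` at a white end, and `0 ≤ s ≤ m - 1` because the root is one of the `m` single leaves. So `c
≤ 1` gives `c - s ≤ 1`, while `c > 1` forces `c ≥ m + 1` and `c - s ≥ 2`; likewise `c ≥ 0` forces `c
≥ m - 1 ≥ s`, while `c < 0` gives `s > c`. The two directions are `IsBlossomTree.isSeparating` and
`isBlossomTree_of_opening_closure`. -/

/-! ### Cycles of a permutation multiplied by a transposition. -/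

theorem Setoid.card_quotient_join {D : Type} [Finite D] (r s : Setoid D) {a b : D}
    (hab : ¬ r a b)
    (hs : ∀ x y, s x y ↔ r x y ∨ (r x a ∧ r b y) ∨ (r x b ∧ r a y)) :
    Nat.card (Quotient s) + 1 = Nat.card (Quotient r) := by
  classical
  -- The merged class is represented by the class of `b`, so discarding the class of `a` leaves
  -- exactly one class of `r` in each class of `s`.
  let f : {q : Quotient r // q ≠ Quotient.mk r a} → Quotient s := fun q =>
    Quotient.map' id (fun x y h => (hs x y).2 (Or.inl h)) q.1
  have hf : Function.Bijective f := by
    constructor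
    · rintro ⟨p, hp⟩ ⟨q, hq⟩ h
      induction p using Quotient.inductionOn with | _ x
      induction q using Quotient.inductionOn with | _ y
      have h' : s x y := Quotient.exact h
      have hx : ¬ r x a := fun e => hp (Quotient.sound e)
      have hy : ¬ r y a := fun e => hq (Quotient.sound e)
      rcases (hs x y).1 h' with h1 | h1 | h1
      · exact Subtype.ext (Quotient.sound h1)
      · exact absurd h1.1 hx
      · exact absurd (r.symm h1.2) hy
    · intro q
      induction q using Quotient.inductionOn with | _ y
      by_cases hy : r y a
      · refine ⟨⟨Quotient.mk r b, fun e => hab (r.symm (Quotient.exact e))⟩, ?_⟩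
        exact Quotient.sound ((hs b y).2 (Or.inr (Or.inr ⟨r.refl b, r.symm hy⟩)))
      · exact ⟨⟨Quotient.mk r y, fun e => hy (Quotient.exact e)⟩, rfl⟩
  rw [← Nat.card_congr (Equiv.ofBijective f hf), ← Finite.card_option]
  exact Nat.card_congr (Equiv.optionSubtypeNe (Quotient.mk r a))

/-- Turns the numbers of vertices and faces, defined through sets of darts, into numbers of classes.
-/
theorem Setoid.card_image_filter {D : Type} [Fintype D] [DecidableEq (Finset D)] (r : Setoid D)
    [∀ d, DecidablePred fun x => r d x] :
    (Finset.univ.image fun d => Finset.univ.filter fun x => r d x).card =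
      Nat.card (Quotient r) := by
  classical
  let f : Quotient r → Finset D := Quotient.lift (fun d => Finset.univ.filter fun x => r d x)
    (fun a b h => by
      ext x
      simp only [Finset.mem_filter, Finset.mem_univ, true_and]
      exact ⟨fun h' => r.trans (r.symm h) h', fun h' => r.trans h h'⟩)
  have hf : Function.Injective f := by
    intro p q h
    induction p using Quotient.inductionOn with | _ x
    induction q using Quotient.inductionOn with | _ y
    have : y ∈ f (Quotient.mk r x) := by
      rw [h]
      exact Finset.mem_filter.2 ⟨Finset.mem_univ _, r.refl y⟩
    exact Quotient.sound (Finset.mem_filter.1 this).2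
  rw [Nat.card_eq_fintype_card, ← Finset.card_univ, ← Finset.card_image_of_injective _ hf]
  congr 1
  ext s
  simp only [Finset.mem_image, Finset.mem_univ, true_and]
  constructor
  · rintro ⟨a, rfl⟩
    exact ⟨Quotient.mk r a, rfl⟩
  · rintro ⟨q, rfl⟩
    induction q using Quotient.inductionOn with | _ y
    exact ⟨y, rfl⟩

namespace Equiv.Perm

variable {D : Type}

theorem SameCycle.of_invariant [Finite D] {σ : Perm D} {x y : D} (h : σ.SameCycle x y)
    (P : D → Prop) (hx : P x) (hP : ∀ z, P z → P (σ z)) : P y := by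
  obtain ⟨n, rfl⟩ := h.exists_nat_pow_eq
  clear h
  induction n with
  | zero => exact hx
  | succ n ih =>
    rw [pow_succ', mul_apply]
    exact hP _ ih

theorem sameCycle_apply_self (σ : Perm D) (x : D) : σ.SameCycle x (σ x) := ⟨1, by simp⟩

variable [DecidableEq D]

theorem mul_swap_apply_left (σ : Perm D) (a b : D) : (σ * swap a b) a = σ b := by simp

theorem mul_swap_apply_right (σ : Perm D) (a b : D) : (σ * swap a b) b = σ a := by simp

theorem mul_swap_apply_of_ne (σ : Perm D) {a b x : D} (ha : x ≠ a) (hb : x ≠ b) :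
    (σ * swap a b) x = σ x := by simp [swap_apply_of_ne_of_ne ha hb]

/-- The new permutation sends `a` to `σ b` and then follows the old cycle of `b`, which avoids `a`,
until it reaches `b`. Positive exponents are used so that `b` itself comes last. -/
theorem SameCycle.mul_swap_cross [Finite D] {σ : Perm D} {a b y : D} (hab : ¬ σ.SameCycle a b)
    (h : σ.SameCycle b y) : (σ * swap a b).SameCycle a y := by
  obtain ⟨i, hi, -, rfl⟩ := h.exists_pow_eq''
  clear h
  induction i, hi using Nat.le_induction with
  | base =>
    have := sameCycle_apply_self (σ * swap a b) a
    rwa [mul_swap_apply_left] at this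
  | succ i hi ih =>
    rw [pow_succ', mul_apply]
    by_cases hb : (σ ^ i) b = b
    · rw [hb]
      have := sameCycle_apply_self (σ * swap a b) a
      rwa [mul_swap_apply_left] at this
    · have ha : (σ ^ i) b ≠ a := fun e => hab (SameCycle.symm ⟨i, by simpa using e⟩)
      have := sameCycle_apply_self (σ * swap a b) ((σ ^ i) b)
      rw [mul_swap_apply_of_ne σ ha hb] at this
      exact ih.trans this

theorem sameCycle_mul_swap_iff [Finite D] {σ : Perm D} {a b : D} (hab : ¬ σ.SameCycle a b)
    (x y : D) : (σ * swap a b).SameCycle x y ↔ σ.SameCycle x y ∨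
      (σ.SameCycle x a ∧ σ.SameCycle b y) ∨ (σ.SameCycle x b ∧ σ.SameCycle a y) := by
  have hba : ¬ σ.SameCycle b a := fun h => hab h.symm
  have hA : ∀ y, σ.SameCycle b y → (σ * swap a b).SameCycle a y := fun y h =>
    SameCycle.mul_swap_cross hab h
  have hB : ∀ y, σ.SameCycle a y → (σ * swap a b).SameCycle b y := fun y h => by
    rw [swap_comm]
    exact SameCycle.mul_swap_cross hba h
  have hAB : (σ * swap a b).SameCycle a b := hA b (SameCycle.refl _ _)
  constructor
  · intro h
    refine h.of_invariant (fun y => σ.SameCycle x y ∨ (σ.SameCycle x a ∧ σ.SameCycle b y) ∨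
      (σ.SameCycle x b ∧ σ.SameCycle a y)) (Or.inl (SameCycle.refl _ _)) ?_
    intro z hz
    by_cases ha : z = a
    · subst ha
      rw [mul_swap_apply_left]
      rcases hz with hz | hz | hz
      · exact Or.inr (Or.inl ⟨hz, sameCycle_apply_self _ _⟩)
      · exact absurd hz.2 hba
      · exact Or.inl (hz.1.trans (sameCycle_apply_self _ _))
    · by_cases hb : z = b
      · subst hb
        rw [mul_swap_apply_right]
        rcases hz with hz | hz | hz
        · exact Or.inr (Or.inr ⟨hz, sameCycle_apply_self _ _⟩)
        · exact Or.inl (hz.1.trans (sameCycle_apply_self _ _))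
        · exact absurd hz.2 hab
      · rw [mul_swap_apply_of_ne σ ha hb]
        have hz' := sameCycle_apply_self σ z
        rcases hz with hz | hz | hz
        · exact Or.inl (hz.trans hz')
        · exact Or.inr (Or.inl ⟨hz.1, hz.2.trans hz'⟩)
        · exact Or.inr (Or.inr ⟨hz.1, hz.2.trans hz'⟩)
  · rintro (h | ⟨h1, h2⟩ | ⟨h1, h2⟩)
    · by_cases ha : σ.SameCycle a x
      · exact (hB x ha).symm.trans (hB y (ha.trans h))
      · by_cases hb : σ.SameCycle b x
        · exact (hA x hb).symm.trans (hA y (hb.trans h))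
        · refine (h.of_invariant (fun y => (σ * swap a b).SameCycle x y ∧ σ.SameCycle x y)
            ⟨SameCycle.refl _ _, SameCycle.refl _ _⟩ ?_).1
          rintro z ⟨hz1, hz2⟩
          have hza : z ≠ a := fun e => ha (e ▸ hz2.symm)
          have hzb : z ≠ b := fun e => hb (e ▸ hz2.symm)
          refine ⟨?_, hz2.trans (sameCycle_apply_self _ _)⟩
          rw [← mul_swap_apply_of_ne σ hza hzb]
          exact hz1.trans (sameCycle_apply_self _ _)
    · exact (hB x h1.symm).symm.trans (hAB.symm.trans (hA y h2))
    · exact (hA x h1.symm).symm.trans (hAB.trans (hB y h2))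

/-- Let `k` be least with `σ ^ k` sending `a` to `b`. The new permutation sends `b` to `σ a`, so the
new cycle of `b` is `σ a, ..., σ ^ k a = b`, which misses `a`. -/
theorem SameCycle.not_mul_swap [Finite D] {σ : Perm D} {a b : D} (hab : σ.SameCycle a b)
    (hne : a ≠ b) : ¬ (σ * swap a b).SameCycle a b := by
  classical
  have hex : ∃ n : ℕ, (σ ^ n) a = b := hab.exists_nat_pow_eq
  have hk := Nat.find_spec hex
  have hmin : ∀ j < Nat.find hex, (σ ^ j) a ≠ b := fun j hj => Nat.find_min hex hj
  generalize Nat.find hex = k at hk hmin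
  have hk0 : 1 ≤ k := by
    rcases Nat.eq_zero_or_pos k with h | h
    · subst h
      exact absurd hk hne
    · exact h
  have hnea : ∀ j, 1 ≤ j → j ≤ k → (σ ^ j) a ≠ a := by
    intro j h1 h2 e
    apply hmin (k - j) (by omega)
    conv_lhs => rw [← e, ← mul_apply, ← pow_add, Nat.sub_add_cancel h2]
    exact hk
  intro h
  obtain ⟨j, h1, h2, h3⟩ := h.symm.of_invariant (fun z => ∃ j, 1 ≤ j ∧ j ≤ k ∧ (σ ^ j) a = z)
    ⟨k, hk0, le_rfl, hk⟩ (by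
      rintro z ⟨j, h1, h2, rfl⟩
      rcases h2.lt_or_eq with h2 | rfl
      · refine ⟨j + 1, by omega, h2, ?_⟩
        rw [mul_swap_apply_of_ne σ (hnea j h1 h2.le) (hmin j h2), pow_succ', mul_apply]
      · exact ⟨1, le_rfl, hk0, by rw [hk, mul_swap_apply_right, pow_one]⟩)
  exact hnea j h1 h2 h3

theorem card_quotient_mul_swap_of_not [Finite D] {σ : Perm D} {a b : D}
    (hab : ¬ σ.SameCycle a b) :
    Nat.card (Quotient (SameCycle.setoid (σ * swap a b))) + 1 =
      Nat.card (Quotient (SameCycle.setoid σ)) :=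
  Setoid.card_quotient_join (SameCycle.setoid σ) _ hab (sameCycle_mul_swap_iff hab)

/-- Multiplying twice by the transposition gives `σ` back, so splitting a cycle is merging read
backwards. -/
theorem card_quotient_mul_swap [Finite D] {σ : Perm D} {a b : D}
    (hab : σ.SameCycle a b) (hne : a ≠ b) :
    Nat.card (Quotient (SameCycle.setoid (σ * swap a b))) =
      Nat.card (Quotient (SameCycle.setoid σ)) + 1 := by
  have h := card_quotient_mul_swap_of_not (hab.not_mul_swap hne)
  rw [mul_swap_mul_self] at h
  exact h.symm

end Equiv.Perm

/-! ### Cutting an edge: faces, components and Euler's inequality. -/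

namespace HalfEdgeMap

theorem ext' {D : Type} {M M' : HalfEdgeMap D} (hrot : M.rot = M'.rot)
    (hopp : ∀ x, M.opp x = M'.opp x) (hblack : M.black = M'.black) (hroot : M.root = M'.root) :
    M = M' := by
  cases M
  cases M'
  obtain rfl := Equiv.ext hopp
  subst hrot hblack hroot
  rfl

section Finite

variable {D : Type}

@[simp] theorem cut_rot (M : HalfEdgeMap D) (d : D) : (M.cut d).rot = M.rot := rfl
@[simp] theorem cut_black (M : HalfEdgeMap D) (d : D) : (M.cut d).black = M.black := rfl
@[simp] theorem cut_root (M : HalfEdgeMap D) (d : D) : (M.cut d).root = M.root := rfl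

theorem cut_opp_self (M : HalfEdgeMap D) (d : D) : (M.cut d).opp d = d := by
  change M.cutFun d d = d
  simp [cutFun]

theorem cut_opp_opp (M : HalfEdgeMap D) (d : D) : (M.cut d).opp (M.opp d) = M.opp d := by
  change M.cutFun d (M.opp d) = M.opp d
  simp [cutFun]

theorem cut_opp_of_ne (M : HalfEdgeMap D) {d x : D} (h1 : x ≠ d) (h2 : x ≠ M.opp d) :
    (M.cut d).opp x = M.opp x := by
  change M.cutFun d x = M.opp x
  simp [cutFun, h1, h2]

theorem cut_opp_eq (M : HalfEdgeMap D) (d x : D) :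
    (M.cut d).opp x = x ∨ (M.cut d).opp x = M.opp x := by
  by_cases h1 : x = d
  · exact Or.inl (by rw [h1, cut_opp_self])
  · by_cases h2 : x = M.opp d
    · exact Or.inl (by rw [h2, cut_opp_opp])
    · exact Or.inr (M.cut_opp_of_ne h1 h2)

theorem cut_opp_comm (M : HalfEdgeMap D) (d : D) : M.cut (M.opp d) = M.cut d := by
  refine ext' rfl (fun x => ?_) rfl rfl
  change M.cutFun (M.opp d) x = M.cutFun d x
  have h : (x = M.opp d ∨ x = M.opp (M.opp d)) ↔ (x = d ∨ x = M.opp d) := by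
    rw [M.opp_opp, or_comm]
  unfold cutFun
  by_cases hx : x = d ∨ x = M.opp d
  · rw [if_pos hx, if_pos (h.2 hx)]
  · rw [if_neg hx, if_neg (mt h.1 hx)]

theorem cut_isHalfEdge_iff (M : HalfEdgeMap D) (d x : D) :
    (M.cut d).IsHalfEdge x ↔ M.IsHalfEdge x ∨ x = d ∨ x = M.opp d := by
  unfold IsHalfEdge
  by_cases h1 : x = d
  · simp [h1, cut_opp_self]
  · by_cases h2 : x = M.opp d
    · simp [h2, cut_opp_opp]
    · simp [M.cut_opp_of_ne h1 h2, h1, h2]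

theorem face_apply (M : HalfEdgeMap D) (x : D) : M.face x = M.rot (M.opp x) := rfl

theorem face_opp (M : HalfEdgeMap D) (x : D) : M.face (M.opp x) = M.rot x := by
  rw [face_apply, M.opp_opp]

theorem cut_face_self (M : HalfEdgeMap D) (d : D) : (M.cut d).face d = M.face (M.opp d) := by
  rw [face_apply, cut_opp_self, face_opp, cut_rot]

theorem cut_face_opp (M : HalfEdgeMap D) (d : D) : (M.cut d).face (M.opp d) = M.face d := by
  rw [face_apply, cut_opp_opp, cut_rot, face_apply]

theorem cut_face_of_ne (M : HalfEdgeMap D) {d x : D} (h1 : x ≠ d) (h2 : x ≠ M.opp d) :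
    (M.cut d).face x = M.face x := by
  rw [face_apply, M.cut_opp_of_ne h1 h2, cut_rot, face_apply]

/-- The faces of a cut map are thereby governed by the merging and splitting of cycles. -/
theorem cut_face [DecidableEq D] (M : HalfEdgeMap D) (d : D) :
    (M.cut d).face = M.face * Equiv.swap d (M.opp d) := by
  ext x
  by_cases h1 : x = d
  · rw [h1, cut_face_self, Equiv.Perm.mul_swap_apply_left]
  · by_cases h2 : x = M.opp d
    · rw [h2, cut_face_opp, Equiv.Perm.mul_swap_apply_right]
    · rw [M.cut_face_of_ne h1 h2, Equiv.Perm.mul_swap_apply_of_ne _ h1 h2]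

theorem Linked.rfl {M : HalfEdgeMap D} {x : D} : M.Linked x x := Relation.ReflTransGen.refl

theorem Linked.trans {M : HalfEdgeMap D} {x y z : D} (h : M.Linked x y) (h' : M.Linked y z) :
    M.Linked x z := Relation.ReflTransGen.trans h h'

theorem linked_rot (M : HalfEdgeMap D) (x : D) : M.Linked x (M.rot x) :=
  Relation.ReflTransGen.single (Or.inl rfl)

theorem linked_opp (M : HalfEdgeMap D) (x : D) : M.Linked x (M.opp x) :=
  Relation.ReflTransGen.single (Or.inr rfl)

theorem linked_face (M : HalfEdgeMap D) (x : D) : M.Linked x (M.face x) :=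
  (M.linked_opp x).trans (M.linked_rot _)

/-- A set that is closed under both permutations contains the component of each of its elements. -/
theorem Linked.of_invariant {M : HalfEdgeMap D} {x y : D} (h : M.Linked x y) (P : D → Prop)
    (hx : P x) (hrot : ∀ z, P z → P (M.rot z)) (hopp : ∀ z, P z → P (M.opp z)) : P y := by
  unfold Linked at h
  induction h with
  | refl => exact hx
  | tail _ hs ih =>
    rcases hs with rfl | rfl
    · exact hrot _ ih
    · exact hopp _ ih

theorem opp_not_isHalfEdge {M : HalfEdgeMap D} {d : D} (hd : ¬ M.IsHalfEdge d) :
    ¬ M.IsHalfEdge (M.opp d) := by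
  intro h
  have h2 : M.opp (M.opp d) = M.opp d := h
  exact hd (M.opp.injective h2)

open Classical in
/-- The contribution of a dart to the charge. -/
noncomputable def charge (M : HalfEdgeMap D) (d : D) : ℤ :=
  (if M.IsLeaf d then 1 else 0) - if M.IsBud d then 1 else 0

open Classical in
/-- `1` for a dart at a white vertex and `-1` for a dart at a black vertex. -/
noncomputable def colour (M : HalfEdgeMap D) (d : D) : ℤ := if M.black d then -1 else 1

theorem colour_opp (M : HalfEdgeMap D) {d : D} (hd : ¬ M.IsHalfEdge d) :
    M.colour (M.opp d) = - M.colour d := by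
  have := M.black_opp d hd
  unfold colour
  by_cases h : M.black d <;> simp [this, h]

theorem charge_of_isHalfEdge {M : HalfEdgeMap D} {d : D} (hd : M.IsHalfEdge d) :
    M.charge d = M.colour d := by
  unfold charge colour IsLeaf IsBud
  by_cases h : M.black d <;> simp [hd, h]

theorem charge_of_not_isHalfEdge {M : HalfEdgeMap D} {d : D} (hd : ¬ M.IsHalfEdge d) :
    M.charge d = 0 := by
  simp [charge, IsLeaf, IsBud, hd]

/-- Over a set of darts that is closed under `opp`, charges and colours have the same sum. -/
theorem sum_charge_eq_sum_colour (M : HalfEdgeMap D) (s : Finset D)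
    (hs : ∀ x ∈ s, M.opp x ∈ s) : ∑ x ∈ s, M.charge x = ∑ x ∈ s, M.colour x := by
  rw [← sub_eq_zero, ← neg_eq_zero, ← Finset.sum_sub_distrib, ← Finset.sum_neg_distrib]
  refine Finset.sum_involution (fun x _ => M.opp x) (fun x _ => ?_) (fun x _ hx => ?_)
    (fun x hx => hs x hx) (fun x _ => M.opp_opp x)
  · by_cases h : M.IsHalfEdge x
    · have h' : M.opp x = x := h
      rw [h', charge_of_isHalfEdge h]
      ring
    · rw [charge_of_not_isHalfEdge h, charge_of_not_isHalfEdge (opp_not_isHalfEdge h),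
        M.colour_opp h]
      ring
  · intro h
    apply hx
    rw [charge_of_isHalfEdge h]
    ring

theorem linked_cut_mono {M : HalfEdgeMap D} {d x y : D} (h : (M.cut d).Linked x y) :
    M.Linked x y := by
  refine h.of_invariant (fun y => M.Linked x y) Linked.rfl (fun z hz => hz.trans (M.linked_rot z))
    fun z hz => ?_
  rcases M.cut_opp_eq d z with e | e <;> rw [e]
  · exact hz
  · exact hz.trans (M.linked_opp z)

variable [Finite D]

theorem linked_of_sameCycle_rot {M : HalfEdgeMap D} {x y : D} (h : M.rot.SameCycle x y) :
    M.Linked x y :=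
  h.of_invariant (fun z => M.Linked x z) Linked.rfl fun _ hz => hz.trans (M.linked_rot _)

theorem linked_of_sameCycle_face {M : HalfEdgeMap D} {x y : D} (h : M.face.SameCycle x y) :
    M.Linked x y :=
  h.of_invariant (fun z => M.Linked x z) Linked.rfl fun _ hz => hz.trans (M.linked_face _)

theorem Linked.symm {M : HalfEdgeMap D} {x y : D} (h : M.Linked x y) : M.Linked y x := by
  refine h.of_invariant (fun y => M.Linked y x) Linked.rfl (fun z hz => ?_) (fun z hz => ?_)
  · exact (linked_of_sameCycle_rot (Equiv.Perm.sameCycle_apply_self _ _).symm).trans hz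
  · refine Linked.trans ?_ hz
    have := M.linked_opp (M.opp z)
    rwa [M.opp_opp] at this

def linkedSetoid (M : HalfEdgeMap D) : Setoid D where
  r := M.Linked
  iseqv := ⟨fun _ => Linked.rfl, Linked.symm, Linked.trans⟩

/-- Stated in the form that `Setoid.card_quotient_join` requires: restoring an edge joins at most
two components. -/
theorem linked_iff_cut (M : HalfEdgeMap D) (d x y : D) : M.Linked x y ↔ (M.cut d).Linked x y ∨
    ((M.cut d).Linked x d ∧ (M.cut d).Linked (M.opp d) y) ∨
      ((M.cut d).Linked x (M.opp d) ∧ (M.cut d).Linked d y) := by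
  constructor
  · intro h
    refine h.of_invariant (fun y => (M.cut d).Linked x y ∨
      ((M.cut d).Linked x d ∧ (M.cut d).Linked (M.opp d) y) ∨
      ((M.cut d).Linked x (M.opp d) ∧ (M.cut d).Linked d y)) (Or.inl Linked.rfl) ?_ ?_
    · intro z hz
      have hz' := (M.cut d).linked_rot z
      rcases hz with hz | hz | hz
      · exact Or.inl (hz.trans hz')
      · exact Or.inr (Or.inl ⟨hz.1, hz.2.trans hz'⟩)
      · exact Or.inr (Or.inr ⟨hz.1, hz.2.trans hz'⟩)
    · intro z hz
      by_cases h1 : z = d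
      · subst h1
        rcases hz with hz | hz | hz
        · exact Or.inr (Or.inl ⟨hz, Linked.rfl⟩)
        · exact Or.inr (Or.inl ⟨hz.1, Linked.rfl⟩)
        · exact Or.inl hz.1
      · by_cases h2 : z = M.opp d
        · subst h2
          rw [M.opp_opp]
          rcases hz with hz | hz | hz
          · exact Or.inr (Or.inr ⟨hz, Linked.rfl⟩)
          · exact Or.inl hz.1
          · exact Or.inr (Or.inr ⟨hz.1, Linked.rfl⟩)
        · have hz' := (M.cut d).linked_opp z
          rw [M.cut_opp_of_ne h1 h2] at hz'
          rcases hz with hz | hz | hz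
          · exact Or.inl (hz.trans hz')
          · exact Or.inr (Or.inl ⟨hz.1, hz.2.trans hz'⟩)
          · exact Or.inr (Or.inr ⟨hz.1, hz.2.trans hz'⟩)
  · rintro (h | ⟨h1, h2⟩ | ⟨h1, h2⟩)
    · exact linked_cut_mono h
    · exact (linked_cut_mono h1).trans ((M.linked_opp d).trans (linked_cut_mono h2))
    · exact (linked_cut_mono h1).trans ((M.linked_opp d).symm.trans (linked_cut_mono h2))

/-- Cutting an edge with two different faces on its sides does not disconnect its endpoints. -/
theorem linked_cut_of_not_sameCycle {M : HalfEdgeMap D} {d : D}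
    (h : ¬ M.face.SameCycle d (M.opp d)) : (M.cut d).Linked d (M.opp d) := by
  classical
  -- The cut merges the two faces into a single one, along which the walk links both ends.
  apply linked_of_sameCycle_face
  rw [cut_face]
  exact (Equiv.Perm.SameCycle.mul_swap_cross h (Equiv.Perm.SameCycle.refl _ _))

theorem isSeparating_iff (M : HalfEdgeMap D) (hM : M.IsConnected) (d : D) :
    M.IsSeparating d ↔ ¬ (M.cut d).Linked d (M.opp d) := by
  unfold IsSeparating IsConnected
  refine not_congr ⟨fun h => h _ _, fun h x y => ?_⟩
  rcases (M.linked_iff_cut d x y).1 (hM x y) with h1 | h1 | h1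
  · exact h1
  · exact h1.1.trans (h.trans h1.2)
  · exact h1.1.trans (h.symm.trans h1.2)

end Finite

section Counting

open Equiv.Perm

variable {D : Type} [Fintype D]

open Classical in
noncomputable def halfEdges (M : HalfEdgeMap D) : Finset D := Finset.univ.filter M.IsHalfEdge

theorem mem_halfEdges {M : HalfEdgeMap D} {d : D} : d ∈ M.halfEdges ↔ M.IsHalfEdge d := by
  classical
  simp [halfEdges]

theorem card_vertices (M : HalfEdgeMap D) :
    M.vertices.card = Nat.card (Quotient (SameCycle.setoid M.rot)) := by
  classical
  rw [← Setoid.card_image_filter (SameCycle.setoid M.rot)]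
  unfold vertices vertexOf
  convert rfl
  exact Iff.rfl

theorem card_faces (M : HalfEdgeMap D) :
    M.faces.card = Nat.card (Quotient (SameCycle.setoid M.face)) := by
  classical
  rw [← Setoid.card_image_filter (SameCycle.setoid M.face)]
  unfold faces faceOf
  convert rfl
  exact Iff.rfl

theorem two_mul_card_edges (M : HalfEdgeMap D) :
    2 * M.edges.card + M.halfEdges.card = Fintype.card D := by
  classical
  have h1 : (Finset.univ.filter fun d => ¬ M.IsHalfEdge d).card = M.edges.card * 2 := by
    unfold edges
    rw [Finset.card_eq_sum_card_image (fun d => ({d, M.opp d} : Finset D))]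
    convert Finset.sum_const_nat fun s hs => ?_
    obtain ⟨d, hd, rfl⟩ := Finset.mem_image.1 hs
    have hd' : M.opp d ≠ d := (Finset.mem_filter.1 hd).2
    have : ((Finset.univ.filter fun d => ¬ M.IsHalfEdge d).filter
        fun x => ({x, M.opp x} : Finset D) = {d, M.opp d}) = {d, M.opp d} := by
      ext x
      simp only [Finset.mem_filter, Finset.mem_univ, true_and, Finset.mem_insert,
        Finset.mem_singleton]
      constructor
      · rintro ⟨-, h⟩
        have : x ∈ ({d, M.opp d} : Finset D) := h ▸ Finset.mem_insert_self _ _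
        simpa using this
      · rintro (rfl | rfl)
        · exact ⟨hd', rfl⟩
        · refine ⟨fun h => hd' ?_, by rw [M.opp_opp, Finset.pair_comm]⟩
          have h2 : M.opp (M.opp d) = M.opp d := h
          rw [M.opp_opp] at h2
          exact h2.symm
    rw [this, Finset.card_pair hd'.symm]
  have h2 := Finset.card_filter_add_card_filter_not (s := (Finset.univ : Finset D)) M.IsHalfEdge
  rw [Finset.card_univ] at h2
  have h3 : M.halfEdges.card = (Finset.univ.filter M.IsHalfEdge).card := by
    unfold halfEdges
    congr
  omega

theorem card_halfEdges_cut (M : HalfEdgeMap D) {d : D} (hd : ¬ M.IsHalfEdge d) :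
    (M.cut d).halfEdges.card = M.halfEdges.card + 2 := by
  classical
  have : (M.cut d).halfEdges = insert d (insert (M.opp d) M.halfEdges) := by
    ext x
    simp only [mem_halfEdges, cut_isHalfEdge_iff, Finset.mem_insert]
    tauto
  rw [this, Finset.card_insert_of_notMem, Finset.card_insert_of_notMem]
  · rw [mem_halfEdges]
    exact opp_not_isHalfEdge hd
  · rw [Finset.mem_insert, mem_halfEdges]
    rintro (h | h)
    · exact hd h.symm
    · exact hd h

theorem card_edges_cut (M : HalfEdgeMap D) {d : D} (hd : ¬ M.IsHalfEdge d) :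
    (M.cut d).edges.card + 1 = M.edges.card := by
  have h1 := M.two_mul_card_edges
  have h2 := (M.cut d).two_mul_card_edges
  have h3 := M.card_halfEdges_cut hd
  omega

theorem card_vertices_cut (M : HalfEdgeMap D) (d : D) :
    (M.cut d).vertices.card = M.vertices.card := by
  rw [card_vertices, card_vertices, cut_rot]

theorem card_faces_cut_of_not (M : HalfEdgeMap D) {d : D}
    (h : ¬ M.face.SameCycle d (M.opp d)) : (M.cut d).faces.card + 1 = M.faces.card := by
  classical
  rw [card_faces, card_faces, cut_face]
  exact card_quotient_mul_swap_of_not h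

theorem card_faces_cut (M : HalfEdgeMap D) {d : D} (hd : ¬ M.IsHalfEdge d)
    (h : M.face.SameCycle d (M.opp d)) : (M.cut d).faces.card = M.faces.card + 1 := by
  classical
  rw [card_faces, card_faces, cut_face]
  exact card_quotient_mul_swap h (Ne.symm hd)

noncomputable def numComponents (M : HalfEdgeMap D) : ℕ := Nat.card (Quotient M.linkedSetoid)

theorem numComponents_cut_of_linked (M : HalfEdgeMap D) {d : D}
    (h : (M.cut d).Linked d (M.opp d)) : (M.cut d).numComponents = M.numComponents := by
  have : (M.cut d).linkedSetoid = M.linkedSetoid := by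
    ext x y
    change (M.cut d).Linked x y ↔ M.Linked x y
    refine ⟨linked_cut_mono, fun h' => ?_⟩
    rcases (M.linked_iff_cut d x y).1 h' with h1 | h1 | h1
    · exact h1
    · exact h1.1.trans (h.trans h1.2)
    · exact h1.1.trans (h.symm.trans h1.2)
  rw [numComponents, this, numComponents]

theorem numComponents_cut_le (M : HalfEdgeMap D) (d : D) :
    (M.cut d).numComponents ≤ M.numComponents + 1 := by
  by_cases h : (M.cut d).Linked d (M.opp d)
  · rw [M.numComponents_cut_of_linked h]
    omega
  · exact (Setoid.card_quotient_join (M.cut d).linkedSetoid M.linkedSetoid h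
      (M.linked_iff_cut d)).ge

/-- The genus of a map is nonnegative. -/
theorem card_vertices_add_card_faces_le (M : HalfEdgeMap D) :
    M.vertices.card + M.faces.card ≤ M.edges.card + 2 * M.numComponents := by
  induction hn : M.edges.card generalizing M with
  | zero =>
    have hH : ∀ d, M.IsHalfEdge d := by
      by_contra! h
      obtain ⟨d, hd⟩ := h
      have := M.card_edges_cut hd
      omega
    have hface : M.face = M.rot := by
      ext x
      rw [face_apply, hH x]
    have hlink : M.linkedSetoid = SameCycle.setoid M.rot := by
      ext x y
      change M.Linked x y ↔ M.rot.SameCycle x y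
      refine ⟨fun h => h.of_invariant (fun y => M.rot.SameCycle x y) (SameCycle.refl _ _)
        (fun z hz => hz.trans (sameCycle_apply_self _ _)) fun z hz => ?_, linked_of_sameCycle_rot⟩
      rwa [hH z]
    rw [card_vertices, card_faces, hface, numComponents, hlink]
    omega
  | succ n ih =>
    have hd : ∃ d, ¬ M.IsHalfEdge d := by
      by_contra! h
      have h1 : M.edges = ∅ := by
        unfold edges
        simp [h]
      rw [h1] at hn
      simp at hn
    obtain ⟨d, hd⟩ := hd
    have hE := M.card_edges_cut hd
    have hV := M.card_vertices_cut d
    have h1 := ih (M.cut d) (by omega)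
    -- Either the cut splits a face and adds at most one component, or it merges two faces and keeps
    -- the components. In both cases the inequality for the cut map implies the one for `M`.
    by_cases hf : M.face.SameCycle d (M.opp d)
    · have hF := M.card_faces_cut hd hf
      have hC := M.numComponents_cut_le d
      omega
    · have hF := M.card_faces_cut_of_not hf
      have hC := M.numComponents_cut_of_linked (linked_cut_of_not_sameCycle hf)
      omega

theorem numComponents_of_isConnected {M : HalfEdgeMap D} (hM : M.IsConnected) :
    M.numComponents = 1 := by
  rw [numComponents, Nat.card_eq_one_iff_unique]
  refine ⟨⟨fun p q => ?_⟩, ⟨Quotient.mk _ M.root⟩⟩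
  induction p using Quotient.inductionOn with | _ x
  induction q using Quotient.inductionOn with | _ y
  exact Quotient.sound (hM x y)

/-- In a planar map, an edge is separating if and only if it has the same face on both sides. -/
theorem IsMap.isSeparating_iff {M : HalfEdgeMap D} (hM : M.IsMap) {d : D}
    (hd : ¬ M.IsHalfEdge d) : M.IsSeparating d ↔ M.face.SameCycle d (M.opp d) := by
  rw [HalfEdgeMap.isSeparating_iff M hM.connected]
  constructor
  · intro h
    by_contra h'
    exact h (linked_cut_of_not_sameCycle h')
  -- A connected cut map would have one more face and one edge less than a planar map, against the
  -- inequality on the genus.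
  · intro h h'
    have h1 := (M.cut d).card_vertices_add_card_faces_le
    rw [M.numComponents_cut_of_linked h', numComponents_of_isConnected hM.connected,
      card_vertices_cut, M.card_faces_cut hd h] at h1
    have h2 := M.card_edges_cut hd
    have h3 := hM.euler
    omega

theorem totalCharge_eq_sum (M : HalfEdgeMap D) : M.totalCharge = ∑ d, M.charge d := by
  classical
  unfold totalCharge charge leaves buds
  rw [Finset.sum_sub_distrib, Finset.sum_boole, Finset.sum_boole]

theorem subtreeCharge_eq_sum (M : HalfEdgeMap D) (d : D) :
    M.subtreeCharge d = ∑ x ∈ M.subtree d, M.charge x := by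
  classical
  unfold subtreeCharge charge leaves buds
  rw [Finset.sum_sub_distrib, Finset.sum_boole, Finset.sum_boole, Finset.inter_filter,
    Finset.inter_filter, Finset.inter_univ]

/-- The right-hand side does not involve `opp`; this is why closure and opening preserve the total
charge. -/
theorem totalCharge_eq_sum_colour (M : HalfEdgeMap D) : M.totalCharge = ∑ d, M.colour d := by
  rw [totalCharge_eq_sum]
  exact M.sum_charge_eq_sum_colour _ fun _ _ => Finset.mem_univ _

end Counting
end HalfEdgeMap

/-! ### The walk around the infinite face and its parenthesis systems. -/

namespace HalfEdgeMap

section Walk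

variable {D : Type}

/-- The `i`-th dart on the walk around the infinite face, starting from the root. -/
def walk (M : HalfEdgeMap D) (i : ℕ) : D := (M.face ^ i) M.root

/-- The first time at which the walk around the infinite face visits the dart `x`. -/
noncomputable def pos (M : HalfEdgeMap D) (x : D) : ℕ := sInf {i | M.walk i = x}

/-- The dart `x` lies on the infinite face. -/
def IsOuter (M : HalfEdgeMap D) (x : D) : Prop := M.face.SameCycle M.root x

theorem walk_zero (M : HalfEdgeMap D) : M.walk 0 = M.root := rfl

theorem walk_succ (M : HalfEdgeMap D) (i : ℕ) : M.walk (i + 1) = M.face (M.walk i) := by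
  rw [walk, pow_succ', Equiv.Perm.mul_apply, walk]

theorem face_pow_walk (M : HalfEdgeMap D) (i k : ℕ) :
    (M.face ^ k) (M.walk i) = M.walk (i + k) := by
  rw [walk, ← Equiv.Perm.mul_apply, ← pow_add, add_comm, walk]

theorem isOuter_walk (M : HalfEdgeMap D) (i : ℕ) : M.IsOuter (M.walk i) := ⟨i, by simp [walk]⟩

theorem isOuter_root (M : HalfEdgeMap D) : M.IsOuter M.root := Equiv.Perm.SameCycle.refl _ _

theorem IsOuter.face {M : HalfEdgeMap D} {x : D} (hx : M.IsOuter x) : M.IsOuter (M.face x) :=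
  Equiv.Perm.SameCycle.trans hx (Equiv.Perm.sameCycle_apply_self _ _)

theorem pos_le {M : HalfEdgeMap D} {i : ℕ} {x : D} (h : M.walk i = x) : M.pos x ≤ i :=
  Nat.sInf_le h

theorem pos_root (M : HalfEdgeMap D) : M.pos M.root = 0 :=
  Nat.le_zero.1 (pos_le M.walk_zero)

theorem walk_injective_add (M : HalfEdgeMap D) {i j k : ℕ} (h : M.walk (i + k) = M.walk (j + k)) :
    M.walk i = M.walk j := by
  rw [← face_pow_walk, ← face_pow_walk] at h
  exact (M.face ^ k).injective h

theorem pos_eq {M : HalfEdgeMap D} {i : ℕ} {x : D} (h : M.walk i = x)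
    (h' : ∀ j < i, M.walk j ≠ x) : M.pos x = i := by
  refine le_antisymm (pos_le h) ?_
  by_contra! hlt
  have h2 : M.walk (M.pos x) = x := Nat.sInf_mem (s := {i | M.walk i = x}) ⟨i, h⟩
  exact h' _ hlt h2

variable [Finite D]

theorem IsOuter.walk_pos {M : HalfEdgeMap D} {x : D} (hx : M.IsOuter x) :
    M.walk (M.pos x) = x := by
  obtain ⟨n, hn⟩ := Equiv.Perm.SameCycle.exists_nat_pow_eq hx
  exact Nat.sInf_mem (s := {i | M.walk i = x}) ⟨n, hn⟩

theorem IsOuter.pos_inj {M : HalfEdgeMap D} {x y : D} (hx : M.IsOuter x) (hy : M.IsOuter y)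
    (h : M.pos x = M.pos y) : x = y := by
  rw [← hx.walk_pos, ← hy.walk_pos, h]

/-- If the walk had already been at the same dart at an earlier time, it would have reached `y`
earlier by the same delay. -/
theorem IsOuter.pos_walk {M : HalfEdgeMap D} {y : D} (hy : M.IsOuter y) {i : ℕ}
    (hi : i ≤ M.pos y) : M.pos (M.walk i) = i := by
  refine pos_eq rfl fun j hj h => ?_
  obtain ⟨k, hk⟩ := Nat.exists_eq_add_of_le hi
  have h2 : M.walk (j + k) = y := by
    rw [← face_pow_walk, h, face_pow_walk, ← hk, hy.walk_pos]
  have := pos_le h2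
  omega

theorem nextIn_mem (M : HalfEdgeMap D) {S : Set D} {d : D} (hd : d ∈ S) : M.nextIn S d ∈ S :=
  (M.nextIn_spec hd).2

/-- If some element of `S` comes after `d` on the walk, then `nextIn` is the first one. -/
theorem nextIn_of_lt {M : HalfEdgeMap D} {S : Set D} {d y : D} (hd : M.IsOuter d)
    (hy : M.IsOuter y) (hyS : y ∈ S) (hlt : M.pos d < M.pos y) :
    M.pos d < M.pos (M.nextIn S d) ∧ M.IsOuter (M.nextIn S d) ∧ M.nextIn S d ∈ S ∧
      ∀ z ∈ S, M.IsOuter z → M.pos d < M.pos z → M.pos (M.nextIn S d) ≤ M.pos z := by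
  have hmem : ∀ z ∈ S, M.IsOuter z → M.pos d < M.pos z →
      M.pos z - M.pos d ∈ {k : ℕ | 0 < k ∧ (M.face ^ k) d ∈ S} := by
    intro z hz hzo hlt
    refine ⟨by omega, ?_⟩
    have : (M.face ^ (M.pos z - M.pos d)) d = z := by
      conv_lhs => rw [← hd.walk_pos]
      rw [face_pow_walk, hd.walk_pos, Nat.add_sub_cancel' hlt.le, hzo.walk_pos]
    rwa [this]
  have hspec : sInf {k : ℕ | 0 < k ∧ (M.face ^ k) d ∈ S} ∈
      {k : ℕ | 0 < k ∧ (M.face ^ k) d ∈ S} := Nat.sInf_mem ⟨_, hmem y hyS hy hlt⟩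
  have hle : ∀ z ∈ S, M.IsOuter z → M.pos d < M.pos z →
      sInf {k : ℕ | 0 < k ∧ (M.face ^ k) d ∈ S} ≤ M.pos z - M.pos d :=
    fun z hz hzo hlt => Nat.sInf_le (hmem z hz hzo hlt)
  unfold nextIn
  generalize sInf {k : ℕ | 0 < k ∧ (M.face ^ k) d ∈ S} = k at hspec hle
  have hk : (M.face ^ k) d = M.walk (M.pos d + k) := by
    conv_lhs => rw [← hd.walk_pos]
    rw [face_pow_walk]
  have hyk := hle y hyS hy hlt
  have hpos : M.pos ((M.face ^ k) d) = M.pos d + k := by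
    rw [hk]
    exact hy.pos_walk (by omega)
  have h0 : 0 < k := hspec.1
  refine ⟨by omega, hk ▸ M.isOuter_walk _, hspec.2, fun z hz hzo hlt' => ?_⟩
  have := hle z hz hzo hlt'
  omega

/-- A search that wraps around the end of the walk meets the root first, and the root belongs to
`S`. -/
theorem nextIn_eq_root_or_lt {M : HalfEdgeMap D} {S : Set D} {d : D} (hd : M.IsOuter d)
    (hdS : d ∈ S) (hroot : M.root ∈ S) :
    M.nextIn S d = M.root ∨ M.pos d < M.pos (M.nextIn S d) := by
  by_contra! hcon
  obtain ⟨hne, hle⟩ := hcon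
  have hspec := M.nextIn_spec hdS
  have hmin : ∀ k ∈ {k : ℕ | 0 < k ∧ (M.face ^ k) d ∈ S},
      sInf {k : ℕ | 0 < k ∧ (M.face ^ k) d ∈ S} ≤ k := fun k hk => Nat.sInf_le hk
  unfold nextIn at hne hle
  generalize sInf {k : ℕ | 0 < k ∧ (M.face ^ k) d ∈ S} = k at hspec hmin hne hle
  have hk : (M.face ^ k) d = M.walk (M.pos d + k) := by
    conv_lhs => rw [← hd.walk_pos]
    rw [face_pow_walk]
  have h0 : 0 < k := hspec.1
  rw [hk] at hne hle
  have hwa := (M.isOuter_walk (M.pos d + k)).walk_pos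
  generalize M.pos (M.walk (M.pos d + k)) = a at hle hwa
  have ha0 : a ≠ 0 := by
    rintro rfl
    exact hne hwa.symm
  rcases lt_or_ge a k with hak | hak
  · have h1 : M.walk 0 = M.walk (M.pos d + (k - a)) := by
      apply M.walk_injective_add (k := a)
      rw [Nat.zero_add, hwa]
      congr 1
      omega
    have h2 := hmin (k - a) ⟨by omega, by
      rw [← hd.walk_pos, face_pow_walk, ← h1]
      exact hroot⟩
    omega
  · have h1 : M.walk (a - k) = M.walk (M.pos d) := by
      apply M.walk_injective_add (k := k)
      rw [Nat.sub_add_cancel hak, hwa]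
    have h2 := pos_le (h1.trans hd.walk_pos)
    omega

end Walk

section Arcs

variable {D : Type}

theorem Consecutive.not_mem_unmatched {M : HalfEdgeMap D} {i j : ℕ} (hij : i < j) {b l : D}
    (h : M.Consecutive (M.unmatched i) b l) : b ∉ M.unmatched j ∧ l ∉ M.unmatched j := by
  constructor
  · intro h'
    have h2 : b ∈ M.unmatched (i + 1) := M.unmatched_antitone (Nat.succ_le_of_lt hij) h'
    exact (h2.2 l).1 h
  · intro h'
    have h2 : l ∈ M.unmatched (i + 1) := M.unmatched_antitone (Nat.succ_le_of_lt hij) h'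
    exact (h2.2 b).2 h

theorem exists_consecutive_of_not_mem_unmatched {M : HalfEdgeMap D} {i : ℕ} {x : D}
    (hx : M.IsHalfEdge x) (h : x ∉ M.unmatched i) :
    ∃ j < i, ∃ y, M.Consecutive (M.unmatched j) x y ∨ M.Consecutive (M.unmatched j) y x := by
  induction i with
  | zero => exact absurd hx h
  | succ i ih =>
    by_cases h' : x ∈ M.unmatched i
    · by_contra! hcon
      exact h ⟨h', fun y => hcon i (Nat.lt_succ_self i) y⟩
    · obtain ⟨j, hj, y, hy⟩ := ih h'
      exact ⟨j, hj.trans (Nat.lt_succ_self i), y, hy⟩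

theorem isHalfEdge_of_mem_unmatched {M : HalfEdgeMap D} {i : ℕ} {x : D}
    (h : x ∈ M.unmatched i) : M.IsHalfEdge x := M.unmatched_antitone (Nat.zero_le i) h

theorem IsBalanced.root_mem_unmatched {M : HalfEdgeMap D} (hroot : M.IsBalanced) (i : ℕ) :
    M.root ∈ M.unmatched i := by
  by_contra h
  obtain ⟨j, -, y, hy | hy⟩ := exists_consecutive_of_not_mem_unmatched hroot.1.1 h
  · exact hroot.1.2 hy.2.2.1.2
  · exact hroot.2 y ⟨j, hy⟩

/-- All half-edges lie on the infinite face. -/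
def HalfEdgesOuter (M : HalfEdgeMap D) : Prop := ∀ d, M.IsHalfEdge d → M.IsOuter d

/-- A relation `R` that matches every bud with a later leaf in a parenthesis system, such that no
unmatched half-edge is enclosed by a matched pair. -/
structure ArcSystem (M : HalfEdgeMap D) (R : D → D → Prop) : Prop where
  bud : ∀ {b l}, R b l → M.IsBud b
  leaf : ∀ {b l}, R b l → M.IsLeaf l
  lt : ∀ {b l}, R b l → M.pos b < M.pos l
  exists_leaf : ∀ {b}, M.IsBud b → ∃ l, R b l
  right_unique : ∀ {b l l'}, R b l → R b l' → l = l'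
  left_unique : ∀ {b b' l}, R b l → R b' l → b = b'
  nested : ∀ {b l x}, R b l → M.IsHalfEdge x → M.pos b < M.pos x → M.pos x < M.pos l →
    (∃ y, R x y ∧ M.pos y < M.pos l) ∨ ∃ y, R y x ∧ M.pos b < M.pos y

variable [Finite D]

/-- A parenthesis system is unique, by induction on the round. If the next unmatched half-edge after
`b` were a leaf `l` before the partner `l'` of `b`, nesting would provide a bud between `b` and `l`
paired with `l`. That bud is still unmatched, so `l` would not be the next one. -/
theorem ArcSystem.of_matches {M : HalfEdgeMap D} {R : D → D → Prop} (h : M.ArcSystem R)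
    (ho : M.HalfEdgesOuter) {b l : D} (hbl : M.Matches b l) : R b l := by
  obtain ⟨i, hi⟩ := hbl
  induction i using Nat.strong_induction_on generalizing b l with
  | _ i ih =>
  obtain ⟨hb, hl, hbud, hleaf, hnext⟩ := hi
  obtain ⟨l', hl'⟩ := h.exists_leaf hbud
  -- By induction only pairs of `R` have been removed so far, so both members of such a pair are
  -- present or both are absent.
  have hmem : ∀ {x y}, R x y → (x ∈ M.unmatched i ↔ y ∈ M.unmatched i) := by
    intro x y hxy
    constructor
    · intro hx
      by_contra hy
      obtain ⟨j, hj, z, hz | hz⟩ := exists_consecutive_of_not_mem_unmatched (h.leaf hxy).1 hy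
      · exact (h.leaf hxy).2 hz.2.2.1.2
      · obtain rfl := h.left_unique hxy (ih j hj hz)
        exact (hz.not_mem_unmatched hj).1 hx
    · intro hy
      by_contra hx
      obtain ⟨j, hj, z, hz | hz⟩ := exists_consecutive_of_not_mem_unmatched (h.bud hxy).1 hx
      · obtain rfl := h.right_unique hxy (ih j hj hz)
        exact (hz.not_mem_unmatched hj).2 hy
      · exact hz.2.2.2.1.2 (h.bud hxy).2
  have hl'U : l' ∈ M.unmatched i := (hmem hl').1 hb
  have hbo := ho b hbud.1
  have hl'o := ho l' (h.leaf hl').1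
  obtain ⟨h1, h2, h3, h4⟩ := nextIn_of_lt hbo hl'o hl'U (h.lt hl')
  rw [hnext] at h1 h2 h3 h4
  have h5 := h4 l' hl'U hl'o (h.lt hl')
  rcases h5.lt_or_eq with h5 | h5
  · exfalso
    rcases h.nested hl' hleaf.1 h1 h5 with ⟨y, hy, -⟩ | ⟨y, hy, hlt⟩
    · exact hleaf.2 (h.bud hy).2
    · have hyU : y ∈ M.unmatched i := (hmem hy).2 hl
      have := h4 y hyU (ho y (h.bud hy).1) hlt
      have := h.lt hy
      omega
  · rwa [h2.pos_inj hl'o h5]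

/-- Once the procedure is stable, consider the last unmatched bud. The next unmatched half-edge
cannot be a leaf, since it would be matched. It cannot be a later bud, by the choice made. It cannot
be the root either, because the root is a leaf. -/
theorem exists_matches_of_isBud {M : HalfEdgeMap D} (ho : M.HalfEdgesOuter)
    (hroot : M.IsBalanced) {b : D} (hb : M.IsBud b) : ∃ l, M.Matches b l := by
  have hrootU := hroot.root_mem_unmatched
  -- The unmatched sets decrease, so a round at which their cardinality is minimal is stable.
  obtain ⟨i, hi⟩ : ∃ i, M.unmatched (i + 1) = M.unmatched i := by
    refine ⟨Function.argmin fun i => (M.unmatched i).ncard, ?_⟩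
    exact Set.eq_of_subset_of_ncard_le (M.unmatched_antitone (Nat.le_succ _))
      (Function.argmin_le (fun i => (M.unmatched i).ncard) _) (Set.toFinite _)
  by_contra! hcon
  have hbU : b ∈ M.unmatched i := by
    by_contra h
    obtain ⟨j, -, y, hy | hy⟩ := exists_consecutive_of_not_mem_unmatched hb.1 h
    · exact hcon y ⟨j, hy⟩
    · exact hy.2.2.2.1.2 hb.2
  obtain ⟨c, ⟨hcU, hcb⟩, hmax⟩ := Set.exists_max_image {c | c ∈ M.unmatched i ∧ M.IsBud c} M.pos
    (Set.toFinite _) ⟨b, hbU, hb⟩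
  have hno : ¬ M.Consecutive (M.unmatched i) c (M.nextIn (M.unmatched i) c) := by
    rw [← hi] at hcU
    exact (hcU.2 _).1
  have hnU := M.nextIn_mem hcU
  have hnb : M.IsBud (M.nextIn (M.unmatched i) c) := by
    refine ⟨isHalfEdge_of_mem_unmatched hnU, ?_⟩
    by_contra h
    exact hno ⟨hcU, hnU, hcb, ⟨isHalfEdge_of_mem_unmatched hnU, h⟩, rfl⟩
  rcases nextIn_eq_root_or_lt (ho c hcb.1) hcU (hrootU i) with h | h
  · rw [h] at hnb
    exact hroot.1.2 hnb.2
  · exact absurd (hmax _ ⟨hnU, hnb⟩) (not_le.2 h)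

theorem ArcSystem.isBalanced {M : HalfEdgeMap D} {R : D → D → Prop} (h : M.ArcSystem R)
    (ho : M.HalfEdgesOuter) (hroot : M.IsLeaf M.root) : M.IsBalanced := by
  refine ⟨hroot, fun b hb => ?_⟩
  have := h.lt (h.of_matches ho hb)
  rw [pos_root] at this
  omega

theorem ArcSystem.matches_iff {M : HalfEdgeMap D} {R : D → D → Prop} (h : M.ArcSystem R)
    (ho : M.HalfEdgesOuter) (hroot : M.IsLeaf M.root) (b l : D) : M.Matches b l ↔ R b l := by
  refine ⟨h.of_matches ho, fun hbl => ?_⟩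
  obtain ⟨l', hl'⟩ := exists_matches_of_isBud ho (h.isBalanced ho hroot) (h.bud hbl)
  rwa [h.right_unique hbl (h.of_matches ho hl')]

/-- When a pair is matched, no unmatched half-edge lies between its members. An enclosed half-edge
was thus matched in an earlier round, and its own pair could not then reach over the bud or the
leaf, both still present. -/
theorem arcSystem_matches {M : HalfEdgeMap D} (ho : M.HalfEdgesOuter) (hroot : M.IsBalanced) :
    M.ArcSystem M.Matches := by
  have hrootU := hroot.root_mem_unmatched
  have key : ∀ {i b l}, M.Consecutive (M.unmatched i) b l → M.pos b < M.pos l ∧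
      ∀ z ∈ M.unmatched i, M.pos b < M.pos z → M.pos l ≤ M.pos z := by
    rintro i b l hc
    obtain ⟨hb, hl, hbud, hleaf, hnext⟩ := hc
    have hlt : M.pos b < M.pos l := by
      rcases nextIn_eq_root_or_lt (ho b hbud.1) hb (hrootU i) with h | h
      · rw [hnext] at h
        subst h
        exact absurd ⟨i, hb, hl, hbud, hleaf, hnext⟩ (hroot.2 b)
      · rwa [hnext] at h
    refine ⟨hlt, fun z hz => ?_⟩
    have := (nextIn_of_lt (ho b hbud.1) (ho l hleaf.1) hl hlt).2.2.2 z hz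
      (ho z (isHalfEdge_of_mem_unmatched hz))
    rwa [hnext] at this
  refine ⟨Matches.isBud, Matches.isLeaf, fun ⟨i, hi⟩ => (key hi).1,
    exists_matches_of_isBud ho hroot, M.matches_unique_right, M.matches_unique_left, ?_⟩
  rintro b l x ⟨i, hi⟩ hx h1 h2
  have hxU : x ∉ M.unmatched i := fun hxU => by
    have := (key hi).2 x hxU h1
    omega
  obtain ⟨j, hj, y, hy | hy⟩ := exists_consecutive_of_not_mem_unmatched hx hxU
  · refine Or.inl ⟨y, ⟨j, hy⟩, ?_⟩
    have hlU : l ∈ M.unmatched j := M.unmatched_antitone hj.le hi.2.1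
    have h3 := (key hy).2 l hlU h2
    refine lt_of_le_of_ne h3 fun e => ?_
    have := (ho y hy.2.2.2.1.1).pos_inj (ho l hi.2.2.2.1.1) e
    subst this
    exact (hy.not_mem_unmatched hj).2 hi.2.1
  · refine Or.inr ⟨y, ⟨j, hy⟩, ?_⟩
    have hbU : b ∈ M.unmatched j := M.unmatched_antitone hj.le hi.1
    by_contra! h3
    rcases h3.lt_or_eq with h3 | h3
    · have := (key hy).2 b hbU h3
      omega
    · have := (ho y hy.2.2.1.1).pos_inj (ho b hi.2.2.1.1) h3
      subst this
      exact (hy.not_mem_unmatched hj).1 hi.1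

end Arcs
end HalfEdgeMap

/-! ### The opening of a map: termination and recovery of the map by closure. -/

namespace HalfEdgeMap

section Step

variable {D : Type}

/-- Otherwise the infinite face would be stable under `opp`, hence under `rot`, and would contain
every dart by connectedness. -/
theorem exists_outer_not_outer_opp {M : HalfEdgeMap D} (hM : M.IsConnected) {x : D}
    (hx : ¬ M.IsOuter x) : ∃ c, M.IsOuter c ∧ ¬ M.IsOuter (M.opp c) := by
  by_contra! h
  refine hx ((hM M.root x).of_invariant M.IsOuter M.isOuter_root (fun z hz => ?_) h)
  rw [← face_opp]
  exact (h z hz).face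

theorem colour_rot (M : HalfEdgeMap D) (x : D) : M.colour (M.rot x) = M.colour x := by
  have := M.black_rot x
  unfold colour
  by_cases h : M.black x <;> simp [this, h]

theorem openState_succ (M : HalfEdgeMap D) (n : ℕ) :
    M.openState (n + 1) = openStep (M.openState n) :=
  Function.iterate_succ_apply' _ _ _

theorem openStep_of_cut {s : HalfEdgeMap D × D}
    (h : s.1.black s.2 ∧ ¬ s.1.IsHalfEdge s.2 ∧ ¬ s.1.IsSeparating s.2) :
    openStep s = (s.1.cut s.2, s.1.face s.2) := by
  unfold openStep
  rw [if_pos h]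

theorem openStep_of_not_cut {s : HalfEdgeMap D × D}
    (h : ¬ (s.1.black s.2 ∧ ¬ s.1.IsHalfEdge s.2 ∧ ¬ s.1.IsSeparating s.2)) :
    openStep s = (s.1, s.1.face s.2) := by
  unfold openStep
  rw [if_neg h]

theorem closureFun_root {M : HalfEdgeMap D} (h : M.IsBalanced) :
    M.closureFun M.root = M.root := by
  rw [closureFun_of_not, M.opp_root]
  rintro ⟨x, hx | hx⟩
  · exact h.1.2 hx.isBud.2
  · exact h.2 x hx

end Step

section Insertion

variable {D : Type} [Finite D]

/-- If an edge separates the infinite face from another face, then cutting it inserts the walk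
around the other face into the walk around the infinite face. -/
theorem cut_pos (M : HalfEdgeMap D) {d : D} (hd : M.IsOuter d) (hd' : ¬ M.IsOuter (M.opp d)) :
    ∃ g, 0 < g ∧ (M.cut d).IsOuter (M.opp d) ∧ (M.cut d).pos (M.opp d) = M.pos d + g ∧
      ∀ x, M.IsOuter x → (M.cut d).IsOuter x ∧
        ((M.pos x ≤ M.pos d ∧ (M.cut d).pos x = M.pos x) ∨
          (M.pos d < M.pos x ∧ (M.cut d).pos x = M.pos x + g)) := by
  classical
  -- The shift `g` is the length of the face that contains `opp d`, that is, its least positive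
  -- return time.
  have hex : ∃ g, 0 < g ∧ (M.face ^ g) (M.opp d) = M.opp d :=
    ⟨orderOf M.face, orderOf_pos _, by simp [pow_orderOf_eq_one]⟩
  obtain ⟨hg0, hg⟩ := Nat.find_spec hex
  have hmin : ∀ j < Nat.find hex, 0 < j → (M.face ^ j) (M.opp d) ≠ M.opp d :=
    fun j hj h0 h => Nat.find_min hex hj ⟨h0, h⟩
  generalize Nat.find hex = g at hg0 hg hmin
  have hno : ∀ j, ¬ M.IsOuter ((M.face ^ j) (M.opp d)) := fun j h =>
    hd' (Equiv.Perm.SameCycle.trans h (Equiv.Perm.SameCycle.symm ⟨j, by simp⟩))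
  have hne : ∀ {x}, M.IsOuter x → x ≠ M.opp d := fun hx e => hd' (e ▸ hx)
  have hne' : ∀ {x}, ¬ M.IsOuter x → x ≠ d := fun hx e => hx (e ▸ hd)
  -- The new walk has three pieces: the old walk up to `d` (`h1`), the inner face ending at `opp d`
  -- (`h2`, `h3`), and the rest of the old walk delayed by `g` (`h4`).
  have h1 : ∀ i, i ≤ M.pos d → (M.cut d).walk i = M.walk i := by
    intro i hi
    induction i with
    | zero => rfl
    | succ i ih =>
      rw [walk_succ, walk_succ, ih (by omega)]
      refine M.cut_face_of_ne (fun e => ?_) (hne (M.isOuter_walk i))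
      have := hd.pos_walk (i := i) (by omega)
      rw [e] at this
      omega
  have h2 : ∀ j, 0 < j → j ≤ g → (M.cut d).walk (M.pos d + j) = (M.face ^ j) (M.opp d) := by
    intro j hj hjg
    induction j, hj using Nat.le_induction with
    | base =>
      change (M.cut d).walk (M.pos d + 1) = (M.face ^ 1) (M.opp d)
      rw [pow_one, walk_succ, h1 _ le_rfl, hd.walk_pos, cut_face_self]
    | succ j hj ih =>
      rw [← add_assoc, walk_succ, ih (by omega), pow_succ', Equiv.Perm.mul_apply]
      exact M.cut_face_of_ne (hne' (hno j)) (hmin j (by omega) hj)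
  have h3 : (M.cut d).walk (M.pos d + g) = M.opp d := by rw [h2 g hg0 le_rfl, hg]
  have h4 : ∀ y, M.IsOuter y → ∀ j, M.pos d + 1 + j ≤ M.pos y →
      (M.cut d).walk (M.pos d + 1 + j + g) = M.walk (M.pos d + 1 + j) := by
    intro y hy j hj
    induction j with
    | zero =>
      have : M.pos d + 1 + 0 + g = M.pos d + g + 1 := by omega
      rw [this, walk_succ, h3, cut_face_opp, add_zero, walk_succ, hd.walk_pos]
    | succ j ih =>
      have : M.pos d + 1 + (j + 1) + g = M.pos d + 1 + j + g + 1 := by omega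
      rw [this, walk_succ, ih (by omega), ← add_assoc, walk_succ]
      refine M.cut_face_of_ne (fun e => ?_) (hne (M.isOuter_walk _))
      have := hy.pos_walk (i := M.pos d + 1 + j) (by omega)
      rw [e] at this
      omega
  refine ⟨g, hg0, h3 ▸ isOuter_walk _ _, pos_eq h3 fun j hj e => ?_, fun x hx => ?_⟩
  · rcases le_or_gt j (M.pos d) with hjd | hjd
    · rw [h1 j hjd] at e
      exact hne (M.isOuter_walk j) e
    · obtain ⟨k, rfl⟩ := Nat.exists_eq_add_of_lt hjd
      rw [add_assoc, h2 _ (by omega) (by omega)] at e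
      exact hmin _ (by omega) (by omega) e
  · rcases le_or_gt (M.pos x) (M.pos d) with hxd | hxd
    · have hw : (M.cut d).walk (M.pos x) = x := by rw [h1 _ hxd, hx.walk_pos]
      refine ⟨hw ▸ isOuter_walk _ _, Or.inl ⟨hxd, pos_eq hw fun j hj e => ?_⟩⟩
      rw [h1 j (by omega)] at e
      have := pos_le e
      omega
    · obtain ⟨k, hk⟩ := Nat.exists_eq_add_of_lt hxd
      have hk' : M.pos x = M.pos d + 1 + k := by omega
      have hw : (M.cut d).walk (M.pos x + g) = x := by
        rw [hk', h4 x hx k hk'.ge, ← hk', hx.walk_pos]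
      refine ⟨hw ▸ isOuter_walk _ _, Or.inr ⟨hxd, pos_eq hw fun j hj e => ?_⟩⟩
      rcases le_or_gt j (M.pos d) with hjd | hjd
      · rw [h1 j hjd] at e
        have := pos_le e
        omega
      · rcases le_or_gt j (M.pos d + g) with hjg | hjg
        · obtain ⟨i, rfl⟩ := Nat.exists_eq_add_of_lt hjd
          rw [add_assoc, h2 _ (by omega) (by omega)] at e
          exact hno _ (e ▸ hx)
        · obtain ⟨i, rfl⟩ := Nat.exists_eq_add_of_lt hjg
          have hi : M.pos d + g + i + 1 = M.pos d + 1 + i + g := by omega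
          rw [hi, h4 x hx i (by omega)] at e
          have := pos_le e
          omega

theorem HalfEdgesOuter.cut {M : HalfEdgeMap D} (ho : M.HalfEdgesOuter) {d : D}
    (hd : M.IsOuter d) (hd' : ¬ M.IsOuter (M.opp d)) : (M.cut d).HalfEdgesOuter := by
  obtain ⟨g, -, h1, -, h2⟩ := M.cut_pos hd hd'
  intro x hx
  rcases (M.cut_isHalfEdge_iff d x).1 hx with hx | rfl | rfl
  · exact (h2 x (ho x hx)).1
  · exact (h2 x hd).1
  · exact h1

/-- The new pair bounds a block inserted just after `d`. An old pair encloses this block entirely or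
not at all, and the order of the old half-edges is unchanged. -/
theorem ArcSystem.cut {M : HalfEdgeMap D} {R : D → D → Prop} (h : M.ArcSystem R)
    (ho : M.HalfEdgesOuter) {d : D} (hb : M.black d) (hd : M.IsOuter d)
    (hd' : ¬ M.IsOuter (M.opp d)) :
    (M.cut d).ArcSystem fun b l => R b l ∨ (b = d ∧ l = M.opp d) := by
  have hdh : ¬ M.IsHalfEdge d := fun h => hd' (by rwa [h])
  have hdh' := opp_not_isHalfEdge hdh
  have hw : ¬ M.black (M.opp d) := fun h => (M.black_opp d hdh).1 h hb
  obtain ⟨g, hg, hoo, hpo, hpos⟩ := M.cut_pos hd hd'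
  have hpd : (M.cut d).pos d = M.pos d := by
    have := hpos d hd
    omega
  have hRb : ∀ {b l}, R b l → M.IsOuter b ∧ b ≠ d := fun hbl =>
    ⟨ho _ (h.bud hbl).1, fun e => hdh (e ▸ (h.bud hbl).1)⟩
  have hRl : ∀ {b l}, R b l → M.IsOuter l ∧ l ≠ M.opp d := fun hbl =>
    ⟨ho _ (h.leaf hbl).1, fun e => hdh' (e ▸ (h.leaf hbl).1)⟩
  have hlt : ∀ {x y}, M.IsOuter x → M.IsOuter y →
      ((M.cut d).pos x < (M.cut d).pos y ↔ M.pos x < M.pos y) := by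
    intro x y hx hy
    have h1 := hpos x hx
    have h2 := hpos y hy
    omega
  refine ⟨?_, ?_, ?_, ?_, ?_, ?_, ?_⟩
  · rintro b l (hbl | ⟨rfl, rfl⟩)
    · exact ⟨(M.cut_isHalfEdge_iff d b).2 (Or.inl (h.bud hbl).1), (h.bud hbl).2⟩
    · exact ⟨M.cut_opp_self b, hb⟩
  · rintro b l (hbl | ⟨rfl, rfl⟩)
    · exact ⟨(M.cut_isHalfEdge_iff d l).2 (Or.inl (h.leaf hbl).1), (h.leaf hbl).2⟩
    · exact ⟨M.cut_opp_opp b, hw⟩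
  · rintro b l (hbl | ⟨rfl, rfl⟩)
    · exact (hlt (hRb hbl).1 (hRl hbl).1).2 (h.lt hbl)
    · omega
  · rintro b ⟨hbh, hbb⟩
    rcases (M.cut_isHalfEdge_iff d b).1 hbh with hx | rfl | rfl
    · obtain ⟨l, hl⟩ := h.exists_leaf ⟨hx, hbb⟩
      exact ⟨l, Or.inl hl⟩
    · exact ⟨_, Or.inr ⟨rfl, rfl⟩⟩
    · exact absurd hbb hw
  · rintro b l l' (h1 | ⟨rfl, rfl⟩) (h2 | ⟨h2, rfl⟩)
    · exact h.right_unique h1 h2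
    · exact absurd h2 (hRb h1).2
    · exact absurd rfl (hRb h2).2
    · rfl
  · rintro b b' l (h1 | ⟨rfl, rfl⟩) (h2 | ⟨rfl, h2⟩)
    · exact h.left_unique h1 h2
    · exact absurd h2 (hRl h1).2
    · exact absurd rfl (hRl h2).2
    · rfl
  · rintro b l x (hbl | ⟨rfl, rfl⟩) hx h1 h2
    · have hb1 := hRb hbl
      have hl1 := hRl hbl
      have hpb := hpos b hb1.1
      have hpl := hpos l hl1.1
      rcases (M.cut_isHalfEdge_iff d x).1 hx with hx | rfl | rfl
      · have hxo := ho x hx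
        rcases h.nested hbl hx ((hlt hb1.1 hxo).1 h1) ((hlt hxo hl1.1).1 h2) with
          ⟨y, hy, hy'⟩ | ⟨y, hy, hy'⟩
        · exact Or.inl ⟨y, Or.inl hy, (hlt (hRl hy).1 hl1.1).2 hy'⟩
        · exact Or.inr ⟨y, Or.inl hy, (hlt hb1.1 (hRb hy).1).2 hy'⟩
      · refine Or.inl ⟨_, Or.inr ⟨rfl, rfl⟩, ?_⟩
        omega
      · refine Or.inr ⟨d, Or.inr ⟨rfl, rfl⟩, ?_⟩
        have : M.pos b ≠ M.pos d := fun e => hb1.2 (hb1.1.pos_inj hd e)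
        omega
    -- Old half-edges lie on the old infinite face, so none belongs to the inserted block.
    · exfalso
      rcases (M.cut_isHalfEdge_iff b x).1 hx with hx | rfl | rfl
      · have := hpos x (ho x hx)
        omega
      · omega
      · omega

end Insertion

section Termination

variable {D : Type} [Fintype D]

/-- If there is more than one face, then some edge is traversed from black to white on the walk
around the infinite face and has another face on its other side. -/
theorem exists_black_outer_not_outer_opp {M : HalfEdgeMap D} (hM : M.IsConnected) {x : D}
    (hx : ¬ M.IsOuter x) : ∃ c, M.IsOuter c ∧ M.black c ∧ ¬ M.IsOuter (M.opp c) := by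
  classical
  obtain ⟨c, hc, hc'⟩ := exists_outer_not_outer_opp hM hx
  by_contra! hcon
  set F : Finset D := Finset.univ.filter M.IsOuter with hF
  have hmem : ∀ {y}, y ∈ F ↔ M.IsOuter y := by simp [hF]
  -- The darts `opp y` and `face y` hang from the same vertex, and `face` permutes the infinite
  -- face.
  have h1 : ∑ y ∈ F, M.colour (M.opp y) = ∑ y ∈ F, M.colour y := by
    refine Finset.sum_bij (fun y _ => M.face y) (fun y hy => hmem.2 (hmem.1 hy).face)
      (fun y _ z _ h => M.face.injective h) (fun y hy => ?_) (fun y _ => ?_)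
    · refine ⟨M.face.symm y, hmem.2 ?_, by simp⟩
      exact Equiv.Perm.SameCycle.trans (hmem.1 hy) (Equiv.Perm.SameCycle.symm ⟨1, by simp⟩)
    · rw [face_apply, colour_rot]
  have h2 : ∑ y ∈ F with M.IsOuter (M.opp y), M.colour (M.opp y) =
      ∑ y ∈ F with M.IsOuter (M.opp y), M.colour y := by
    refine Finset.sum_bij (fun y _ => M.opp y) (fun y hy => ?_)
      (fun y _ z _ h => M.opp.injective h) (fun y hy => ⟨M.opp y, ?_, M.opp_opp y⟩) (fun y _ => rfl)
    all_goals
      rw [Finset.mem_filter, hmem] at hy ⊢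
      exact ⟨hy.2, by rw [M.opp_opp]; exact hy.1⟩
  rw [← Finset.sum_filter_add_sum_filter_not F fun y => M.IsOuter (M.opp y),
    ← Finset.sum_filter_add_sum_filter_not F (fun y => M.IsOuter (M.opp y)) (f := M.colour), h2,
    add_right_inj] at h1
  -- After cancellation of the edges with the infinite face on both sides, only white darts would be
  -- left: the two sums would be `-k` and `k`, with `k` positive.
  have h3 : ∀ y ∈ F.filter fun y => ¬ M.IsOuter (M.opp y),
      M.colour y = 1 ∧ M.colour (M.opp y) = -1 := by
    intro y hy
    rw [Finset.mem_filter, hmem] at hy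
    have hb : ¬ M.black y := fun hb => hy.2 (hcon y hy.1 hb)
    have hh : ¬ M.IsHalfEdge y := fun h => hy.2 (by rw [h]; exact hy.1)
    have : M.colour y = 1 := by simp [colour, hb]
    exact ⟨this, by rw [M.colour_opp hh, this]⟩
  rw [Finset.sum_congr rfl fun y hy => (h3 y hy).2, Finset.sum_congr rfl fun y hy => (h3 y hy).1,
    Finset.sum_const, Finset.sum_const] at h1
  have h4 : c ∈ F.filter fun y => ¬ M.IsOuter (M.opp y) :=
    Finset.mem_filter.2 ⟨hmem.2 hc, hc'⟩
  have h5 := Finset.card_pos.2 ⟨c, h4⟩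
  simp only [nsmul_eq_mul] at h1
  omega

theorem isSeparating_of_outer {M : HalfEdgeMap D} (hM : M.IsMap) {d : D} (hd : M.IsOuter d)
    (hh : ¬ M.IsHalfEdge d) : M.IsSeparating d ↔ M.IsOuter (M.opp d) := by
  rw [hM.isSeparating_iff hh]
  exact ⟨fun h => Equiv.Perm.SameCycle.trans hd h,
    fun h => Equiv.Perm.SameCycle.trans (Equiv.Perm.SameCycle.symm hd) h⟩

theorem isOuter_of_allSeparating {M : HalfEdgeMap D} (hM : M.IsMap) (h : M.AllSeparating)
    (x : D) : M.IsOuter x := by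
  by_contra hx
  obtain ⟨c, hc, hc'⟩ := exists_outer_not_outer_opp hM.connected hx
  have hh : ¬ M.IsHalfEdge c := fun h => hc' (by rw [h]; exact hc)
  exact hc' ((isSeparating_of_outer hM hc hh).1 (h c hh))

theorem card_faces_eq_one_iff {M : HalfEdgeMap D} : M.faces.card = 1 ↔ ∀ x, M.IsOuter x := by
  rw [card_faces, Nat.card_eq_one_iff_unique]
  constructor
  · rintro ⟨h, -⟩ x
    exact Quotient.exact (h.elim (Quotient.mk _ M.root) (Quotient.mk _ x))
  · intro h
    refine ⟨⟨fun p q => ?_⟩, ⟨Quotient.mk _ M.root⟩⟩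
    induction p using Quotient.inductionOn with | _ x
    induction q using Quotient.inductionOn with | _ y
    exact Quotient.sound (Equiv.Perm.SameCycle.trans (Equiv.Perm.SameCycle.symm (h x)) (h y))

theorem IsMap.cut {M : HalfEdgeMap D} (hM : M.IsMap) {d : D} (hd : M.IsOuter d)
    (hd' : ¬ M.IsOuter (M.opp d)) : (M.cut d).IsMap := by
  have hh : ¬ M.IsHalfEdge d := fun h => hd' (by rw [h]; exact hd)
  refine ⟨?_, ?_, HalfEdgesOuter.cut hM.outer hd hd'⟩
  · have := mt (isSeparating_of_outer hM hd hh).1 hd'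
    unfold IsSeparating at this
    exact not_not.1 this
  · have h1 := M.card_vertices_cut d
    have h2 := M.card_faces_cut_of_not (d := d) fun h => hd' (Equiv.Perm.SameCycle.trans hd h)
    have h3 := M.card_edges_cut hh
    have h4 := hM.euler
    omega

/-- The map `S` is obtained from `M` by cutting the edges that are matched by `R`. -/
structure IsOpened (M S : HalfEdgeMap D) (R : D → D → Prop) : Prop where
  rot : S.rot = M.rot
  black : S.black = M.black
  root : S.root = M.root
  isMap : S.IsMap
  arcs : S.ArcSystem R
  opp_of_arc : ∀ {b l}, R b l → M.opp b = l
  opp_of_not : ∀ {x}, (¬ ∃ y, R x y ∨ R y x) → S.opp x = M.opp x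

theorem isOpened_self {M : HalfEdgeMap D} (hM : M.IsMap) (hb : ∀ d, ¬ M.IsBud d) :
    M.IsOpened M fun _ _ => False :=
  ⟨rfl, rfl, rfl, hM, ⟨False.elim, False.elim, False.elim, fun h => absurd h (hb _), False.elim,
    False.elim, False.elim⟩, False.elim, fun _ => rfl⟩

theorem IsOpened.cut {M S : HalfEdgeMap D} {R : D → D → Prop} (h : M.IsOpened S R) {d : D}
    (hb : S.black d) (hd : S.IsOuter d) (hd' : ¬ S.IsOuter (S.opp d)) :
    M.IsOpened (S.cut d) fun b l => R b l ∨ (b = d ∧ l = S.opp d) := by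
  have hh : ¬ S.IsHalfEdge d := fun h => hd' (by rw [h]; exact hd)
  refine ⟨h.rot, h.black, h.root, h.isMap.cut hd hd', h.arcs.cut h.isMap.outer hb hd hd', ?_, ?_⟩
  · rintro b l (hbl | ⟨rfl, rfl⟩)
    · exact h.opp_of_arc hbl
    · refine (h.opp_of_not ?_).symm
      rintro ⟨y, hy | hy⟩
      · exact hh (h.arcs.bud hy).1
      · exact hh (h.arcs.leaf hy).1
  · intro x hx
    rw [S.cut_opp_of_ne, h.opp_of_not]
    · rintro ⟨y, hy | hy⟩
      · exact hx ⟨y, Or.inl (Or.inl hy)⟩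
      · exact hx ⟨y, Or.inr (Or.inl hy)⟩
    · rintro rfl
      exact hx ⟨_, Or.inl (Or.inr ⟨rfl, rfl⟩)⟩
    · rintro rfl
      exact hx ⟨_, Or.inr (Or.inr ⟨rfl, rfl⟩)⟩

theorem isOpened_openState {M : HalfEdgeMap D} (hM : M.IsMap) (hb : ∀ d, ¬ M.IsBud d) (n : ℕ) :
    (∃ R, M.IsOpened (M.openState n).1 R) ∧ (M.openState n).1.IsOuter (M.openState n).2 := by
  induction n with
  | zero => exact ⟨⟨_, isOpened_self hM hb⟩, M.isOuter_root⟩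
  | succ n ih =>
    rw [openState_succ]
    generalize M.openState n = s at ih
    obtain ⟨⟨R, hR⟩, ho⟩ := ih
    by_cases h : s.1.black s.2 ∧ ¬ s.1.IsHalfEdge s.2 ∧ ¬ s.1.IsSeparating s.2
    · rw [openStep_of_cut h]
      have h' : ¬ s.1.IsOuter (s.1.opp s.2) :=
        mt (isSeparating_of_outer hR.isMap ho h.2.1).2 h.2.2
      refine ⟨⟨_, hR.cut h.1 ho h'⟩, ?_⟩
      obtain ⟨g, -, -, -, hpos⟩ := s.1.cut_pos ho h'
      exact (hpos _ ho.face).1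
    · rw [openStep_of_not_cut h]
      exact ⟨⟨R, hR⟩, ho.face⟩

/-- From a state with the fewest edges on, nothing is cut and the walk turns around the infinite
face. If an edge were not separating, this turn would reach a black dart with another face on its
other side, and would cut there. -/
theorem exists_allSeparating {M : HalfEdgeMap D} (hM : M.IsMap) (hb : ∀ d, ¬ M.IsBud d) :
    ∃ n, (M.openState n).1.AllSeparating := by
  by_contra! hcon
  set f : ℕ → ℕ := fun n => (M.openState n).1.edges.card with hf
  have hmin : ∀ n, f (Function.argmin f) ≤ f n := fun n => Function.argmin_le f n
  generalize Function.argmin f = n at hmin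
  obtain ⟨⟨R, hR⟩, ho⟩ := isOpened_openState hM hb n
  obtain ⟨c, hc, hcb, hc'⟩ : ∃ c, (M.openState n).1.IsOuter c ∧ (M.openState n).1.black c ∧
      ¬ (M.openState n).1.IsOuter ((M.openState n).1.opp c) := by
    have h1 := hcon n
    unfold AllSeparating at h1
    push Not at h1
    obtain ⟨d, hd, hd'⟩ := h1
    rw [hR.isMap.isSeparating_iff hd] at hd'
    have : ∃ x, ¬ (M.openState n).1.IsOuter x := by
      by_contra! h2
      exact hd' (Equiv.Perm.SameCycle.trans (Equiv.Perm.SameCycle.symm (h2 _)) (h2 _))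
    obtain ⟨x, hx⟩ := this
    exact exists_black_outer_not_outer_opp hR.isMap.connected hx
  have hch : ¬ (M.openState n).1.IsHalfEdge c := fun h => hc' (by rw [h]; exact hc)
  have hcs : ¬ (M.openState n).1.IsSeparating c := mt (isSeparating_of_outer hR.isMap hc hch).1 hc'
  have hstep : ∀ k, (M.openState (n + k)).1 = (M.openState n).1 ∧
      (M.openState (n + k)).2 = ((M.openState n).1.face ^ k) (M.openState n).2 := by
    intro k
    induction k with
    | zero => simp
    | succ k ih =>
      have hle := hmin (n + k + 1)
      rw [hf] at hle
      simp only [← add_assoc] at hle ⊢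
      rw [openState_succ] at hle ⊢
      by_cases h : (M.openState (n + k)).1.black (M.openState (n + k)).2 ∧
        ¬ (M.openState (n + k)).1.IsHalfEdge (M.openState (n + k)).2 ∧
        ¬ (M.openState (n + k)).1.IsSeparating (M.openState (n + k)).2
      · have := card_edges_cut _ h.2.1
        rw [openStep_of_cut h] at hle
        rw [ih.1] at hle this
        dsimp only at hle
        omega
      · rw [openStep_of_not_cut h, ih.1, ih.2, pow_succ', Equiv.Perm.mul_apply]
        exact ⟨rfl, rfl⟩
  obtain ⟨k, hk⟩ := (Equiv.Perm.SameCycle.trans (Equiv.Perm.SameCycle.symm ho)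
    hc).exists_nat_pow_eq
  have h1 := hstep k
  rw [hk] at h1
  have hle := hmin (n + k + 1)
  rw [hf] at hle
  simp only at hle
  rw [openState_succ, openStep_of_cut (by rw [h1.1, h1.2]; exact ⟨hcb, hch, hcs⟩), h1.1,
    h1.2] at hle
  have := card_edges_cut _ hch
  dsimp only at hle
  omega

theorem opening_allSeparating {M : HalfEdgeMap D} (hM : M.IsMap) (hb : ∀ d, ¬ M.IsBud d) :
    M.opening.AllSeparating :=
  Nat.sInf_mem (s := {n : ℕ | (M.openState n).1.AllSeparating}) (exists_allSeparating hM hb)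

theorem isOpened_opening {M : HalfEdgeMap D} (hM : M.IsMap) (hb : ∀ d, ¬ M.IsBud d) :
    ∃ R, M.IsOpened M.opening R :=
  (isOpened_openState hM hb _).1

theorem isTree_opening {M : HalfEdgeMap D} (hM : M.IsMap) (hb : ∀ d, ¬ M.IsBud d) :
    M.opening.IsTree := by
  obtain ⟨R, hR⟩ := isOpened_opening hM hb
  exact ⟨hR.isMap, card_faces_eq_one_iff.2
    (isOuter_of_allSeparating hR.isMap (opening_allSeparating hM hb))⟩

theorem IsOpened.isLeaf_root {M S : HalfEdgeMap D} {R : D → D → Prop} (h : M.IsOpened S R)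
    (hb : ∀ d, ¬ M.IsBud d) : S.IsLeaf S.root := by
  refine ⟨S.opp_root, fun hr => hb M.root ⟨M.opp_root, ?_⟩⟩
  rwa [h.root, h.black] at hr

theorem IsOpened.isBalanced {M S : HalfEdgeMap D} {R : D → D → Prop} (h : M.IsOpened S R)
    (hb : ∀ d, ¬ M.IsBud d) : S.IsBalanced :=
  h.arcs.isBalanced h.isMap.outer (h.isLeaf_root hb)

/-- The cut pairs form a parenthesis system, so by uniqueness the matching procedure finds exactly
these pairs. -/
theorem closure_eq_of_isOpened {M S : HalfEdgeMap D} {R : D → D → Prop} (h : M.IsOpened S R)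
    (hb : ∀ d, ¬ M.IsBud d) : S.closure = M := by
  have hm := h.arcs.matches_iff h.isMap.outer (h.isLeaf_root hb)
  unfold HalfEdgeMap.closure
  rw [dif_pos (closureFun_root (h.isBalanced hb))]
  refine ext' h.rot (fun x => ?_) h.black h.root
  change S.closureFun x = M.opp x
  by_cases hx : ∃ y, S.Matches x y ∨ S.Matches y x
  · obtain ⟨y, hy⟩ := hx
    rw [S.closureFun_of_matches hy]
    rcases hy with hy | hy
    · exact (h.opp_of_arc ((hm _ _).1 hy)).symm
    · rw [← h.opp_of_arc ((hm _ _).1 hy), M.opp_opp]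
  · rw [S.closureFun_of_not hx]
    refine h.opp_of_not ?_
    simpa only [hm] using hx

theorem closure_opening {M : HalfEdgeMap D} (hM : M.IsMap) (hb : ∀ d, ¬ M.IsBud d) :
    M.opening.closure = M := by
  obtain ⟨R, hR⟩ := isOpened_opening hM hb
  exact closure_eq_of_isOpened hR hb

theorem isBalanced_opening {M : HalfEdgeMap D} (hM : M.IsMap) (hb : ∀ d, ¬ M.IsBud d) :
    M.opening.IsBalanced := by
  obtain ⟨R, hR⟩ := isOpened_opening hM hb
  exact hR.isBalanced hb

end Termination
end HalfEdgeMap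

/-! ### Positions, heights and subtrees in a tree. -/

namespace HalfEdgeMap

section TreeWalk

variable {D : Type} [Fintype D] {T : HalfEdgeMap D}

theorem pos_lt_card (ho : ∀ x, T.IsOuter x) (x : D) : T.pos x < Fintype.card D := by
  have h : Set.InjOn T.walk (Finset.range (T.pos x + 1)) := by
    intro i hi j hj h
    simp only [Finset.coe_range, Set.mem_Iio] at hi hj
    have h1 := (ho x).pos_walk (i := i) (by omega)
    have h2 := (ho x).pos_walk (i := j) (by omega)
    rw [← h1, ← h2, h]
  have := Finset.card_le_card_of_injOn T.walk (fun _ _ => Finset.mem_univ _) h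
  rw [Finset.card_range, Finset.card_univ] at this
  omega

/-- First-visit times are injective and smaller than the number of darts, so each such time is
taken. -/
theorem pos_walk (ho : ∀ x, T.IsOuter x) {i : ℕ} (hi : i < Fintype.card D) :
    T.pos (T.walk i) = i := by
  have hinj : Function.Injective fun x => (⟨T.pos x, pos_lt_card ho x⟩ : Fin (Fintype.card D)) :=
    fun x y h => (ho x).pos_inj (ho y) (Fin.mk.inj h)
  have hsurj := (Fintype.bijective_iff_injective_and_card _).2 ⟨hinj, by simp⟩
  obtain ⟨x, hx⟩ := hsurj.2 ⟨i, hi⟩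
  have hx' : T.pos x = i := Fin.mk.inj hx
  exact (ho x).pos_walk hx'.ge

theorem walk_card (ho : ∀ x, T.IsOuter x) : T.walk (Fintype.card D) = T.root := by
  have h1 := (ho (T.walk (Fintype.card D))).walk_pos
  have h2 := pos_lt_card ho (T.walk (Fintype.card D))
  generalize T.pos (T.walk (Fintype.card D)) = j at h1 h2
  have h3 : T.walk 0 = T.walk (Fintype.card D - j) := by
    apply T.walk_injective_add (k := j)
    rw [Nat.zero_add, h1, Nat.sub_add_cancel h2.le]
  rcases Nat.eq_zero_or_pos j with rfl | hj
  · rw [← h1, walk_zero]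
  · have h4 := pos_walk ho (i := Fintype.card D - j) (by omega)
    rw [← h3, walk_zero, pos_root] at h4
    omega

theorem walk_pos_succ (ho : ∀ x, T.IsOuter x) (x : D) : T.walk (T.pos x + 1) = T.face x := by
  rw [walk_succ, (ho x).walk_pos]

end TreeWalk

section Single

variable {D : Type} {T : HalfEdgeMap D}

theorem ArcSystem.lt_of_bud_lt {R : D → D → Prop} (ha : T.ArcSystem R) {b l b' l' : D}
    (h : R b l) (h' : R b' l') (h1 : T.pos b < T.pos b') (h2 : T.pos b' < T.pos l) :
    T.pos l' < T.pos l := by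
  rcases ha.nested h (ha.bud h').1 h1 h2 with ⟨y, hy, hlt⟩ | ⟨y, hy, -⟩
  · rwa [ha.right_unique h' hy]
  · exact absurd (ha.bud h').2 (ha.leaf hy).2

theorem ArcSystem.lt_of_lt_leaf {R : D → D → Prop} (ha : T.ArcSystem R) {b l b' l' : D}
    (h : R b l) (h' : R b' l') (h1 : T.pos b < T.pos l') (h2 : T.pos l' < T.pos l) :
    T.pos b < T.pos b' := by
  rcases ha.nested h (ha.leaf h').1 h1 h2 with ⟨y, hy, -⟩ | ⟨y, hy, hlt⟩
  · exact absurd (ha.bud hy).2 (ha.leaf h').2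
  · rwa [ha.left_unique h' hy]

theorem bud_ne_leaf {b l b' l' : D} (h : T.Matches b l) (h' : T.Matches b' l') : b ≠ l' :=
  fun e => h'.isLeaf.2 (e ▸ h.isBud.2)

open Classical in
/-- `1` for a single leaf, `0` for all other darts. -/
noncomputable def single (T : HalfEdgeMap D) (x : D) : ℤ := if T.IsSingle x then 1 else 0

theorem single_nonneg (x : D) : 0 ≤ T.single x := by
  unfold single
  split_ifs <;> simp

theorem single_of_not_isHalfEdge {x : D} (hx : ¬ T.IsHalfEdge x) : T.single x = 0 := by
  have : ¬ T.IsSingle x := fun h => hx h.1.1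
  simp [single, this]

theorem charge_of_isBud {x : D} (hx : T.IsBud x) : T.charge x = -1 := by
  have := hx.2
  simp [charge, hx, IsLeaf, this]

theorem charge_of_isLeaf {x : D} (hx : T.IsLeaf x) : T.charge x = 1 := by
  have := hx.2
  simp [charge, hx, IsBud, this]

theorem single_of_isBud {x : D} (hx : T.IsBud x) : T.single x = 0 := by
  have : ¬ T.IsSingle x := fun h => h.1.2 hx.2
  simp [single, this]

end Single

section Height

variable {D : Type} [Fintype D] {T : HalfEdgeMap D}

open Classical in
/-- The buds of the matched pairs that enclose the position `q` on the walk. -/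
noncomputable def cover (T : HalfEdgeMap D) (q : ℕ) : Finset D :=
  Finset.univ.filter fun b => ∃ l, T.Matches b l ∧ T.pos b < q ∧ q ≤ T.pos l

/-- The number of matched pairs that enclose the position `q` on the walk. -/
noncomputable def height (T : HalfEdgeMap D) (q : ℕ) : ℕ := (T.cover q).card

theorem mem_cover {q : ℕ} {b : D} :
    b ∈ T.cover q ↔ ∃ l, T.Matches b l ∧ T.pos b < q ∧ q ≤ T.pos l := by
  classical
  simp [cover]

theorem height_zero : T.height 0 = 0 := by
  rw [height, Finset.card_eq_zero, Finset.eq_empty_iff_forall_notMem]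
  intro b hb
  obtain ⟨l, -, h, -⟩ := mem_cover.1 hb
  omega

theorem height_card (ho : ∀ x, T.IsOuter x) : T.height (Fintype.card D) = 0 := by
  rw [height, Finset.card_eq_zero, Finset.eq_empty_iff_forall_notMem]
  intro b hb
  obtain ⟨l, -, -, h⟩ := mem_cover.1 hb
  have := pos_lt_card ho l
  omega

/-- Pairs do not cross, so a pair around the bud is also around `q`. The pair of the bud itself
encloses `q` but, by the strict inequality in `cover`, not its own bud. This comparison decides
below which fused pairs can straddle an edge. -/
theorem height_bud_lt (ha : T.ArcSystem T.Matches) (ho : ∀ x, T.IsOuter x) {b l : D} {q : ℕ}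
    (h : T.Matches b l) (h1 : T.pos b < q) (h2 : q ≤ T.pos l) : T.height (T.pos b) < T.height q := by
  refine Finset.card_lt_card ⟨fun b' hb' => ?_, fun hss => ?_⟩
  · obtain ⟨l', hl', h3, h4⟩ := mem_cover.1 hb'
    refine mem_cover.2 ⟨l', hl', by omega, ?_⟩
    have hne : T.pos b ≠ T.pos l' := fun e => bud_ne_leaf h hl' ((ho _).pos_inj (ho _) e)
    have := ha.lt_of_bud_lt hl' h h3 (by omega)
    omega
  · obtain ⟨l', -, h3, -⟩ := mem_cover.1 (hss (mem_cover.2 ⟨l, h, h1, h2⟩))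
    omega

/-- Just behind the leaf, the enclosing pairs are the same as at the bud: jumping over a pair does
not change the height. -/
theorem height_leaf_succ (ha : T.ArcSystem T.Matches) (ho : ∀ x, T.IsOuter x) {b l : D}
    (h : T.Matches b l) : T.height (T.pos l + 1) = T.height (T.pos b) := by
  unfold height
  congr 1
  ext b'
  rw [mem_cover, mem_cover]
  refine exists_congr fun l' => and_congr_right fun hl' => ?_
  have h1 := ha.lt h
  have h2 := ha.lt hl'
  have hn1 : T.pos b ≠ T.pos l' := fun e => bud_ne_leaf h hl' ((ho _).pos_inj (ho _) e)
  have hn2 : T.pos b' ≠ T.pos l := fun e => bud_ne_leaf hl' h ((ho _).pos_inj (ho _) e)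
  have hn3 : T.pos b = T.pos b' → T.pos l = T.pos l' := fun e => by
    rw [ha.right_unique h ((ho _).pos_inj (ho _) e ▸ hl')]
  have h3 := ha.lt_of_bud_lt hl' h
  have h4 := ha.lt_of_bud_lt h hl'
  omega

/-- Among the pairs around `q`, the one with the last bud is enclosed by all the others. -/
theorem exists_innermost (ho : ∀ x, T.IsOuter x) {q : ℕ}
    (hq : 0 < T.height q) : ∃ b l, T.Matches b l ∧ T.pos b < q ∧ q ≤ T.pos l ∧
      T.height q ≤ T.height (T.pos b) + 1 := by
  classical
  obtain ⟨b, hb, hmax⟩ := Finset.exists_max_image (T.cover q) T.pos (Finset.card_pos.1 hq)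
  obtain ⟨l, hl, h1, h2⟩ := mem_cover.1 hb
  refine ⟨b, l, hl, h1, h2, ?_⟩
  have : T.cover q ⊆ insert b (T.cover (T.pos b)) := by
    intro b' hb'
    rw [Finset.mem_insert]
    by_cases e : b' = b
    · exact Or.inl e
    · obtain ⟨l', hl', h3, h4⟩ := mem_cover.1 hb'
      have h5 := hmax b' hb'
      have h6 : T.pos b' ≠ T.pos b := fun h => e ((ho _).pos_inj (ho _) h)
      exact Or.inr (mem_cover.2 ⟨l', hl', by omega, by omega⟩)
  exact (Finset.card_le_card this).trans (Finset.card_insert_le _ _)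

/-- The height goes up after a bud, down after a matched leaf, and is otherwise constant. The last
term compensates the charge of the unmatched leaves. -/
theorem height_succ_add_charge (ha : T.ArcSystem T.Matches) (ho : ∀ x, T.IsOuter x) (x : D) :
    (T.height (T.pos x + 1) : ℤ) + T.charge x = T.height (T.pos x) + T.single x := by
  classical
  by_cases hbud : T.IsBud x
  · obtain ⟨l, hl⟩ := ha.exists_leaf hbud
    have : T.cover (T.pos x + 1) = insert x (T.cover (T.pos x)) := by
      ext b
      rw [Finset.mem_insert, mem_cover, mem_cover]
      constructor
      · rintro ⟨l', hl', h1, h2⟩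
        by_cases e : b = x
        · exact Or.inl e
        · have : T.pos b ≠ T.pos x := fun h => e ((ho _).pos_inj (ho _) h)
          exact Or.inr ⟨l', hl', by omega, by omega⟩
      · rintro (rfl | ⟨l', hl', h1, h2⟩)
        · exact ⟨l, hl, by omega, ha.lt hl⟩
        · have : T.pos x ≠ T.pos l' := fun e => bud_ne_leaf hl hl' ((ho _).pos_inj (ho _) e)
          exact ⟨l', hl', by omega, by omega⟩
    have hx : x ∉ T.cover (T.pos x) := fun h => by
      obtain ⟨_, _, h1, _⟩ := mem_cover.1 h
      omega
    rw [charge_of_isBud hbud, single_of_isBud hbud, height, this, Finset.card_insert_of_notMem hx,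
      height]
    push_cast
    ring
  · by_cases hm : ∃ b, T.Matches b x
    · obtain ⟨b, hb⟩ := hm
      have hs : T.single x = 0 := by
        have : ¬ T.IsSingle x := fun h => h.2 b hb
        simp [single, this]
      have : T.cover (T.pos x) = insert b (T.cover (T.pos b)) := by
        ext b'
        rw [Finset.mem_insert, mem_cover, mem_cover]
        constructor
        · rintro ⟨l', hl', h1, h2⟩
          by_cases e : b' = b
          · exact Or.inl e
          · have h3 : T.pos b' ≠ T.pos b := fun h => e ((ho _).pos_inj (ho _) h)
            have h4 : T.pos x ≠ T.pos l' := fun h => by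
              have := (ho _).pos_inj (ho _) h
              subst this
              exact e (ha.left_unique hl' hb)
            have h5 := ha.lt_of_bud_lt hb hl'
            have h6 := ha.lt hb
            exact Or.inr ⟨l', hl', by omega, by omega⟩
        · rintro (rfl | ⟨l', hl', h1, h2⟩)
          · exact ⟨x, hb, ha.lt hb, le_rfl⟩
          · have hne : T.pos b ≠ T.pos l' := fun e => bud_ne_leaf hb hl' ((ho _).pos_inj (ho _) e)
            have := ha.lt_of_bud_lt hl' hb h1
            have := ha.lt hb
            exact ⟨l', hl', by omega, by omega⟩
      have hx : b ∉ T.cover (T.pos b) := fun h => by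
        obtain ⟨_, _, h1, _⟩ := mem_cover.1 h
        omega
      rw [charge_of_isLeaf hb.isLeaf, hs, height_leaf_succ ha ho hb, height, height, this,
        Finset.card_insert_of_notMem hx]
      push_cast
      ring
    · have h1 : T.height (T.pos x + 1) = T.height (T.pos x) := by
        unfold height
        congr 1
        ext b'
        rw [mem_cover, mem_cover]
        refine exists_congr fun l' => and_congr_right fun hl' => ?_
        have hn1 : T.pos x ≠ T.pos l' := fun e => hm ⟨b', (ho _).pos_inj (ho _) e ▸ hl'⟩
        have hn2 : T.pos x ≠ T.pos b' := fun e => hbud ((ho _).pos_inj (ho _) e ▸ hl'.isBud)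
        omega
      have h2 : T.charge x = T.single x := by
        by_cases hh : T.IsHalfEdge x
        · have hl : T.IsLeaf x := ⟨hh, fun h => hbud ⟨hh, h⟩⟩
          have : T.IsSingle x := ⟨hl, fun b hb => hm ⟨b, hb⟩⟩
          simp [charge_of_isLeaf hl, single, this]
        · rw [charge_of_not_isHalfEdge hh, single_of_not_isHalfEdge hh]
      rw [h1, h2]

theorem height_add_sum_charge (ha : T.ArcSystem T.Matches) (ho : ∀ x, T.IsOuter x) {p p' : ℕ}
    (hp : p ≤ p') (hp' : p' ≤ Fintype.card D) :
    (T.height p' : ℤ) + ∑ i ∈ Finset.Ico p p', T.charge (T.walk i) =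
      T.height p + ∑ i ∈ Finset.Ico p p', T.single (T.walk i) := by
  induction p', hp using Nat.le_induction with
  | base => simp
  | succ k hk ih =>
    have h1 := height_succ_add_charge ha ho (T.walk k)
    rw [pos_walk ho (by omega)] at h1
    have h2 := ih (by omega)
    rw [Finset.sum_Ico_succ_top hk, Finset.sum_Ico_succ_top hk]
    linarith

theorem height_single (ha : T.ArcSystem T.Matches) (ho : ∀ x, T.IsOuter x) {x : D}
    (hx : T.IsSingle x) : T.height (T.pos x) = 0 := by
  rw [height, Finset.card_eq_zero, Finset.eq_empty_iff_forall_notMem]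
  intro b hb
  obtain ⟨l, hl, h1, h2⟩ := mem_cover.1 hb
  have hne : T.pos x ≠ T.pos l := fun e => hx.2 b ((ho _).pos_inj (ho _) e ▸ hl)
  rcases ha.nested hl hx.1.1 h1 (by omega) with ⟨y, hy, -⟩ | ⟨y, hy, -⟩
  · exact hx.1.2 hy.isBud.2
  · exact hx.2 y hy

/-- The height vanishes at both ends of the walk. -/
theorem sum_single (ha : T.ArcSystem T.Matches) (ho : ∀ x, T.IsOuter x) :
    ∑ x, T.single x = T.totalCharge := by
  have hsum : ∀ f : D → ℤ, ∑ x, f x = ∑ i ∈ Finset.Ico 0 (Fintype.card D), f (T.walk i) := by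
    intro f
    refine Finset.sum_bij (fun x _ => T.pos x) (fun x _ => ?_)
      (fun x _ y _ h => (ho x).pos_inj (ho y) h) (fun i hi => ?_) fun x _ => ?_
    · simp [pos_lt_card ho x]
    · exact ⟨T.walk i, Finset.mem_univ _, pos_walk ho (Finset.mem_Ico.1 hi).2⟩
    · rw [(ho x).walk_pos]
  have h := height_add_sum_charge ha ho (Nat.zero_le _) le_rfl
  rw [height_card ho, height_zero] at h
  rw [totalCharge_eq_sum, hsum, hsum]
  linarith

end Height

section Subtree

variable {D : Type} [Fintype D] {T : HalfEdgeMap D}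

theorem IsTree.isOuter (hT : T.IsTree) (x : D) : T.IsOuter x := card_faces_eq_one_iff.1 hT.2 x

theorem IsTree.isSeparating (hT : T.IsTree) {d : D} (hd : ¬ T.IsHalfEdge d) : T.IsSeparating d :=
  (isSeparating_of_outer hT.1 (hT.isOuter d) hd).2 (hT.isOuter _)

theorem mem_subtree {d x : D} : x ∈ T.subtree d ↔ (T.cut d).Linked d x := by
  classical
  simp [subtree]

theorem IsTree.opp_not_mem_subtree (hT : T.IsTree) {d : D} (hd : ¬ T.IsHalfEdge d) :
    T.opp d ∉ T.subtree d := by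
  rw [mem_subtree]
  exact (isSeparating_iff T hT.1.connected d).1 (hT.isSeparating hd)

theorem linked_cut_walk (ho : ∀ x, T.IsOuter x) {d : D} {i j : ℕ} (hij : i ≤ j)
    (hj : j < Fintype.card D)
    (h : ∀ k, i ≤ k → k < j → k ≠ T.pos d ∧ k ≠ T.pos (T.opp d)) :
    (T.cut d).Linked (T.walk i) (T.walk j) := by
  induction j, hij using Nat.le_induction with
  | base => exact Linked.rfl
  | succ k hk ih =>
    refine (ih (by omega) fun n h1 h2 => h n h1 (by omega)).trans ?_
    have h1 := h k hk (Nat.lt_succ_self k)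
    have h2 := pos_walk ho (i := k) (by omega)
    have h3 := (T.cut d).linked_face (T.walk k)
    rwa [T.cut_face_of_ne, ← walk_succ] at h3
    · exact fun e => h1.1 (by rw [← e, h2])
    · exact fun e => h1.2 (by rw [← e, h2])

/-- The subtrees of a tree are intervals for the walk around the tree. -/
theorem IsTree.mem_subtree_iff (hT : T.IsTree) {d : D} (hd : ¬ T.IsHalfEdge d)
    (hlt : T.pos (T.opp d) < T.pos d) (x : D) :
    x ∈ T.subtree d ↔ T.pos (T.opp d) < T.pos x ∧ T.pos x ≤ T.pos d := by
  have ho := hT.isOuter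
  have hxN := pos_lt_card ho x
  have hdN := pos_lt_card ho d
  -- In the cut map the successor of `d` is the dart following `opp d`, so the stretch from just
  -- after `opp d` up to `d` stays with `d`.
  have hin : T.pos (T.opp d) < T.pos x → T.pos x ≤ T.pos d → (T.cut d).Linked d x := by
    intro h1 h2
    have h3 := (T.cut d).linked_face d
    rw [cut_face_self, ← walk_pos_succ ho] at h3
    have h4 := linked_cut_walk ho (d := d) (i := T.pos (T.opp d) + 1) (j := T.pos x) h1 hxN
      fun k _ _ => by omega
    rw [(ho x).walk_pos] at h4
    exact h3.trans h4
  -- The stretch up to `opp d` and the stretch after `d` are joined at `opp d`, whose successor in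
  -- the cut map is the dart following `d`.
  have hout : ∀ y, ¬ (T.pos (T.opp d) < T.pos y ∧ T.pos y ≤ T.pos d) →
      (T.cut d).Linked T.root y := by
    intro y hy
    have hlow : ∀ k, k ≤ T.pos (T.opp d) → (T.cut d).Linked T.root (T.walk k) := fun k hk =>
      linked_cut_walk ho (d := d) (Nat.zero_le k) (by omega) fun _ _ _ => by omega
    rcases le_or_gt (T.pos y) (T.pos (T.opp d)) with h1 | h1
    · have := hlow _ h1
      rwa [(ho y).walk_pos] at this
    · have h2 : T.pos d + 1 ≤ T.pos y := by omega
      have h3 := (T.cut d).linked_face (T.opp d)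
      rw [cut_face_opp, ← walk_pos_succ ho] at h3
      have h4 := linked_cut_walk ho (d := d) h2 (pos_lt_card ho y) fun k _ _ => by omega
      have h5 := hlow _ le_rfl
      rw [(ho _).walk_pos] at h4 h5
      exact h5.trans (h3.trans h4)
  constructor
  · intro hx
    by_contra h
    refine hT.opp_not_mem_subtree hd (mem_subtree.2 ?_)
    exact (mem_subtree.1 hx).trans ((hout x h).symm.trans (hout _ (by omega)))
  · rintro ⟨h1, h2⟩
    exact mem_subtree.2 (hin h1 h2)

theorem IsTree.mem_subtree_opp (hT : T.IsTree) {d : D} (hd : ¬ T.IsHalfEdge d) (x : D) :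
    x ∈ T.subtree (T.opp d) ↔ x ∉ T.subtree d := by
  have h := hT.opp_not_mem_subtree hd
  rw [mem_subtree] at h
  rw [mem_subtree, mem_subtree, cut_opp_comm]
  constructor
  · exact fun h1 h2 => h (h2.trans h1.symm)
  · intro h1
    rcases (T.linked_iff_cut d d x).1 (hT.1.connected d x) with h2 | h2 | h2
    · exact absurd h2 h1
    · exact h2.2
    · exact absurd h2.1 h

theorem pos_opp_ne (ho : ∀ x, T.IsOuter x) {d : D} (hd : ¬ T.IsHalfEdge d) :
    T.pos (T.opp d) ≠ T.pos d := fun e => hd ((ho _).pos_inj (ho _) e)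

/-- The walk enters a lower subtree through its edge before leaving it through `d`; the root has
position `0`, outside the interval. -/
theorem IsTree.root_not_mem_subtree (hT : T.IsTree) {d : D} (hd : ¬ T.IsHalfEdge d) :
    T.root ∉ T.subtree d ↔ T.pos (T.opp d) < T.pos d := by
  have hne := pos_opp_ne hT.isOuter hd
  rcases lt_or_gt_of_ne hne with h | h
  · rw [hT.mem_subtree_iff hd h, pos_root]
    omega
  · have := hT.mem_subtree_iff (opp_not_isHalfEdge hd) (by rwa [T.opp_opp]) T.root
    rw [hT.mem_subtree_opp hd, T.opp_opp, pos_root] at this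
    rw [this]
    omega

/-- The variation of the height along a lower subtree. -/
theorem IsTree.height_add_subtreeCharge (hT : T.IsTree) (ha : T.ArcSystem T.Matches) {d : D}
    (hd : ¬ T.IsHalfEdge d) (hlt : T.pos (T.opp d) < T.pos d) :
    (T.height (T.pos d) : ℤ) + T.subtreeCharge d =
      T.height (T.pos (T.opp d)) + ∑ x ∈ T.subtree d, T.single x := by
  have ho := hT.isOuter
  have hsum : ∀ f : D → ℤ, ∑ x ∈ T.subtree d, f x =
      ∑ i ∈ Finset.Ico (T.pos (T.opp d) + 1) (T.pos d + 1), f (T.walk i) := by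
    intro f
    refine Finset.sum_bij (fun x _ => T.pos x) (fun x hx => ?_)
      (fun x _ y _ h => (ho x).pos_inj (ho y) h) (fun i hi => ?_) fun x _ => ?_
    · rw [hT.mem_subtree_iff hd hlt] at hx
      rw [Finset.mem_Ico]
      omega
    · rw [Finset.mem_Ico] at hi
      have := pos_lt_card ho d
      have hw := pos_walk ho (i := i) (by omega)
      refine ⟨T.walk i, (hT.mem_subtree_iff hd hlt _).2 ?_, hw⟩
      omega
    · rw [(ho x).walk_pos]
  have h1 := height_add_sum_charge ha ho (p := T.pos (T.opp d) + 1) (p' := T.pos d + 1) (by omega)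
    (pos_lt_card ho d)
  have h2 := height_succ_add_charge ha ho d
  have h3 := height_succ_add_charge ha ho (T.opp d)
  rw [charge_of_not_isHalfEdge hd, single_of_not_isHalfEdge hd] at h2
  rw [charge_of_not_isHalfEdge (opp_not_isHalfEdge hd),
    single_of_not_isHalfEdge (opp_not_isHalfEdge hd)] at h3
  rw [subtreeCharge_eq_sum, hsum, hsum]
  linarith

theorem sum_single_subtree_nonneg (d : D) : 0 ≤ ∑ x ∈ T.subtree d, T.single x :=
  Finset.sum_nonneg fun x _ => single_nonneg x

/-- A subtree that does not contain the root contains at most `totalCharge - 1` single leaves. -/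
theorem sum_single_subtree_lt (ha : T.ArcSystem T.Matches) (ho : ∀ x, T.IsOuter x)
    (hb : T.IsBalanced) {d : D} (hd : T.root ∉ T.subtree d) :
    ∑ x ∈ T.subtree d, T.single x < T.totalCharge := by
  classical
  rw [← sum_single ha ho]
  refine Finset.sum_lt_sum_of_subset (Finset.subset_univ _) (Finset.mem_univ T.root) hd ?_
    fun x _ _ => single_nonneg x
  have : T.IsSingle T.root := hb
  simp [single, this]

/-- Over a union of vertices, the sum of the colours is divisible by the common divisor of the
degrees. -/
theorem dvd_sum_colour {m : ℕ} (hm : T.DegreesDivisibleBy m) (s : Finset D)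
    (hs : ∀ x ∈ s, T.rot x ∈ s) : (m : ℤ) ∣ ∑ x ∈ s, T.colour x := by
  classical
  have hv : ∀ x y, y ∈ T.vertexOf x ↔ T.rot.SameCycle x y := by
    intro x y
    simp [vertexOf]
  rw [← Finset.sum_fiberwise_of_maps_to (t := s.image T.vertexOf) (g := T.vertexOf)
    fun x hx => Finset.mem_image_of_mem _ hx]
  refine Finset.dvd_sum fun v hv' => ?_
  obtain ⟨x, hx, rfl⟩ := Finset.mem_image.1 hv'
  have h1 : (s.filter fun y => T.vertexOf y = T.vertexOf x) = T.vertexOf x := by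
    ext y
    rw [Finset.mem_filter, hv]
    constructor
    · rintro ⟨-, h⟩
      rw [← hv, ← h, hv]
    · intro h
      refine ⟨h.of_invariant (· ∈ s) hx hs, ?_⟩
      ext z
      rw [hv, hv]
      exact ⟨fun h' => h.trans h', fun h' => h.symm.trans h'⟩
  have h2 : ∀ y ∈ T.vertexOf x, T.colour y = T.colour x := fun y hy =>
    ((hv x y).1 hy).of_invariant (fun y => T.colour y = T.colour x) rfl fun z hz => by
      rw [colour_rot, hz]
  rw [h1, Finset.sum_congr rfl h2, Finset.sum_const, nsmul_eq_mul]
  refine Dvd.dvd.mul_right ?_ _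
  exact Int.natCast_dvd_natCast.2 (hm _ (Finset.mem_image_of_mem _ (Finset.mem_univ x)))

/-- After the cut, the subtree is a union of vertices closed under `opp`, so its charge is a sum of
colours, divisible vertex by vertex. The half-edge `d`, which `subtreeCharge` ignores, accounts for
the term `colour d`. -/
theorem IsTree.dvd_subtreeCharge (hT : T.IsTree) {m : ℕ} (hm : T.DegreesDivisibleBy m) {d : D}
    (hd : ¬ T.IsHalfEdge d) : (m : ℤ) ∣ T.subtreeCharge d + T.colour d := by
  classical
  have hdm : d ∈ T.subtree d := mem_subtree.2 Linked.rfl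
  have h1 := dvd_sum_colour hm (T.subtree d) fun x hx =>
    mem_subtree.2 ((mem_subtree.1 hx).trans ((T.cut d).linked_rot x))
  have h2 := (T.cut d).sum_charge_eq_sum_colour (T.subtree d) fun x hx =>
    mem_subtree.2 ((mem_subtree.1 hx).trans ((T.cut d).linked_opp x))
  have h3 : ∑ x ∈ T.subtree d, (T.cut d).charge x = T.subtreeCharge d + T.colour d := by
    rw [subtreeCharge_eq_sum, ← Finset.add_sum_erase _ _ hdm, ← Finset.add_sum_erase _ _ hdm,
      charge_of_not_isHalfEdge hd, charge_of_isHalfEdge (T.cut_opp_self d), zero_add, add_comm]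
    congr 1
    refine Finset.sum_congr rfl fun x hx => ?_
    rw [Finset.mem_erase] at hx
    have hx2 : x ≠ T.opp d := fun e => hT.opp_not_mem_subtree hd (e ▸ hx.2)
    have : (T.cut d).IsHalfEdge x ↔ T.IsHalfEdge x := by
      rw [cut_isHalfEdge_iff]
      tauto
    by_cases hh : T.IsHalfEdge x
    · rw [charge_of_isHalfEdge hh, charge_of_isHalfEdge (this.2 hh)]
      rfl
    · rw [charge_of_not_isHalfEdge hh, charge_of_not_isHalfEdge (mt this.1 hh)]
  rw [← h3, h2]
  exact h1

end Subtree
end HalfEdgeMap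

/-! ### Partial closures and the rounds of the opening walk. -/

namespace HalfEdgeMap

section PartialClosure

variable {D : Type} {T S : HalfEdgeMap D} {A : D → Prop}

/-- The map `S` is obtained from `T` by fusing the matched pairs whose bud belongs to `A`. -/
structure IsPartialClosure (T S : HalfEdgeMap D) (A : D → Prop) : Prop where
  rot : S.rot = T.rot
  black : S.black = T.black
  root : S.root = T.root
  opp_bud : ∀ {b l}, T.Matches b l → A b → S.opp b = l
  opp_of_not : ∀ {x}, (∀ b l, T.Matches b l → A b → x ≠ b ∧ x ≠ l) → S.opp x = T.opp x

theorem IsPartialClosure.opp_leaf (h : T.IsPartialClosure S A) {b l : D} (hbl : T.Matches b l)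
    (hb : A b) : S.opp l = b := by
  rw [← h.opp_bud hbl hb, S.opp_opp]

theorem IsPartialClosure.opp_of_not_isHalfEdge (h : T.IsPartialClosure S A) {x : D}
    (hx : ¬ T.IsHalfEdge x) : S.opp x = T.opp x := by
  refine h.opp_of_not fun b l hbl _ => ⟨?_, ?_⟩
  · rintro rfl
    exact hx hbl.isBud.1
  · rintro rfl
    exact hx hbl.isLeaf.1

theorem IsPartialClosure.congr (h : T.IsPartialClosure S A) {A' : D → Prop}
    (hA : ∀ b l, T.Matches b l → (A b ↔ A' b)) : T.IsPartialClosure S A' :=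
  ⟨h.rot, h.black, h.root, fun hbl hb => h.opp_bud hbl ((hA _ _ hbl).2 hb), fun hx =>
    h.opp_of_not fun b l hbl hb => hx b l hbl ((hA b l hbl).1 hb)⟩

theorem IsPartialClosure.eq_of_empty (h : T.IsPartialClosure S A)
    (hA : ∀ b l, T.Matches b l → ¬ A b) : S = T :=
  ext' h.rot (fun _ => h.opp_of_not fun b l hbl hb => absurd hb (hA b l hbl)) h.black h.root

theorem Linked.mono {M M' : HalfEdgeMap D} (hrot : M'.rot = M.rot)
    (hopp : ∀ z, M.opp z ≠ z → M'.opp z = M.opp z) {x y : D} (h : M.Linked x y) :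
    M'.Linked x y := by
  refine h.of_invariant (fun y => M'.Linked x y) Linked.rfl (fun z hz => ?_) fun z hz => ?_
  · rw [← hrot]
    exact hz.trans (M'.linked_rot z)
  · by_cases hz' : M.opp z = z
    · rwa [hz']
    · rw [← hopp z hz']
      exact hz.trans (M'.linked_opp z)

theorem IsPartialClosure.isConnected (h : T.IsPartialClosure S A) (hT : T.IsConnected) :
    S.IsConnected :=
  fun x y => (hT x y).mono h.rot fun _ hz => h.opp_of_not_isHalfEdge hz

theorem IsPartialClosure.isPartialClosure_cut [Finite D] (h : T.IsPartialClosure S A) {b l : D}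
    (hbl : T.Matches b l) (hb : A b) :
    T.IsPartialClosure (S.cut b) fun b' => A b' ∧ b' ≠ b := by
  have hl : S.opp b = l := h.opp_bud hbl hb
  refine ⟨h.rot, h.black, h.root, fun {b' l'} hbl' hb' => ?_, fun {x} hx => ?_⟩
  · rw [S.cut_opp_of_ne hb'.2, h.opp_bud hbl' hb'.1]
    rw [hl]
    exact bud_ne_leaf hbl' hbl
  · by_cases h1 : x = b
    · rw [h1, cut_opp_self]
      exact hbl.isBud.1.symm
    · by_cases h2 : x = S.opp b
      · rw [h2, cut_opp_opp, hl]
        exact hbl.isLeaf.1.symm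
      · rw [S.cut_opp_of_ne h1 h2]
        refine h.opp_of_not fun b' l' hbl' hb' => ?_
        by_cases e : b' = b
        · subst e
          obtain rfl := T.matches_unique_right hbl hbl'
          exact ⟨h1, hl ▸ h2⟩
        · exact hx b' l' hbl' ⟨hb', e⟩

/-- The edges of the tree alone connect all vertices, and cutting a fused pair keeps them. -/
theorem IsPartialClosure.not_isSeparating_bud [Finite D] (h : T.IsPartialClosure S A)
    (hT : T.IsConnected) {b l : D} (hbl : T.Matches b l) (hb : A b) : ¬ S.IsSeparating b :=
  not_not.2 ((h.isPartialClosure_cut hbl hb).isConnected hT)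

theorem isPartialClosure_closure [Finite D] (hb : T.IsBalanced) :
    T.IsPartialClosure T.closure fun _ => True := by
  unfold HalfEdgeMap.closure
  rw [dif_pos (closureFun_root hb)]
  refine ⟨rfl, rfl, rfl, fun {b l} hbl _ => ?_, fun {x} hx => ?_⟩
  · exact T.closureFun_of_matches (Or.inl hbl)
  · refine T.closureFun_of_not ?_
    rintro ⟨y, hy | hy⟩
    · exact (hx _ _ hy trivial).1 rfl
    · exact (hx _ _ hy trivial).2 rfl

end PartialClosure

section Stage

variable {D : Type} [Fintype D] {T S : HalfEdgeMap D} {A : D → Prop}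

/-- An edge of the tree is separating in a partial closure if and only if no fused pair joins the
two subtrees at this edge. -/
theorem IsPartialClosure.isSeparating_iff (h : T.IsPartialClosure S A) (hT : T.IsTree) {d : D}
    (hd : ¬ T.IsHalfEdge d) :
    S.IsSeparating d ↔
      ∀ b l, T.Matches b l → A b → (b ∈ T.subtree d ↔ l ∈ T.subtree d) := by
  have hS := h.isConnected hT.1.connected
  have hopp := h.opp_of_not_isHalfEdge hd
  have hmono : ∀ {x y}, (T.cut d).Linked x y → (S.cut d).Linked x y := fun hxy =>
    Linked.mono (M := T.cut d) (M' := S.cut d) h.rot (fun z hz => by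
      have h1 : ¬ (T.cut d).IsHalfEdge z := hz
      rw [cut_isHalfEdge_iff] at h1
      push Not at h1
      rw [T.cut_opp_of_ne h1.2.1 h1.2.2, S.cut_opp_of_ne h1.2.1 (hopp ▸ h1.2.2),
        h.opp_of_not_isHalfEdge h1.1]) hxy
  rw [HalfEdgeMap.isSeparating_iff S hS, hopp]
  constructor
  · intro hsep b l hbl hb
    have hbl' : (S.cut d).Linked b l := by
      have h1 := (S.cut d).linked_opp b
      rwa [S.cut_opp_of_ne, h.opp_bud hbl hb] at h1
      · rintro rfl
        exact hd hbl.isBud.1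
      · rintro rfl
        rw [hopp] at hbl
        exact opp_not_isHalfEdge hd hbl.isBud.1
    have hin : ∀ {x}, x ∈ T.subtree d → (S.cut d).Linked d x := fun hx =>
      hmono (mem_subtree.1 hx)
    have hout : ∀ {x}, x ∉ T.subtree d → (S.cut d).Linked (T.opp d) x := fun hx => by
      have := mem_subtree.1 ((hT.mem_subtree_opp hd _).2 hx)
      rw [cut_opp_comm] at this
      exact hmono this
    by_contra hne
    apply hsep
    by_cases hbs : b ∈ T.subtree d
    · have hls : l ∉ T.subtree d := fun hls => hne (iff_of_true hbs hls)
      exact (hin hbs).trans (hbl'.trans (hout hls).symm)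
    · have hls : l ∈ T.subtree d := by
        by_contra hls
        exact hne (iff_of_false hbs hls)
      exact (hin hls).trans (hbl'.symm.trans (hout hbs).symm)
  · intro hall hlink
    refine hT.opp_not_mem_subtree hd (hlink.of_invariant (· ∈ T.subtree d)
      (mem_subtree.2 Linked.rfl) (fun z hz => ?_) fun z hz => ?_)
    · rw [cut_rot, h.rot]
      exact mem_subtree.2 ((mem_subtree.1 hz).trans ((T.cut d).linked_rot z))
    · by_cases h1 : z = d
      · rw [h1] at hz ⊢
        rwa [cut_opp_self]
      · by_cases h2 : z = S.opp d
        · rw [h2] at hz ⊢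
          rwa [cut_opp_opp]
        · rw [S.cut_opp_of_ne h1 h2]
          by_cases h3 : ∃ b l, T.Matches b l ∧ A b ∧ (z = b ∨ z = l)
          · obtain ⟨b, l, hbl, hb, rfl | rfl⟩ := h3
            · rw [h.opp_bud hbl hb]
              exact (hall _ _ hbl hb).1 hz
            · rw [h.opp_leaf hbl hb]
              exact (hall _ _ hbl hb).2 hz
          · push Not at h3
            rw [h.opp_of_not h3]
            have h4 := (T.cut d).linked_opp z
            rw [T.cut_opp_of_ne h1 (hopp ▸ h2)] at h4
            exact mem_subtree.2 ((mem_subtree.1 hz).trans h4)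

/-- The buds that are not yet cut when the opening walk, in its round `r`, has reached the
position `q`. -/
def remaining (T : HalfEdgeMap D) (r q : ℕ) (b : D) : Prop :=
  r < T.height (T.pos b) ∨ (T.height (T.pos b) = r ∧ q ≤ T.pos b)

/-- One step of the opening walk on a partial closure, provided that no edge of the tree is cut. -/
theorem IsPartialClosure.openStep (hT : T.IsTree) (ha : T.ArcSystem T.Matches) {r : ℕ} {x : D}
    (h : T.IsPartialClosure S (T.remaining r (T.pos x))) (hx : T.height (T.pos x) ≤ r)
    (hsep : ¬ T.IsHalfEdge x → T.black x → S.IsSeparating x) :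
    ∃ q, T.pos x < q ∧ q ≤ Fintype.card D ∧ T.height q ≤ r ∧
      (HalfEdgeMap.openStep (S, x)).2 = T.walk q ∧
      T.IsPartialClosure (HalfEdgeMap.openStep (S, x)).1 (T.remaining r q) ∧
      ∀ p, T.pos x < p → p < q → r < T.height p := by
  have ho := hT.isOuter
  have hxN := pos_lt_card ho x
  by_cases hcut : ∃ l, T.Matches x l ∧ T.height (T.pos x) = r
  -- A fused bud of height `r`: the walk cuts it and goes on just behind its leaf.
  · obtain ⟨l, hl, hr⟩ := hcut
    have hrem : T.remaining r (T.pos x) x := Or.inr ⟨hr, le_rfl⟩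
    have hopp := h.opp_bud hl hrem
    rw [openStep_of_cut ⟨?_, ?_, ?_⟩]
    · refine ⟨T.pos l + 1, ?_, pos_lt_card ho l, ?_, ?_, ?_, ?_⟩
      · have := ha.lt hl
        omega
      · rw [height_leaf_succ ha ho hl]
        exact hx
      · change S.face x = _
        have hl' : T.opp l = l := hl.isLeaf.1
        rw [walk_pos_succ ho, face_apply, face_apply, hopp, h.rot, hl']
      -- Buds between `x` and `l` have height above `r`, so they remain whether the current position
      -- is `pos x` or `pos l + 1`.
      · refine (h.isPartialClosure_cut hl hrem).congr fun b l' hbl => ?_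
        have h1 := fun h1 h2 => height_bud_lt ha ho hl (q := T.pos b) h1 h2
        have h2 : b ≠ x → T.pos b ≠ T.pos x := fun e e' => e ((ho _).pos_inj (ho _) e')
        have h3 : b = x → T.pos b = T.pos x := fun e => by rw [e]
        have h4 := ha.lt hl
        unfold remaining
        by_cases e : b = x
        · subst e
          simp only [ne_eq, not_true_eq_false, and_false, false_iff]
          omega
        · have h5 := h2 e
          simp only [ne_eq, e, not_false_eq_true, and_true]
          omega
      · intro p h1 h2
        rw [← hr]
        exact height_bud_lt ha ho hl h1 (by omega)
    · change S.black x
      rw [h.black]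
      exact hl.isBud.2
    · intro hh
      have hh' : S.opp x = x := hh
      rw [hopp] at hh'
      exact bud_ne_leaf hl hl hh'.symm
    · exact h.not_isSeparating_bud hT.1.connected hl hrem
  -- Here `x` is not fused. As a leaf, it would have a bud of smaller height, thus below `r`, whose
  -- pair is already cut.
  · have hopp : S.opp x = T.opp x := by
      refine h.opp_of_not fun b l hbl hrem => ⟨?_, ?_⟩
      · rintro rfl
        refine hcut ⟨l, hbl, ?_⟩
        unfold remaining at hrem
        omega
      · rintro rfl
        have h1 := ha.lt hbl
        have h2 := height_bud_lt ha ho hbl h1 le_rfl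
        unfold remaining at hrem
        omega
    rw [openStep_of_not_cut]
    · refine ⟨T.pos x + 1, Nat.lt_succ_self _, hxN, ?_, ?_, ?_, fun p h1 h2 => by omega⟩
      · have h1 := height_succ_add_charge ha ho x
        by_cases hb : T.IsBud x
        · obtain ⟨l, hl⟩ := ha.exists_leaf hb
          have h2 : T.height (T.pos x) ≠ r := fun e => hcut ⟨l, hl, e⟩
          rw [charge_of_isBud hb, single_of_isBud hb] at h1
          omega
        · have h2 : T.single x ≤ T.charge x := by
            by_cases hh : T.IsHalfEdge x
            · rw [charge_of_isLeaf ⟨hh, fun h => hb ⟨hh, h⟩⟩]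
              unfold single
              split_ifs <;> simp
            · rw [charge_of_not_isHalfEdge hh, single_of_not_isHalfEdge hh]
          omega
      · change S.face x = _
        rw [walk_pos_succ ho, face_apply, face_apply, hopp, h.rot]
      · refine h.congr fun b l hbl => ?_
        have h2 : T.pos b = T.pos x → T.height (T.pos x) ≠ r := fun e e' =>
          hcut ⟨l, (ho _).pos_inj (ho _) e ▸ hbl, e'⟩
        have h3 : T.pos b = T.pos x → T.height (T.pos b) = T.height (T.pos x) := fun e => by rw [e]
        unfold remaining
        omega
    · rintro ⟨h1, h2, h3⟩
      change S.black x at h1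
      rw [h.black] at h1
      refine h3 (hsep (fun hh => h2 ?_) h1)
      change S.opp x = x
      rw [hopp]
      exact hh

/-- After a whole round, the next round starts at the root. -/
theorem remaining_card_iff (ho : ∀ x, T.IsOuter x) (r : ℕ) (b : D) :
    T.remaining r (Fintype.card D) b ↔ T.remaining (r + 1) 0 b := by
  have := pos_lt_card ho b
  unfold remaining
  omega

end Stage
end HalfEdgeMap

/-! ### The closure of a balanced tree is a planar map. -/

namespace HalfEdgeMap

section ClosureIsMap

variable {D : Type} [Fintype D] {T : HalfEdgeMap D}

theorem IsTree.arcSystem (hT : T.IsTree) (hb : T.IsBalanced) : T.ArcSystem T.Matches :=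
  arcSystem_matches hT.1.outer hb

theorem closure_not_isBud (hT : T.IsTree) (hb : T.IsBalanced) (d : D) : ¬ T.closure.IsBud d := by
  have h := isPartialClosure_closure hb
  rintro ⟨h1, h2⟩
  have h1' : T.closure.opp d = d := h1
  rw [h.black] at h2
  by_cases hd : T.IsHalfEdge d
  · obtain ⟨l, hl⟩ := (hT.arcSystem hb).exists_leaf ⟨hd, h2⟩
    rw [h.opp_bud hl trivial] at h1'
    exact bud_ne_leaf hl hl h1'.symm
  · rw [h.opp_of_not_isHalfEdge hd] at h1'
    exact hd h1'

/-- Induction on the position. If the dart just before `x` is a matched leaf, the closure reaches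
`x` directly from its bud, which also has height `0`. Otherwise the previous dart has height `0` and
leads to `x` as in the tree. -/
theorem isOuter_closure_of_height_eq_zero (hT : T.IsTree) (hb : T.IsBalanced) (x : D)
    (hx : T.height (T.pos x) = 0) : T.closure.IsOuter x := by
  have h := isPartialClosure_closure hb
  have ha := hT.arcSystem hb
  have ho := hT.isOuter
  induction hn : T.pos x using Nat.strong_induction_on generalizing x with
  | _ n ih =>
  rcases Nat.eq_zero_or_pos n with h0 | h0
  · have : x = T.closure.root := by
      rw [h.root]
      refine (ho _).pos_inj (ho _) ?_
      rw [pos_root, hn, h0]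
    rw [this]
    exact isOuter_root _
  · obtain ⟨i, rfl⟩ : ∃ i, n = i + 1 := ⟨n - 1, by omega⟩
    have hlt := pos_lt_card ho x
    have hyp : T.pos (T.walk i) = i := pos_walk ho (by omega)
    generalize T.walk i = y at hyp
    subst hyp
    have hyx : T.face y = x := by rw [← walk_pos_succ ho, ← hn, (ho x).walk_pos]
    have hs := height_succ_add_charge ha ho y
    rw [← hn, hx] at hs
    by_cases hm : ∃ b, T.Matches b y
    · obtain ⟨b, hby⟩ := hm
      have h1 : T.closure.face b = x := by
        have hy' : T.opp y = y := hby.isLeaf.1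
        rw [← hyx, face_apply, face_apply, h.opp_bud hby trivial, h.rot, hy']
      rw [← h1]
      refine IsOuter.face (ih _ (Nat.lt_succ_of_lt (ha.lt hby)) b ?_ rfl)
      rw [← height_leaf_succ ha ho hby, ← hn, hx]
    · have hbud : ¬ T.IsBud y := fun hbud => by
        rw [charge_of_isBud hbud, single_of_isBud hbud] at hs
        omega
      have h1 : T.closure.face y = x := by
        rw [← hyx, face_apply, face_apply, h.rot, h.opp_of_not]
        intro b l hbl _
        exact ⟨fun e => hbud (e ▸ hbl.isBud), fun e => hm ⟨b, e ▸ hbl⟩⟩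
      have h2 : T.height (T.pos y) = 0 := by
        by_cases hh : T.IsHalfEdge y
        · exact height_single ha ho ⟨⟨hh, fun h => hbud ⟨hh, h⟩⟩, fun b hby => hm ⟨b, hby⟩⟩
        · rw [charge_of_not_isHalfEdge hh, single_of_not_isHalfEdge hh] at hs
          omega
      rw [← h1]
      exact IsOuter.face (ih _ (Nat.lt_succ_self _) y h2 rfl)

theorem closure_outer (hT : T.IsTree) (hb : T.IsBalanced) : T.closure.HalfEdgesOuter := by
  have h := isPartialClosure_closure hb
  intro d hd
  refine isOuter_closure_of_height_eq_zero hT hb d ?_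
  have hd' : T.closure.opp d = d := hd
  have hh : T.IsHalfEdge d := by
    by_contra hh
    rw [h.opp_of_not_isHalfEdge hh] at hd'
    exact hh hd'
  have hw : ¬ T.black d := fun hw => closure_not_isBud hT hb d ⟨hd, by rwa [h.black]⟩
  refine height_single (hT.arcSystem hb) hT.isOuter ⟨⟨hh, hw⟩, fun b hbd => ?_⟩
  rw [h.opp_leaf hbd trivial] at hd'
  exact bud_ne_leaf hbd hbd hd'

/-- In the closure, the part of the walk that is enclosed by a matched pair is a union of faces. -/
theorem closure_face_mem (hT : T.IsTree) (hb : T.IsBalanced) {b l x : D} (hbl : T.Matches b l)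
    (h1 : T.pos b < T.pos x) (h2 : T.pos x ≤ T.pos l) :
    T.pos b < T.pos (T.closure.face x) ∧ T.pos (T.closure.face x) ≤ T.pos l := by
  have h := isPartialClosure_closure hb
  have ha := hT.arcSystem hb
  have ho := hT.isOuter
  have hlN := pos_lt_card ho l
  have hlt := ha.lt hbl
  have hface : ∀ y, T.opp y = y → T.pos y < T.pos l → T.pos (T.rot y) = T.pos y + 1 := by
    intro y hy hyl
    have := walk_pos_succ ho y
    rw [face_apply, hy] at this
    rw [← this, pos_walk ho (by omega)]
  by_cases hbud : T.IsBud x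
  · obtain ⟨l', hl'⟩ := ha.exists_leaf hbud
    have hne : T.pos x ≠ T.pos l := fun e => bud_ne_leaf hl' hbl ((ho _).pos_inj (ho _) e)
    have h3 := ha.lt_of_bud_lt hbl hl' h1 (by omega)
    have h4 := ha.lt hl'
    rw [face_apply, h.opp_bud hl' trivial, h.rot, hface l' hl'.isLeaf.1 h3]
    omega
  · by_cases hm : ∃ b', T.Matches b' x
    · obtain ⟨b', hb'⟩ := hm
      have h3 : T.pos b ≤ T.pos b' := by
        rcases h2.lt_or_eq with h2 | h2
        · exact (ha.lt_of_lt_leaf hbl hb' h1 h2).le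
        · have := (ho _).pos_inj (ho _) h2
          subst this
          rw [ha.left_unique hbl hb']
      have h4 := ha.lt hb'
      rw [face_apply, h.opp_leaf hb' trivial, h.rot, hface b' hb'.isBud.1 (by omega)]
      omega
    · have hopp : T.closure.opp x = T.opp x := h.opp_of_not fun b' l' hbl' _ =>
        ⟨fun e => hbud (e ▸ hbl'.isBud), fun e => hm ⟨b', e ▸ hbl'⟩⟩
      have hne : T.pos x ≠ T.pos l := fun e => hm ⟨b, (ho _).pos_inj (ho _) e ▸ hbl⟩
      rw [face_apply, hopp, h.rot, ← face_apply, ← walk_pos_succ ho, pos_walk ho (by omega)]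
      omega

/-- The face of a matched leaf stays within the interval of its pair, where the leaf is last.
Different matched leaves thus have different faces, none of which contains the root. -/
theorem card_buds_lt_card_faces_closure (hT : T.IsTree) (hb : T.IsBalanced) :
    T.buds.card + 1 ≤ T.closure.faces.card := by
  classical
  have ha := hT.arcSystem hb
  have ho := hT.isOuter
  choose f hf using fun b : {b // T.IsBud b} => ha.exists_leaf b.2
  have hinv : ∀ {b l y}, T.Matches b l → T.closure.face.SameCycle l y →
      T.pos b < T.pos y ∧ T.pos y ≤ T.pos l := fun hbl hy =>
    hy.of_invariant (fun y => T.pos _ < T.pos y ∧ T.pos y ≤ T.pos _) ⟨ha.lt hbl, le_rfl⟩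
      fun z hz => closure_face_mem hT hb hbl hz.1 hz.2
  let g : Option {b // T.IsBud b} → Quotient (Equiv.Perm.SameCycle.setoid T.closure.face) :=
    fun o => Quotient.mk _ (o.elim T.root f)
  have hroot : ∀ b, g (some b) ≠ g none := fun b e => by
    have := (hinv (hf b) (Quotient.exact e)).1
    dsimp only [Option.elim] at this
    rw [pos_root] at this
    omega
  have hg : Function.Injective g := by
    rintro (_ | b) (_ | b') e
    · rfl
    · exact absurd e.symm (hroot b')
    · exact absurd e (hroot b)
    · have e' : T.closure.face.SameCycle (f b) (f b') := Quotient.exact e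
      have h1 := (hinv (hf b) e').2
      have h2 := (hinv (hf b') e'.symm).2
      have h3 : f b = f b' := (ho _).pos_inj (ho _) (le_antisymm h2 h1)
      have h4 := hf b'
      rw [← h3] at h4
      exact congrArg some (Subtype.ext (ha.left_unique (hf b) h4))
  have := Nat.card_le_card_of_injective g hg
  rw [Finite.card_option, Nat.card_eq_fintype_card, Fintype.card_subtype] at this
  rw [card_faces]
  unfold buds
  convert this

theorem card_halfEdges (M : HalfEdgeMap D) : M.halfEdges.card = M.leaves.card + M.buds.card := by
  classical
  have h1 : M.halfEdges = M.leaves ∪ M.buds := by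
    ext x
    simp only [halfEdges, leaves, buds, IsLeaf, IsBud, Finset.mem_filter, Finset.mem_univ,
      true_and, Finset.mem_union]
    tauto
  rw [h1, Finset.card_union_of_disjoint]
  rw [Finset.disjoint_left]
  intro x hx hx'
  simp only [leaves, buds, Finset.mem_filter, Finset.mem_univ, true_and] at hx hx'
  exact hx.2 hx'.2

theorem totalCharge_congr {M M' : HalfEdgeMap D} (h : M'.black = M.black) :
    M'.totalCharge = M.totalCharge := by
  rw [totalCharge_eq_sum_colour, totalCharge_eq_sum_colour]
  unfold colour
  rw [h]

theorem card_buds_eq_zero_iff {M : HalfEdgeMap D} : M.buds.card = 0 ↔ ∀ d, ¬ M.IsBud d := by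
  classical
  simp [buds, Finset.filter_eq_empty_iff]

/-- Closure adds one edge per bud and at least as many faces. The genus inequality prevents more, so
Euler's relation holds. -/
theorem closure_isMap (hT : T.IsTree) (hb : T.IsBalanced) : T.closure.IsMap := by
  have h := isPartialClosure_closure hb
  have hconn := h.isConnected hT.1.connected
  refine ⟨hconn, ?_, closure_outer hT hb⟩
  have h1 := T.closure.card_vertices_add_card_faces_le
  rw [numComponents_of_isConnected hconn] at h1
  have h2 := card_buds_lt_card_faces_closure hT hb
  have h3 := T.two_mul_card_edges
  have h4 := T.closure.two_mul_card_edges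
  have h5 := T.card_halfEdges
  have h6 := T.closure.card_halfEdges
  have h7 := card_buds_eq_zero_iff.2 (closure_not_isBud hT hb)
  have h8 := totalCharge_congr h.black
  unfold totalCharge at h8
  have h9 := hT.1.euler
  have h10 := hT.2
  have h11 : T.closure.vertices.card = T.vertices.card := by
    rw [card_vertices, card_vertices, h.rot]
  omega

theorem isLegMap_of_totalCharge {M : HalfEdgeMap D} (hM : M.IsMap) (hb : ∀ d, ¬ M.IsBud d)
    {m : ℕ} (hm : M.totalCharge = m) : M.IsLegMap m := by
  have h := card_buds_eq_zero_iff.2 hb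
  refine ⟨hM, ?_, h⟩
  unfold totalCharge at hm
  omega

end ClosureIsMap

/-! ### The blossom condition as the criterion for opening to undo closure. -/

section Iterate

variable {D : Type}

theorem isSeparating_opp {M : HalfEdgeMap D} (d : D) :
    M.IsSeparating (M.opp d) ↔ M.IsSeparating d := by
  unfold IsSeparating
  rw [cut_opp_comm]

theorem openState_opp_eq_self {M : HalfEdgeMap D} {n : ℕ} {x : D}
    (h : (M.openState n).1.opp x = x) {k : ℕ} (hk : n ≤ k) : (M.openState k).1.opp x = x := by
  induction k, hk using Nat.le_induction with
  | base => exact h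
  | succ k hk ih =>
    rw [openState_succ]
    by_cases hc : (M.openState k).1.black (M.openState k).2 ∧
        ¬ (M.openState k).1.IsHalfEdge (M.openState k).2 ∧
        ¬ (M.openState k).1.IsSeparating (M.openState k).2
    · rw [openStep_of_cut hc]
      exact ((M.openState k).1.cut_isHalfEdge_iff _ x).2 (Or.inl ih)
    · rw [openStep_of_not_cut hc]
      exact ih

theorem openState_of_allSeparating {M : HalfEdgeMap D} {n : ℕ}
    (h : (M.openState n).1.AllSeparating) {k : ℕ} (hk : n ≤ k) :
    (M.openState k).1 = (M.openState n).1 := by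
  induction k, hk using Nat.le_induction with
  | base => rfl
  | succ k hk ih =>
    rw [openState_succ, openStep_of_not_cut]
    · exact ih
    · rintro ⟨-, h1, h2⟩
      rw [ih] at h1 h2
      exact h2 (h _ h1)

end Iterate

section Blossom

variable {D : Type} [Fintype D] {T S : HalfEdgeMap D}

theorem IsTree.pos_ne (hT : T.IsTree) {d x : D} (hd : ¬ T.IsHalfEdge d) (hx : T.IsHalfEdge x) :
    T.pos x ≠ T.pos d :=
  fun e => hd ((hT.isOuter x).pos_inj (hT.isOuter d) e ▸ hx)

/-- In a balanced blossom tree, the edges that are visited from black to white by the opening walk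
are separating. -/
theorem IsBlossomTree.isSeparating (hB : T.IsBlossomTree) (hb : T.IsBalanced) {m : ℕ}
    (hc : T.totalCharge = m) (hm : T.DegreesDivisibleBy m) {r : ℕ} {x : D}
    (h : T.IsPartialClosure S (T.remaining r (T.pos x))) (hx : T.height (T.pos x) ≤ r)
    (hd : ¬ T.IsHalfEdge x) (hblack : T.black x) : S.IsSeparating x := by
  have hT := hB.1
  have ho := hT.isOuter
  have ha := hT.arcSystem hb
  have hd' := opp_not_isHalfEdge hd
  have hpair : ∀ {b l}, T.Matches b l → T.pos b ≠ T.pos x ∧ T.pos l ≠ T.pos x ∧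
      T.pos b ≠ T.pos (T.opp x) ∧ T.pos l ≠ T.pos (T.opp x) ∧ T.pos b < T.pos l := fun hbl =>
    ⟨hT.pos_ne hd hbl.isBud.1, hT.pos_ne hd hbl.isLeaf.1, hT.pos_ne hd' hbl.isBud.1,
      hT.pos_ne hd' hbl.isLeaf.1, ha.lt hbl⟩
  rcases lt_or_gt_of_ne (pos_opp_ne ho hd) with hlt | hlt
  · have hroot := (hT.root_not_mem_subtree hd).2 hlt
    have h1 := ((hB.2 x hd hroot).1 hblack)
    have h2 := hT.height_add_subtreeCharge ha hd hlt
    have h3 := sum_single_subtree_nonneg (T := T) x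
    rw [h.isSeparating_iff hT hd]
    -- The walk leaves the lower subtree. A pair straddling its end has a bud of height below `r`;
    -- one straddling its beginning has a bud of height at most `r`, because the height drops by at
    -- most one along the subtree, and this bud comes before the current position. Neither remains.
    intro b l hbl hrem
    rw [hT.mem_subtree_iff hd hlt, hT.mem_subtree_iff hd hlt]
    have h4 := hpair hbl
    have h5 := fun a b => height_bud_lt ha ho hbl (q := T.pos x) a b
    have h6 := fun a b => height_bud_lt ha ho hbl (q := T.pos (T.opp x)) a b
    unfold remaining at hrem
    omega
  · have hlt' : T.pos (T.opp (T.opp x)) < T.pos (T.opp x) := by rwa [T.opp_opp]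
    have hroot := (hT.root_not_mem_subtree hd').2 hlt'
    have hw : ¬ T.black (T.opp x) := fun h => (T.black_opp x hd).1 h hblack
    have h1 := (hB.2 _ hd' hroot).2 hw
    have h2 := hT.height_add_subtreeCharge ha hd' hlt'
    have h3 := sum_single_subtree_lt ha ho hb hroot
    have h7 := hT.dvd_subtreeCharge hm hd'
    have h8 : T.colour (T.opp x) = 1 := by simp [colour, hw]
    rw [h8] at h7
    -- The charge is at least `m - 1` and there are at most `m - 1` single leaves, so the height
    -- does not increase along the subtree.
    have h9 := Int.le_of_dvd (by omega) h7
    rw [T.opp_opp] at h2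
    have hsep := h.isSeparating_iff hT hd'
    rw [← h.opp_of_not_isHalfEdge hd, isSeparating_opp, h.opp_of_not_isHalfEdge hd] at hsep
    rw [hsep]
    -- A pair straddling either end of the subtree now has a bud of height below `r`, and is already
    -- cut.
    intro b l hbl hrem
    rw [hT.mem_subtree_iff hd' hlt', hT.mem_subtree_iff hd' hlt', T.opp_opp]
    have h4 := hpair hbl
    have h5 := fun a b => height_bud_lt ha ho hbl (q := T.pos x) a b
    have h6 := fun a b => height_bud_lt ha ho hbl (q := T.pos (T.opp x)) a b
    unfold remaining at hrem
    omega

/-- Every state of the walk is a partial closure of `T`. In the final one all edges are separating,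
whereas a fused pair never is; so no pair is fused any more. -/
theorem opening_closure (hB : T.IsBlossomTree) (hb : T.IsBalanced) {m : ℕ}
    (hc : T.totalCharge = m) (hm : T.DegreesDivisibleBy m) : T.closure.opening = T := by
  have hT := hB.1
  have ho := hT.isOuter
  have ha := hT.arcSystem hb
  have hinv : ∀ n, ∃ r q, q < Fintype.card D ∧ T.height q ≤ r ∧
      (T.closure.openState n).2 = T.walk q ∧
      T.IsPartialClosure (T.closure.openState n).1 (T.remaining r q) := by
    have hD : 0 < Fintype.card D := Fintype.card_pos_iff.2 ⟨T.root⟩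
    intro n
    induction n with
    | zero =>
      have h := isPartialClosure_closure hb
      refine ⟨0, 0, hD, height_zero.le, h.root, h.congr fun b l _ => ?_⟩
      unfold remaining
      simp only [true_iff]
      omega
    | succ n ih =>
      obtain ⟨r, q, hq, hqr, hw, hp⟩ := ih
      rw [openState_succ]
      generalize T.closure.openState n = s at hw hp
      obtain ⟨S, x⟩ := s
      dsimp only at hw hp
      have hpos : T.pos x = q := by rw [hw, pos_walk ho hq]
      subst hpos
      obtain ⟨q', -, h2, h3, h4, h5, -⟩ := hp.openStep hT ha hqr
        (hB.isSeparating hb hc hm hp hqr)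
      rcases h2.lt_or_eq with h2 | h2
      · exact ⟨r, q', h2, h3, h4, h5⟩
      -- Position `card D` is the root again: the next round begins.
      · subst h2
        refine ⟨r + 1, 0, hD, height_zero.le.trans (Nat.zero_le _), ?_, h5.congr fun b l _ =>
          remaining_card_iff ho r b⟩
        rw [h4, walk_card ho, walk_zero]
  have hall := opening_allSeparating (closure_isMap hT hb) (closure_not_isBud hT hb)
  unfold opening at hall ⊢
  obtain ⟨r, q, -, -, -, hp⟩ :=
    hinv (sInf {n : ℕ | (T.closure.openState n).1.AllSeparating})
  refine hp.eq_of_empty fun b l hbl hrem => ?_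
  refine hp.not_isSeparating_bud hT.1.connected hbl hrem (hall b fun hh => ?_)
  have hh' := hp.opp_bud hbl hrem
  rw [hh] at hh'
  exact bud_ne_leaf hbl hbl hh'

/-- The opening walk does not cut the edges of the opening. -/
theorem isSeparating_openState {M : HalfEdgeMap D} (hM : M.IsMap) (hb : ∀ d, ¬ M.IsBud d) (n : ℕ)
    (h : ¬ M.opening.IsHalfEdge (M.openState n).2)
    (h1 : (M.openState n).1.black (M.openState n).2)
    (h2 : ¬ (M.openState n).1.IsHalfEdge (M.openState n).2) :
    (M.openState n).1.IsSeparating (M.openState n).2 := by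
  by_contra hcon
  have hall := opening_allSeparating hM hb
  unfold opening at h hall
  rcases le_or_gt (sInf {n : ℕ | (M.openState n).1.AllSeparating}) n with hle | hlt
  · have := openState_of_allSeparating hall hle
    rw [this] at hcon h2
    exact hcon (hall _ h2)
  · refine h (openState_opp_eq_self (n := n + 1) ?_ hlt)
    rw [openState_succ, openStep_of_cut ⟨h1, h2, hcon⟩]
    exact cut_opp_self _ _

/-- If the opening of the closure of `T` is `T`, then the opening walk visits the position `q` in
every round `r` with `height q ≤ r`. -/
theorem exists_openState (hT : T.IsTree) (hb : T.IsBalanced) (hop : T.closure.opening = T)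
    (r q : ℕ) (hq : q ≤ Fintype.card D) (hr : T.height q ≤ r) :
    ∃ n, (T.closure.openState n).2 = T.walk q ∧
      T.IsPartialClosure (T.closure.openState n).1 (T.remaining r q) := by
  have ho := hT.isOuter
  have ha := hT.arcSystem hb
  have key : ∀ r q₀, q₀ ≤ Fintype.card D → T.height q₀ ≤ r →
      (∃ n, (T.closure.openState n).2 = T.walk q₀ ∧
        T.IsPartialClosure (T.closure.openState n).1 (T.remaining r q₀)) →
      ∀ q, q₀ ≤ q → q ≤ Fintype.card D → T.height q ≤ r →
        ∃ n, (T.closure.openState n).2 = T.walk q ∧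
          T.IsPartialClosure (T.closure.openState n).1 (T.remaining r q) := by
    intro r q₀ hq₀ hr₀ hex q hqq hq hr
    induction hk : q - q₀ using Nat.strong_induction_on generalizing q₀ with
    | _ k ih =>
    rcases hqq.eq_or_lt with rfl | hqq
    · exact hex
    obtain ⟨n, hw, hp⟩ := hex
    have hsep := isSeparating_openState (closure_isMap hT hb) (closure_not_isBud hT hb) n
    have hnext := T.closure.openState_succ n
    rw [hop] at hsep
    generalize T.closure.openState n = s at hw hp hsep hnext
    obtain ⟨S, x⟩ := s
    dsimp only at hw hp hsep
    have hpos : T.pos x = q₀ := by rw [hw, pos_walk ho (by omega)]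
    subst hpos
    obtain ⟨q', h1, h2, h3, h4, h5, h6⟩ := hp.openStep hT ha hr₀ fun hx hblack => by
      refine hsep hx (by rwa [hp.black]) fun hh => hx ?_
      have hh' : S.opp x = x := hh
      rwa [hp.opp_of_not_isHalfEdge hx] at hh'
    -- A single step only jumps over positions of height above `r`, so it cannot pass `q`.
    have hq' : q' ≤ q := by
      by_contra! hlt
      have := h6 q hqq hlt
      omega
    refine ih (q - q') (by omega) q' h2 h3 ⟨n + 1, ?_, ?_⟩ hq' rfl
    · rw [hnext, h4]
    · rw [hnext]
      exact h5
  have hround : ∀ r, ∃ n, (T.closure.openState n).2 = T.walk 0 ∧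
      T.IsPartialClosure (T.closure.openState n).1 (T.remaining r 0) := by
    intro r
    induction r with
    | zero =>
      have h := isPartialClosure_closure hb
      refine ⟨0, h.root, h.congr fun b l _ => ?_⟩
      unfold remaining
      simp only [true_iff]
      omega
    | succ r ih =>
      obtain ⟨n, h1, h2⟩ := key r 0 (Nat.zero_le _) (height_zero.le.trans (Nat.zero_le _)) ih _
        (Nat.zero_le _) le_rfl ((height_card ho).le.trans (Nat.zero_le _))
      refine ⟨n, ?_, h2.congr fun b l _ => remaining_card_iff ho r b⟩
      rw [h1, walk_card ho, walk_zero]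
  exact key r 0 (Nat.zero_le _) (height_zero.le.trans (Nat.zero_le _)) (hround r) q
    (Nat.zero_le _) hq hr

/-- In round `height (pos x)` of the opening walk, the edge of a black dart `x` is separating. -/
theorem exists_isSeparating (hT : T.IsTree) (hb : T.IsBalanced) (hop : T.closure.opening = T)
    {x : D} (hx : ¬ T.IsHalfEdge x) (hblack : T.black x) :
    ∃ S : HalfEdgeMap D,
      T.IsPartialClosure S (T.remaining (T.height (T.pos x)) (T.pos x)) ∧ S.IsSeparating x := by
  have ho := hT.isOuter
  obtain ⟨n, hw, hp⟩ := exists_openState hT hb hop (T.height (T.pos x)) (T.pos x)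
    (pos_lt_card ho x).le le_rfl
  refine ⟨_, hp, ?_⟩
  rw [(ho x).walk_pos] at hw
  have hsep := isSeparating_openState (closure_isMap hT hb) (closure_not_isBud hT hb) n
  rw [hop, hw] at hsep
  refine hsep hx (by rwa [hp.black]) fun hh => hx ?_
  have hh' : (T.closure.openState n).1.opp x = x := hh
  rwa [hp.opp_of_not_isHalfEdge hx] at hh'

/-- If a charge violates the condition, the heights at the two ends of the subtree differ enough for
the innermost pair around the higher end to be still fused when the edge is followed from black to
white, and to join its two sides. The edge would not be separating. -/
theorem isBlossomTree_of_opening_closure (hT : T.IsTree) (hb : T.IsBalanced)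
    (hop : T.closure.opening = T) {m : ℕ} (hc : T.totalCharge = m)
    (hm : T.DegreesDivisibleBy m) : T.IsBlossomTree := by
  have ho := hT.isOuter
  have ha := hT.arcSystem hb
  refine ⟨hT, fun d hd hroot => ?_⟩
  have hlt := (hT.root_not_mem_subtree hd).1 hroot
  have hd' := opp_not_isHalfEdge hd
  have h2 := hT.height_add_subtreeCharge ha hd hlt
  have h3 := sum_single_subtree_nonneg (T := T) d
  have h4 := sum_single_subtree_lt ha ho hb hroot
  have h5 := hT.dvd_subtreeCharge hm hd
  have hpair : ∀ {b l}, T.Matches b l → T.pos b ≠ T.pos d ∧ T.pos l ≠ T.pos d ∧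
      T.pos b ≠ T.pos (T.opp d) ∧ T.pos l ≠ T.pos (T.opp d) ∧ T.pos b < T.pos l := fun hbl =>
    ⟨hT.pos_ne hd hbl.isBud.1, hT.pos_ne hd hbl.isLeaf.1, hT.pos_ne hd' hbl.isBud.1,
      hT.pos_ne hd' hbl.isLeaf.1, ha.lt hbl⟩
  constructor
  · intro hblack
    by_contra! hcon
    have h6 : T.colour d = -1 := by simp [colour, hblack]
    rw [h6] at h5
    -- The charge is at least `m + 1` against at most `m - 1` single leaves: the height is larger by
    -- at least two where the walk enters the subtree.
    have h7 := Int.le_of_dvd (by omega) h5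
    obtain ⟨S, hp, hsep⟩ := exists_isSeparating hT hb hop hd hblack
    rw [hp.isSeparating_iff hT hd] at hsep
    obtain ⟨b, l, hbl, h8, h9, h10⟩ := exists_innermost ho (q := T.pos (T.opp d)) (by omega)
    have h11 := hsep b l hbl (Or.inl (by omega))
    rw [hT.mem_subtree_iff hd hlt, hT.mem_subtree_iff hd hlt] at h11
    have h12 := hpair hbl
    have h13 := fun a c => height_bud_lt ha ho hbl (q := T.pos d) a c
    omega
  · intro hw
    by_contra! hcon
    have hblack : T.black (T.opp d) := (T.black_opp d hd).2 hw
    obtain ⟨S, hp, hsep⟩ := exists_isSeparating hT hb hop hd' hblack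
    rw [← hp.opp_of_not_isHalfEdge hd, isSeparating_opp, hp.isSeparating_iff hT hd] at hsep
    -- The height is larger at `d`, where the subtree ends. The chosen bud cannot precede the
    -- subtree, since its height would then be too small; its leaf comes after `d`.
    obtain ⟨b, l, hbl, h8, h9, h10⟩ := exists_innermost ho (q := T.pos d) (by omega)
    have h12 := hpair hbl
    have h13 := fun a c => height_bud_lt ha ho hbl (q := T.pos (T.opp d)) a c
    have h11 := hsep b l hbl (by unfold remaining; omega)
    rw [hT.mem_subtree_iff hd hlt, hT.mem_subtree_iff hd hlt] at h11
    omega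

end Blossom

section Degrees

variable {D : Type} [Fintype D] {M M' : HalfEdgeMap D}

theorem degreeDistribution_congr (hrot : M'.rot = M.rot) (hblack : M'.black = M.black) :
    M'.degreeDistribution = M.degreeDistribution := by
  have h : M'.vertexOf = M.vertexOf := by
    unfold vertexOf
    rw [hrot]
  unfold degreeDistribution whiteVertices blackVertices
  rw [h, hblack]

theorem DegreesDivisibleBy.congr (hrot : M'.rot = M.rot) {m : ℕ} (h : M.DegreesDivisibleBy m) :
    M'.DegreesDivisibleBy m := by
  have h' : M'.vertices = M.vertices := by
    unfold vertices vertexOf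
    rw [hrot]
  intro v hv
  exact h v (h' ▸ hv)

end Degrees
end HalfEdgeMap

/-! ### Passage to isomorphism classes. -/

namespace RootedMap

theorem closure_mk {n : ℕ} (M : HalfEdgeMap (Fin n)) : closure (mk M) = mk M.closure := rfl

theorem opening_mk {n : ℕ} (M : HalfEdgeMap (Fin n)) : opening (mk M) = mk M.opening := rfl

theorem degreeDistribution_mk {n : ℕ} (M : HalfEdgeMap (Fin n)) :
    degreeDistribution (mk M) = M.degreeDistribution := rfl

theorem mapsTo_closure (m : ℕ) : Set.MapsTo closure (balancedBlossomTrees m) (legMaps m) := by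
  rintro _ ⟨n, T, rfl, hB, hb, hc, hm⟩
  have h := HalfEdgeMap.isPartialClosure_closure hb
  refine ⟨n, T.closure, (closure_mk T).symm, ?_, hm.congr h.rot⟩
  exact HalfEdgeMap.isLegMap_of_totalCharge (HalfEdgeMap.closure_isMap hB.1 hb)
    (HalfEdgeMap.closure_not_isBud hB.1 hb) ((HalfEdgeMap.totalCharge_congr h.black).trans hc)

theorem mapsTo_opening (m : ℕ) : Set.MapsTo opening (legMaps m) (balancedBlossomTrees m) := by
  rintro _ ⟨n, M, rfl, ⟨hM, hl, hb⟩, hm⟩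
  have hb' := HalfEdgeMap.card_buds_eq_zero_iff.1 hb
  obtain ⟨R, hR⟩ := HalfEdgeMap.isOpened_opening hM hb'
  have hT := HalfEdgeMap.isTree_opening hM hb'
  have hbal := HalfEdgeMap.isBalanced_opening hM hb'
  have hc : M.opening.totalCharge = m := by
    rw [HalfEdgeMap.totalCharge_congr hR.black, HalfEdgeMap.totalCharge, hl, hb]
    simp
  have hdeg := hm.congr hR.rot
  refine ⟨n, M.opening, (opening_mk M).symm, ?_, hbal, hc, hdeg⟩
  exact HalfEdgeMap.isBlossomTree_of_opening_closure hT hbal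
    -- For an opening, recovery by closure already supplies the premise of the criterion.
    (by rw [HalfEdgeMap.closure_opening hM hb']) hc hdeg

theorem invOn_opening_closure (m : ℕ) :
    Set.InvOn opening closure (balancedBlossomTrees m) (legMaps m) := by
  constructor
  · rintro _ ⟨n, T, rfl, hB, hb, hc, hm⟩
    rw [closure_mk, opening_mk, HalfEdgeMap.opening_closure hB hb hc hm]
  · rintro _ ⟨n, M, rfl, ⟨hM, -, hb⟩, -⟩
    rw [opening_mk, closure_mk,
      HalfEdgeMap.closure_opening hM (HalfEdgeMap.card_buds_eq_zero_iff.1 hb)]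

end RootedMap

theorem mainTheorem4 (m : ℕ) (hm : 3 ≤ m) :
    Set.BijOn RootedMap.closure
        (RootedMap.balancedBlossomTrees m) (RootedMap.legMaps m) ∧
      Set.BijOn RootedMap.opening
        (RootedMap.legMaps m) (RootedMap.balancedBlossomTrees m) ∧
      Set.InvOn RootedMap.opening RootedMap.closure
        (RootedMap.balancedBlossomTrees m) (RootedMap.legMaps m) ∧
      (∀ T ∈ RootedMap.balancedBlossomTrees m,
        (RootedMap.closure T).degreeDistribution = T.degreeDistribution) ∧
      (∀ M ∈ RootedMap.legMaps m,
        (RootedMap.opening M).degreeDistribution = M.degreeDistribution) := by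
  have hinv := RootedMap.invOn_opening_closure m
  have h1 := RootedMap.mapsTo_closure m
  have h2 := RootedMap.mapsTo_opening m
  refine ⟨hinv.bijOn h1 h2, hinv.symm.bijOn h2 h1, hinv, ?_, ?_⟩
  · rintro _ ⟨n, T, rfl, hB, hb, -, -⟩
    have h := HalfEdgeMap.isPartialClosure_closure hb
    rw [RootedMap.closure_mk, RootedMap.degreeDistribution_mk, RootedMap.degreeDistribution_mk]
    exact HalfEdgeMap.degreeDistribution_congr h.rot h.black
  · rintro _ ⟨n, M, rfl, ⟨hM, -, hb⟩, -⟩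
    obtain ⟨R, hR⟩ := HalfEdgeMap.isOpened_opening hM (HalfEdgeMap.card_buds_eq_zero_iff.1 hb)
    rw [RootedMap.opening_mk, RootedMap.degreeDistribution_mk, RootedMap.degreeDistribution_mk]
    exact HalfEdgeMap.degreeDistribution_congr hR.rot hR.black
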